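/- Let $0\le a<M$ and let $K$ be the domain of outer communication $\{r>M+\sqrt{M^2-a^2}\}$ (axis included) of the subcritical Kerr spacetime of mass $M$ and angular momentum parameter $a$, with Boyer--Lindquist coordinates $(t,r,\vartheta,\varphi)$, $g$ being the Kerr metric and $t$ increasing to the future. A photon in $K$ is an inextendible null geodesic; it is called trapped if its orbit in the quotient of $K$ by the flow of the stationary Killing field $\partial_t$ is contained in a compact subset of that quotient. Let $P\subseteq T^*K$ be the photon region, i.e. the set of all $\bigl(\gamma(0), g(\dot\gamma(0),\cdot)\bigr)$ where $\gamma$ is a future-directed trapped photon whose parameter interval contains $0$, and let $$P_0=\{(m,p)\in P : t(m)=0,\ p_0=p(\partial_t)=-1\},$$ with the subspace topology of $T^*K$. Then $P_0$ is path-connected, and its fundamental group (at any base point) is isomorphic to $\mathbb Z_2=\mathbb Z/2\mathbb Z$. -/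

import Mathlib

noncomputable section

namespace Kerr

/-! The domain of outer communication of the Kerr spacetime, its axis included, is the open
subset `r > M + √(M² - a²)` of `ℝ × ℝ³`, with global coordinates `q = (t, x, y, z)`, where
`x = r sin ϑ cos φ`, `y = r sin ϑ sin φ`, `z = r cos ϑ` and `(t, r, ϑ, φ)` are the
Boyer-Lindquist coordinates. -/

/-- The Boyer-Lindquist radius. -/
def radius (q : Fin 4 → ℝ) : ℝ := √(q 1 ^ 2 + q 2 ^ 2 + q 3 ^ 2)

/-- `ρ² = r² + a² cos² ϑ`. -/
def rhoSq (a : ℝ) (q : Fin 4 → ℝ) : ℝ := radius q ^ 2 + a ^ 2 * (q 3 / radius q) ^ 2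

/-- `Δ = r² - 2 M r + a²`. -/
def Delta (M a : ℝ) (q : Fin 4 → ℝ) : ℝ := radius q ^ 2 - 2 * M * radius q + a ^ 2

/-- The domain of outer communication. -/
def DOC (M a : ℝ) : Set (Fin 4 → ℝ) := {q | M + √(M ^ 2 - a ^ 2) < radius q}

/-- The components of the one-form `dt`. -/
def dt : Fin 4 → ℝ := ![1, 0, 0, 0]

/-- The components of the one-form `dr`. -/
def dr (q : Fin 4 → ℝ) : Fin 4 → ℝ :=
  ![0, q 1 / radius q, q 2 / radius q, q 3 / radius q]

/-- The components of the one-form `sin² ϑ dφ = (x dy - y dx) / r²`, smooth across the axis. -/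
def sinSqDphi (q : Fin 4 → ℝ) : Fin 4 → ℝ :=
  ![0, -q 2 / radius q ^ 2, q 1 / radius q ^ 2, 0]

/-- The components of the flat spatial metric `dx² + dy² + dz²`. -/
def flat : Matrix (Fin 4) (Fin 4) ℝ := Matrix.diagonal ![0, 1, 1, 1]

/-- The components of the Kerr metric in the coordinates `(t, x, y, z)`, i.e. the smooth extension
over the axis of the metric given by the usual expression in Boyer-Lindquist coordinates (see
`metric_boyerLindquist`). It is obtained from that expression by
`r² (dϑ² + sin² ϑ dφ²) = dx² + dy² + dz² - dr²` and
`(r² + a²) ρ² + 2 M r a² sin² ϑ = 𝒜`. -/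
def metric (M a : ℝ) (q : Fin 4 → ℝ) : Matrix (Fin 4) (Fin 4) ℝ := fun μ ν =>
  -(1 - 2 * M * radius q / rhoSq a q) * (dt μ * dt ν)
    + rhoSq a q / Delta M a q * (dr q μ * dr q ν)
    + rhoSq a q / radius q ^ 2 * (flat μ ν - dr q μ * dr q ν)
    - 2 * M * radius q * a / rhoSq a q * (dt μ * sinSqDphi q ν + sinSqDphi q μ * dt ν)
    + a ^ 2 * (1 + 2 * M * radius q / rhoSq a q) * (sinSqDphi q μ * sinSqDphi q ν)

/-- The squared length of a vector in terms of the one-forms that define the metric. -/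
theorem sum_metric (M a : ℝ) (q v : Fin 4 → ℝ) :
    ∑ μ, ∑ ν, metric M a q μ ν * v μ * v ν =
      -(1 - 2 * M * radius q / rhoSq a q) * v 0 ^ 2
        + rhoSq a q / Delta M a q * (∑ μ, dr q μ * v μ) ^ 2
        + rhoSq a q / radius q ^ 2 *
          (v 1 ^ 2 + v 2 ^ 2 + v 3 ^ 2 - (∑ μ, dr q μ * v μ) ^ 2)
        - 4 * M * radius q * a / rhoSq a q * v 0 * (∑ μ, sinSqDphi q μ * v μ)
        + a ^ 2 * (1 + 2 * M * radius q / rhoSq a q) * (∑ μ, sinSqDphi q μ * v μ) ^ 2 := by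
  simp [metric, Fin.sum_univ_four, dt, dr, sinSqDphi, flat, Matrix.diagonal_apply]
  ring

/-- The Cartesian coordinates of the point with Boyer-Lindquist coordinates `(t, r, ϑ, φ)`. -/
def ofBoyerLindquist (t r ϑ φ : ℝ) : Fin 4 → ℝ :=
  ![t, r * Real.sin ϑ * Real.cos φ, r * Real.sin ϑ * Real.sin φ, r * Real.cos ϑ]

/-- The Kerr line element in Boyer-Lindquist coordinates: the squared length of the velocity of a
curve `(t, r, ϑ, φ)` where `r > 0` and `Δ ≠ 0`. -/
theorem metric_boyerLindquist (M a : ℝ) (t r ϑ φ : ℝ → ℝ) (s t' r' ϑ' φ' : ℝ)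
    (ht : HasDerivAt t t' s) (hr : HasDerivAt r r' s) (hϑ : HasDerivAt ϑ ϑ' s)
    (hφ : HasDerivAt φ φ' s) (hpos : 0 < r s) (hΔ : r s ^ 2 - 2 * M * r s + a ^ 2 ≠ 0)
    (v : Fin 4 → ℝ)
    (hv : v = deriv (fun s => ofBoyerLindquist (t s) (r s) (ϑ s) (φ s)) s)
    (S C ρ2 Δ A : ℝ) (hS : S = Real.sin (ϑ s)) (hC : C = Real.cos (ϑ s))
    (hρ : ρ2 = r s ^ 2 + a ^ 2 * C ^ 2) (hD : Δ = r s ^ 2 - 2 * M * r s + a ^ 2)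
    (hA : A = (r s ^ 2 + a ^ 2) ^ 2 - Δ * a ^ 2 * S ^ 2) :
    ∑ μ, ∑ ν, metric M a (ofBoyerLindquist (t s) (r s) (ϑ s) (φ s)) μ ν * v μ * v ν =
      -(1 - 2 * M * r s / ρ2) * t' ^ 2 + ρ2 / Δ * r' ^ 2 + ρ2 * ϑ' ^ 2
        - 4 * M * r s * a * S ^ 2 / ρ2 * t' * φ' + A / ρ2 * S ^ 2 * φ' ^ 2 := by
  have hder : HasDerivAt (fun s => ofBoyerLindquist (t s) (r s) (ϑ s) (φ s))
      ![t', (r' * Real.sin (ϑ s) + r s * (Real.cos (ϑ s) * ϑ')) * Real.cos (φ s)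
          + r s * Real.sin (ϑ s) * (-Real.sin (φ s) * φ'),
        (r' * Real.sin (ϑ s) + r s * (Real.cos (ϑ s) * ϑ')) * Real.sin (φ s)
          + r s * Real.sin (ϑ s) * (Real.cos (φ s) * φ'),
        r' * Real.cos (ϑ s) + r s * (-Real.sin (ϑ s) * ϑ')] s := by
    rw [hasDerivAt_pi]
    intro i
    fin_cases i
    · exact ht
    · exact (hr.mul hϑ.sin).mul hφ.cos
    · exact (hr.mul hϑ.sin).mul hφ.sin
    · exact hr.mul hϑ.cos
  rw [hder.deriv, ← hS, ← hC] at hv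
  have h1 : C ^ 2 = 1 - S ^ 2 := by
    rw [hS, hC]; linarith [Real.sin_sq_add_cos_sq (ϑ s)]
  have h2 : Real.cos (φ s) ^ 2 = 1 - Real.sin (φ s) ^ 2 := by
    linarith [Real.sin_sq_add_cos_sq (φ s)]
  have hr0 : r s ≠ 0 := hpos.ne'
  have hrad : radius (ofBoyerLindquist (t s) (r s) (ϑ s) (φ s)) = r s := by
    have h3 : (r s * S * Real.cos (φ s)) ^ 2
        + (r s * S * Real.sin (φ s)) ^ 2 + (r s * C) ^ 2 = r s ^ 2 := by
      linear_combination (r s ^ 2) * h1 + r s ^ 2 * S ^ 2 * h2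
    rw [hS, hC] at h3
    simp [radius, ofBoyerLindquist, h3, Real.sqrt_sq hpos.le]
  have hrho : rhoSq a (ofBoyerLindquist (t s) (r s) (ϑ s) (φ s)) = ρ2 := by
    rw [rhoSq, hrad, hρ, hC]
    simp [ofBoyerLindquist, hr0]
  have hDel : Delta M a (ofBoyerLindquist (t s) (r s) (ϑ s) (φ s)) = Δ := by
    rw [Delta, hrad, hD]
  have hdr : ∑ μ, dr (ofBoyerLindquist (t s) (r s) (ϑ s) (φ s)) μ * v μ = r' := by
    rw [hv]
    simp only [dr, hrad]
    simp [ofBoyerLindquist, Fin.sum_univ_four, hr0, ← hS, ← hC]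
    field_simp
    linear_combination r' * h1 + (S * (r' * S + r s * C * ϑ')) * h2
  have hω : ∑ μ, sinSqDphi (ofBoyerLindquist (t s) (r s) (ϑ s) (φ s)) μ * v μ = S ^ 2 * φ' := by
    rw [hv]
    simp only [sinSqDphi, hrad]
    simp [ofBoyerLindquist, Fin.sum_univ_four, ← hS]
    field_simp
    linear_combination (r s * S ^ 2 * φ') * h2
  have h0 : v 0 = t' := by rw [hv]; rfl
  have hsp : v 1 ^ 2 + v 2 ^ 2 + v 3 ^ 2
      = r' ^ 2 + r s ^ 2 * ϑ' ^ 2 + r s ^ 2 * S ^ 2 * φ' ^ 2 := by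
    rw [hv]
    simp
    linear_combination (r' ^ 2 + r s ^ 2 * ϑ' ^ 2) * h1
      + ((r' * S + r s * (C * ϑ')) ^ 2 + (r s * S * φ') ^ 2) * h2
  have hρ0 : ρ2 ≠ 0 := by rw [hρ]; positivity
  have hΔ0 : Δ ≠ 0 := by rw [hD]; exact hΔ
  have hA' : A = (r s ^ 2 + a ^ 2) * ρ2 + 2 * M * r s * a ^ 2 * S ^ 2 := by
    rw [hA, hρ, hD, h1]; ring
  have hr2 : r s ^ 2 = ρ2 - a ^ 2 * (1 - S ^ 2) := by rw [hρ, h1]; ring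
  rw [sum_metric, hrad, hrho, hDel, hdr, hω, h0, hsp, hA', hr2]
  have hr2' : ρ2 - a ^ 2 * (1 - S ^ 2) ≠ 0 := by rw [← hr2]; positivity
  field_simp
  ring

/-- The partial derivative `∂_μ g_{αβ}`. -/
def metricPartial (M a : ℝ) (q : Fin 4 → ℝ) (μ α β : Fin 4) : ℝ :=
  fderiv ℝ (fun q' => metric M a q' α β) q (Pi.single μ 1)

/-- The covector `g(v, ·)` at the point `q`. -/
def lower (M a : ℝ) (q v : Fin 4 → ℝ) : Fin 4 → ℝ := fun μ => ∑ ν, metric M a q μ ν * v ν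

/-- `γ` is a geodesic of the domain of outer communication, with affine parameter in the open
interval `J`. The geodesic equation `∇_γ' γ' = 0` is written with its index lowered:
`d/ds (g_{μν} γ'^ν) = ½ ∂_μ g_{αβ} γ'^α γ'^β`. -/
structure IsGeodesicOn (M a : ℝ) (γ : ℝ → Fin 4 → ℝ) (J : Set ℝ) : Prop where
  isOpen : IsOpen J
  ordConnected : J.OrdConnected
  contDiffOn : ContDiffOn ℝ 2 γ J
  mem_DOC : ∀ s ∈ J, γ s ∈ DOC M a
  equation : ∀ s ∈ J, ∀ μ,
    deriv (fun s' => lower M a (γ s') (deriv γ s') μ) s =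
      1 / 2 * ∑ α, ∑ β, metricPartial M a (γ s) μ α β * deriv γ s α * deriv γ s β

/-- `γ : J → DOC` is an inextendible geodesic. -/
def IsMaximalGeodesicOn (M a : ℝ) (γ : ℝ → Fin 4 → ℝ) (J : Set ℝ) : Prop :=
  IsGeodesicOn M a γ J ∧
    ∀ (γ' : ℝ → Fin 4 → ℝ) (J' : Set ℝ),
      IsGeodesicOn M a γ' J' → J ⊆ J' → Set.EqOn γ γ' J → J' = J

/-- `γ : J → DOC` is a future-directed photon, i.e. an inextendible future-directed null geodesic.
The time orientation of the domain of outer communication is the one in which the time function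
`t` increases to the future. -/
def IsFuturePhoton (M a : ℝ) (γ : ℝ → Fin 4 → ℝ) (J : Set ℝ) : Prop :=
  IsMaximalGeodesicOn M a γ J ∧
    ∀ s ∈ J, ∑ μ, ∑ ν, metric M a (γ s) μ ν * deriv γ s μ * deriv γ s ν = 0 ∧ 0 < deriv γ s 0

/-- The projection to the quotient under the flow of the stationary Killing field `∂_t`, which
acts by translations of `t`. -/
def spatial (q : Fin 4 → ℝ) : Fin 3 → ℝ := fun i => q i.succ

/-- The curve is trapped: its orbit in the quotient of the domain of outer communication by the
flow of `∂_t` is contained in a compact subset of that quotient. -/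
def IsTrapped (M a : ℝ) (γ : ℝ → Fin 4 → ℝ) (J : Set ℝ) : Prop :=
  ∃ K : Set (Fin 3 → ℝ), IsCompact K ∧ K ⊆ spatial '' DOC M a ∧ ∀ s ∈ J, spatial (γ s) ∈ K

/-- The photon region in the cotangent bundle: the set of the `(γ(0), g(γ'(0), ·))` for the
future-directed trapped photons `γ`. The cotangent bundle of the domain of outer communication is
`DOC M a ×ˢ univ` in the coordinates `(q, p)` induced by `(t, x, y, z)`. -/
def photonRegion (M a : ℝ) : Set ((Fin 4 → ℝ) × (Fin 4 → ℝ)) :=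
  {w | ∃ (γ : ℝ → Fin 4 → ℝ) (J : Set ℝ), 0 ∈ J ∧ IsFuturePhoton M a γ J ∧ IsTrapped M a γ J ∧
    w = (γ 0, lower M a (γ 0) (deriv γ 0))}

/-- The slice `{t = 0, p_0 = p(∂_t) = -1}` of the photon region. -/
def photonSlice (M a : ℝ) : Set ((Fin 4 → ℝ) × (Fin 4 → ℝ)) :=
  {w | w ∈ photonRegion M a ∧ w.1 0 = 0 ∧ w.2 0 = -1}

end Kerr

end

/-! The slice is identified with the space of orthonormal pairs in three-dimensional space, which is
a copy of SO(3). Three facts carry the argument.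

Trapped photons have constant radius (`photonSlice_eq_photonSet`). The Hamiltonian `ρ² g⁻¹(p, p)`
separates. For unit energy and axial angular momentum `L`, put `u = r² + a² - a L` and `y = √Δ p_r`.
Up to the positive factor `√Δ / ρ²` in the parameter, the radial motion is `r' = y`, `y' = ½ d/dr
(u² / Δ)`. Outside the horizon this force pushes away from its equilibrium: there is an increasing
function `Ξ` of `r` for which `Ξ · y` is nondecreasing along the motion. On a complete orbit in a
compact range of radii a LaSalle argument forces `y = 0` and makes the radius stationary. The
alternative `u = 0` is excluded by the null condition. Trapped photons are complete because their
covectors stay in a compact set over bounded parameter intervals. Conversely, a null covector with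
`p_r = 0` at a stationary radius generates a complete photon on a sphere, since the reduced motion
there preserves a compact set.

Such a covector is determined by two directions (`nonempty_homeomorph_photonSet`). Let `n` be the
direction of the position and `e` that of the spatial momentum; they are orthogonal because `p_r =
0`. The unknowns left are the radius `r` and the total angular momentum `k = r |p|`, subject to the
null condition and to stationarity. These have a solution by the intermediate value theorem
(`exists_isSphericalRadius`) and only one by a convexity argument (`IsSphericalRadius.eq`). As the
set of covectors is compact, the continuous bijection to orthonormal pairs is a homeomorphism.

Orthonormal pairs of imaginary quaternions are the quotient of the unit quaternions by signs,
through `q ↦ (q i q⁻¹, q j q⁻¹)`. The three-sphere is simply connected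
(`simplyConnectedSpace_sphere`), so the quotient is path-connected and its fundamental group has
order two. -/

open Set Filter Topology Manifold

/-! ### Completeness and extension of flows, and a LaSalle principle -/

section FlowExtension

variable {E : Type*} [NormedAddCommGroup E] [NormedSpace ℝ E]

/-- A bounded, globally Lipschitz vector field is complete. -/
theorem exists_global_solution_of_lipschitz_of_bounded [CompleteSpace E] {v : E → E}
    {K L : NNReal} (hv : LipschitzWith K v) (hL : ∀ x, ‖v x‖ ≤ L) (x₀ : E) :
    ∃ α : ℝ → E, α 0 = x₀ ∧ ∀ t, HasDerivAt α (v (α t)) t := by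
  have key : ∀ n : ℕ, ∃ α : ℝ → E, α 0 = x₀ ∧
      ∀ t ∈ Ioo (-(n + 1 : ℝ)) (n + 1), HasDerivAt α (v (α t)) t := by
    intro n
    have hn : (0 : ℝ) ≤ n + 1 := by positivity
    have h0 : (0 : ℝ) ∈ Icc (-(n + 1 : ℝ)) (n + 1) := ⟨by linarith, hn⟩
    -- Over time at most `n + 1` a solution of speed at most `L` stays in the ball of radius `L (n +
    -- 1)`, and the Lipschitz bound is global, so Picard-Lindelöf applies on intervals of any
    -- length.
    have hP : IsPicardLindelof (fun _ => v) (⟨0, h0⟩ : Icc (-(n + 1 : ℝ)) (n + 1)) x₀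
        (L * (n + 1)) 0 L K := by
      refine ⟨fun _ _ => hv.lipschitzOnWith, fun _ _ => continuousOn_const,
        fun _ _ x _ => hL x, ?_⟩
      simp
    obtain ⟨α, h1, h2⟩ := hP.exists_eq_forall_mem_Icc_hasDerivWithinAt₀
    exact ⟨α, h1, fun t ht => (h2 t (Ioo_subset_Icc_self ht)).hasDerivAt
      (Icc_mem_nhds ht.1 ht.2)⟩
  choose α hα0 hα using key
  have huniq : ∀ m n : ℕ, m ≤ n → EqOn (α m) (α n) (Ioo (-(m + 1 : ℝ)) (m + 1)) := by
    intro m n hmn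
    have hmn' : (m : ℝ) ≤ n := by exact_mod_cast hmn
    have hm : (0 : ℝ) ≤ m := by positivity
    refine ODE_solution_unique_of_mem_Ioo (v := fun _ => v) (s := fun _ => univ) (K := K) (t₀ := 0)
      (fun _ _ => hv.lipschitzOnWith) ⟨by linarith, by linarith⟩ (fun t ht => ⟨hα m t ht, trivial⟩)
      (fun t ht => ⟨hα n t ⟨by linarith [ht.1], by linarith [ht.2]⟩, trivial⟩) ?_
    rw [hα0, hα0]
  -- The solution with index `⌈|t|⌉₊` lives on an open interval containing `t`. Near `t` the glued
  -- curve equals the solution with index one larger, because rounding up may jump at `t`.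
  refine ⟨fun t => α ⌈|t|⌉₊ t, by simp [hα0], fun t => ?_⟩
  set n := ⌈|t|⌉₊ + 1 with hn
  have ht : |t| < n := by
    rw [hn]; push_cast; linarith [Nat.le_ceil |t|]
  have hev : (fun t => α ⌈|t|⌉₊ t) =ᶠ[𝓝 t] α n := by
    have h1 : ∀ᶠ s : ℝ in 𝓝 t, |s| < (n : ℝ) := (continuous_abs.tendsto t).eventually (gt_mem_nhds ht)
    filter_upwards [h1] with s hs
    refine huniq _ _ (Nat.ceil_le.2 hs.le) ?_
    have := Nat.le_ceil |s|
    exact ⟨by linarith [neg_abs_le s], by linarith [le_abs_self s]⟩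
  have h2 : α ⌈|t|⌉₊ t = α n t := hev.eq_of_nhds
  have h3 := hα n t ⟨by linarith [neg_abs_le t], by linarith [le_abs_self t]⟩
  rw [← h2] at h3
  exact h3.congr_of_eventuallyEq hev

/-- A compact subset of an open set has a `C¹` cutoff function. -/
theorem exists_contDiff_cutoff [FiniteDimensional ℝ E] {K U : Set E} (hK : IsCompact K)
    (hU : IsOpen U) (hKU : K ⊆ U) :
    ∃ (χ : E → ℝ) (W : Set E), ContDiff ℝ 1 χ ∧ HasCompactSupport χ ∧ tsupport χ ⊆ U ∧
      IsOpen W ∧ K ⊆ W ∧ ∀ x ∈ W, χ x = 1 := by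
  obtain ⟨K1, hK1, hKK1, hK1U⟩ := exists_compact_between hK hU hKU
  obtain ⟨K2, hK2, hK12, hK2U⟩ := exists_compact_between hK1 hU hK1U
  obtain ⟨χ, h1, -, h3, h4⟩ := exists_contMDiff_support_eq_eq_one_iff (n := 1) 𝓘(ℝ, E)
    isOpen_interior hK1.isClosed hK12
  have hts : tsupport χ ⊆ K2 := by
    rw [tsupport, h3]
    exact closure_minimal interior_subset hK2.isClosed
  exact ⟨χ, interior K1, h1.contDiff, HasCompactSupport.of_support_subset_isCompact hK2
    (by rw [h3]; exact interior_subset), hts.trans hK2U, isOpen_interior, hKK1,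
    fun x hx => (h4 x).1 (interior_subset hx)⟩

/-- A `C¹` vector field on an open set can be multiplied by a cutoff function which is one near a
given compact set such that the result has a global flow. -/
theorem exists_complete_cutoff [FiniteDimensional ℝ E] {v : E → E} {K U : Set E}
    (hU : IsOpen U) (hv : ContDiffOn ℝ 1 v U) (hK : IsCompact K) (hKU : K ⊆ U) :
    ∃ (χ : E → ℝ) (W : Set E) (C : NNReal), IsOpen W ∧ K ⊆ W ∧ W ⊆ U ∧ (∀ x ∈ W, χ x = 1) ∧
      LipschitzWith C (fun x => χ x • v x) ∧ ∀ x₀, ∃ α : ℝ → E, α 0 = x₀ ∧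
        ∀ t, HasDerivAt α (χ (α t) • v (α t)) t := by
  obtain ⟨χ, W, h1, h2, h3, h4, h5, h6⟩ := exists_contDiff_cutoff hK hU hKU
  have hsm : ContDiff ℝ 1 (fun x => χ x • v x) := by
    rw [contDiff_iff_contDiffAt]
    intro x
    by_cases hx : x ∈ tsupport χ
    · exact h1.contDiffAt.smul (hv.contDiffAt (hU.mem_nhds (h3 hx)))
    · have : (fun x => χ x • v x) =ᶠ[𝓝 x] fun _ => 0 := by
        filter_upwards [(isClosed_tsupport χ).isOpen_compl.mem_nhds hx] with y hy
        simp [image_eq_zero_of_notMem_tsupport hy]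
      exact contDiffAt_const.congr_of_eventuallyEq this
  have hcs : HasCompactSupport (fun x => χ x • v x) := h2.smul_right
  obtain ⟨C, hC⟩ := hsm.lipschitzWith_of_hasCompactSupport hcs one_ne_zero
  obtain ⟨B, hB⟩ := hcs.exists_bound_of_continuous hsm.continuous
  refine ⟨χ, W, C, h4, h5, fun x hx => h3 (subset_tsupport _ ?_), h6, hC, fun x₀ => ?_⟩
  · simp [h6 x hx]
  · exact exists_global_solution_of_lipschitz_of_bounded hC (L := ⟨max B 0, le_max_right _ _⟩)
      (fun x => (hB x).trans (le_max_left _ _)) x₀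

/-- A solution of an autonomous equation that stays in a compact set up to the finite right end
point of its interval of definition can be extended beyond it. -/
theorem exists_extension_right [FiniteDimensional ℝ E] {v : E → E} {K U : Set E} (hU : IsOpen U)
    (hv : ContDiffOn ℝ 1 v U) (hK : IsCompact K) (hKU : K ⊆ U) {J : Set ℝ} (hJ : IsOpen J)
    (hJc : J.OrdConnected) (h0 : 0 ∈ J) {x : ℝ → E} (hx : ∀ s ∈ J, HasDerivAt x (v (x s)) s)
    (hxU : ∀ s ∈ J, x s ∈ U) (hxK : ∀ s ∈ J, 0 ≤ s → x s ∈ K) (hb : BddAbove J) :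
    ∃ (J' : Set ℝ) (y : ℝ → E), IsOpen J' ∧ J'.OrdConnected ∧ J ⊂ J' ∧ EqOn x y J ∧
      ∀ s ∈ J', HasDerivAt y (v (y s)) s ∧ y s ∈ U := by
  -- The cut-off field has a global solution `β` from the same initial point. It agrees with `x`
  -- before the end point `b`, so `β b` is a limit of points of `K`. Hence `β` stays for a while in
  -- the region where the cutoff is one and continues `x`.
  obtain ⟨χ, W, C, hW, hKW, hWU, hχ, hLip, hglob⟩ := exists_complete_cutoff hU hv hK hKU
  obtain ⟨β, hβ0, hβ⟩ := hglob (x 0)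
  set b := sSup J with hbdef
  have hlub : IsLUB J b := isLUB_csSup ⟨0, h0⟩ hb
  have hbJ : b ∉ J := by
    intro hbJ
    obtain ⟨ε, hε, hball⟩ := Metric.isOpen_iff.1 hJ b hbJ
    have : b + ε / 2 ∈ J := hball (by simp [abs_of_pos hε, hε])
    linarith [hlub.1 this]
  have hlt : ∀ s ∈ J, s < b := fun s hs => lt_of_le_of_ne (hlub.1 hs) (by rintro rfl; exact hbJ hs)
  have hb0 : 0 < b := hlt 0 h0
  have hmem : ∀ s, 0 ≤ s → s < b → s ∈ J := by
    intro s hs hsb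
    obtain ⟨c, hc, hsc⟩ := (lt_isLUB_iff hlub).1 hsb
    exact hJc.out h0 hc ⟨hs, hsc.le⟩
  have heq : ∀ s, 0 ≤ s → s < b → x s = β s := by
    intro s hs hsb
    have hx' : ∀ u ∈ Icc 0 s, HasDerivAt x (χ (x u) • v (x u)) u := by
      intro u hu
      have huJ := hmem u hu.1 (hu.2.trans_lt hsb)
      rw [hχ _ (hKW (hxK u huJ hu.1)), one_smul]
      exact hx u huJ
    have h := ODE_solution_unique (v := fun _ x => χ x • v x) (fun _ => hLip)
      (fun u hu => (hx' u hu).continuousAt.continuousWithinAt)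
      (fun u hu => (hx' u (Ico_subset_Icc_self hu)).hasDerivWithinAt)
      (fun u hu => (hβ u).continuousAt.continuousWithinAt)
      (fun u hu => (hβ u).hasDerivWithinAt) hβ0.symm
    exact h ⟨hs, le_rfl⟩
  have hβc : Continuous β := continuous_iff_continuousAt.2 fun u => (hβ u).continuousAt
  have hβb : β b ∈ K := by
    refine hK.isClosed.closure_subset_iff.2 (Subset.refl K) ?_
    refine mem_closure_of_tendsto (b := 𝓝[<] b) ((hβc.tendsto b).mono_left inf_le_left) ?_
    filter_upwards [Ioo_mem_nhdsLT hb0] with u hu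
    rw [← heq u hu.1.le hu.2]
    exact hxK u (hmem u hu.1.le hu.2) hu.1.le
  obtain ⟨ε, hε, hball⟩ := Metric.isOpen_iff.1 (hW.preimage hβc) b (hKW hβb)
  have hβW : ∀ s, b ≤ s → s < b + ε → β s ∈ W := by
    intro s h1 h2
    exact hball (by rw [Metric.mem_ball, Real.dist_eq, abs_lt]; constructor <;> linarith)
  set y : ℝ → E := fun s => if s < b then x s else β s with hy
  have hyJ : EqOn x y J := fun s hs => by simp [hy, hlt s hs]
  refine ⟨J ∪ Ioo 0 (b + ε), y, hJ.union isOpen_Ioo, ?_, ?_, hyJ, ?_⟩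
  · have : J ∪ Ioo 0 (b + ε) = J ∪ Ico 0 (b + ε) := by
      ext s
      simp only [mem_union, mem_Ioo, mem_Ico]
      constructor
      · rintro (h | h)
        exacts [.inl h, .inr ⟨h.1.le, h.2⟩]
      · rintro (h | h)
        · exact .inl h
        · rcases h.1.eq_or_lt with rfl | h'
          exacts [.inl h0, .inr ⟨h', h.2⟩]
    rw [this]
    exact (IsPreconnected.union 0 h0 (show (0 : ℝ) ∈ Ico 0 (b + ε) from ⟨le_rfl, by linarith⟩)
      hJc.isPreconnected isPreconnected_Ico).ordConnected
  · refine ⟨subset_union_left, fun h => hbJ (h (.inr ⟨hb0, by linarith⟩))⟩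
  · intro s hs
    rcases lt_or_ge s b with hsb | hsb
    · have hsJ : s ∈ J := by
        rcases hs with hs | hs
        exacts [hs, hmem s hs.1.le hsb]
      have hev : y =ᶠ[𝓝 s] x := by
        filter_upwards [hJ.mem_nhds hsJ] with u hu using (hyJ hu).symm
      refine ⟨?_, by rw [← hyJ hsJ]; exact hxU s hsJ⟩
      rw [← hyJ hsJ]
      exact (hx s hsJ).congr_of_eventuallyEq hev
    · have hev : y =ᶠ[𝓝 s] β := by
        filter_upwards [lt_mem_nhds (hb0.trans_le hsb)] with u hu
        simp only [hy]
        split_ifs with h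
        exacts [heq u hu.le h, rfl]
      have hsε : s < b + ε := by
        rcases hs with hs | hs
        exacts [absurd (hlt s hs) (not_lt.2 hsb), hs.2]
      rw [hev.eq_of_nhds]
      refine ⟨?_, hWU (hβW s hsb hsε)⟩
      have := (hβ s).congr_of_eventuallyEq hev
      rwa [hχ _ (hβW s hsb hsε), one_smul] at this

/-- The time reversal of `exists_extension_right`. -/
theorem exists_extension_left [FiniteDimensional ℝ E] {v : E → E} {K U : Set E} (hU : IsOpen U)
    (hv : ContDiffOn ℝ 1 v U) (hK : IsCompact K) (hKU : K ⊆ U) {J : Set ℝ} (hJ : IsOpen J)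
    (hJc : J.OrdConnected) (h0 : 0 ∈ J) {x : ℝ → E} (hx : ∀ s ∈ J, HasDerivAt x (v (x s)) s)
    (hxU : ∀ s ∈ J, x s ∈ U) (hxK : ∀ s ∈ J, s ≤ 0 → x s ∈ K) (hb : BddBelow J) :
    ∃ (J' : Set ℝ) (y : ℝ → E), IsOpen J' ∧ J'.OrdConnected ∧ J ⊂ J' ∧ EqOn x y J ∧
      ∀ s ∈ J', HasDerivAt y (v (y s)) s ∧ y s ∈ U := by
  have hneg : ∀ {w : E → E} {z : ℝ → E} {s : ℝ}, HasDerivAt z (w (z (-s))) (-s) →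
      HasDerivAt (fun u => z (-u)) (-w (z (-s))) s := by
    intro w z s h
    simpa [Function.comp_def] using h.scomp s (hasDerivAt_neg s)
  have hoc : ∀ {I : Set ℝ}, I.OrdConnected → (-I).OrdConnected := fun {I} h =>
    ⟨fun a ha b hb c hc => h.out hb ha ⟨neg_le_neg hc.2, neg_le_neg hc.1⟩⟩
  obtain ⟨J', y, h1, h2, h3, h4, h5⟩ := exists_extension_right (v := fun x => -v x)
    (J := -J) (x := fun s => x (-s)) hU hv.neg hK hKU hJ.neg (hoc hJc) (by simpa)
    (fun s hs => hneg (hx (-s) hs)) (fun s hs => hxU _ hs)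
    (fun s hs h => hxK _ hs (by linarith)) hb.neg
  refine ⟨-J', fun s => y (-s), h1.neg, hoc h2, ?_, fun s hs => ?_, fun s hs => ?_⟩
  · refine ⟨fun s hs => h3.1 (by simpa using hs), fun h => h3.2 fun s hs => ?_⟩
    exact h (by simpa using hs)
  · simpa using h4 (show -s ∈ -J by simpa using hs)
  · have := h5 (-s) hs
    exact ⟨by simpa using hneg (w := fun x => -v x) this.1, this.2⟩

/-- If all reparametrized solutions stay in a compact set then there is a global solution. -/
theorem exists_global_solution_of_invariant [FiniteDimensional ℝ E] {v : E → E} {K U : Set E}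
    (hU : IsOpen U) (hv : ContDiffOn ℝ 1 v U) (hK : IsCompact K) (hKU : K ⊆ U) (x₀ : E)
    (hinv : ∀ (f : ℝ → ℝ) (α : ℝ → E), α 0 = x₀ →
      (∀ t, HasDerivAt α (f t • v (α t)) t) → ∀ t, α t ∈ K) :
    ∃ α : ℝ → E, α 0 = x₀ ∧ (∀ t, HasDerivAt α (v (α t)) t) ∧ ∀ t, α t ∈ K := by
  -- A solution of the cut-off equation is a solution with the scalar factor `f = χ ∘ α`; the
  -- invariance then keeps it where the factor is one.
  obtain ⟨χ, W, C, hW, hKW, hWU, hχ, hLip, hglob⟩ := exists_complete_cutoff hU hv hK hKU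
  obtain ⟨α, h0, h1⟩ := hglob x₀
  have h2 := hinv (fun t => χ (α t)) α h0 h1
  refine ⟨α, h0, fun t => ?_, h2⟩
  have := h1 t
  rwa [hχ _ (hKW (h2 t)), one_smul] at this

/-- A LaSalle principle: if a function `V` is nondecreasing along a curve in a compact set, with
rate `W`, and if `V` vanishes where `W` does, then `W` vanishes along the curve. -/
theorem rate_eq_zero_of_mem_compact {X : Type*} [TopologicalSpace X] [FirstCountableTopology X]
    {K : Set X} (hK : IsCompact K) {V W : X → ℝ} (hV : ContinuousOn V K) (hW : ContinuousOn W K)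
    {σ : ℝ → X} (hσ : ∀ s, σ s ∈ K) (hder : ∀ s, HasDerivAt (fun s => V (σ s)) (W (σ s)) s)
    (hpos : ∀ x ∈ K, 0 ≤ W x) (hzero : ∀ x ∈ K, W x = 0 → V x = 0) (s : ℝ) : W (σ s) = 0 := by
  have hmono : Monotone fun s => V (σ s) :=
    monotone_of_deriv_nonneg (fun s => (hder s).differentiableAt)
      fun s => by rw [(hder s).deriv]; exact hpos _ (hσ s)
  -- By the mean value theorem the increment of `V` over a unit interval is a value of the rate.
  -- Increments of a bounded monotone function tend to zero, which yields points where the rate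
  -- tends to zero.
  have key : ∀ c : ℝ, ∃ u : ℕ → ℝ, (∀ n, c + n < u n ∧ u n < c + n + 1) ∧
      ∀ n : ℕ, W (σ (u n)) = V (σ (c + n + 1)) - V (σ (c + n)) := by
    intro c
    have : ∀ n : ℕ, ∃ u : ℝ, (c + n < u ∧ u < c + n + 1) ∧
        W (σ u) = V (σ (c + n + 1)) - V (σ (c + n)) := by
      intro n
      obtain ⟨u, hu, h⟩ := exists_hasDerivAt_eq_slope (fun s => V (σ s)) (fun s => W (σ s))
        (show c + n < c + n + 1 by linarith)
        (fun s _ => (hder s).continuousAt.continuousWithinAt) (fun s _ => hder s)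
      exact ⟨u, hu, by rw [h]; simp⟩
    choose u h1 h2 using this
    exact ⟨u, h1, h2⟩
  obtain ⟨B, hB⟩ := (hK.image_of_continuousOn hV).isBounded.subset_closedBall 0
  have hB' : ∀ s, |V (σ s)| ≤ B := fun s => by
    simpa using hB (mem_image_of_mem V (hσ s))
  -- At a cluster point of such points the rate vanishes, hence so does `V`. Thus `V` tends to zero
  -- along a subsequence, and this happens in both time directions; a monotone function with limit
  -- zero at both ends is zero.
  have hlim : ∀ u : ℕ → ℝ, Tendsto (fun n => W (σ (u n))) atTop (𝓝 0) →
      ∃ φ : ℕ → ℕ, StrictMono φ ∧ Tendsto (fun n => V (σ (u (φ n)))) atTop (𝓝 0) := by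
    intro u hu
    obtain ⟨x, hx, φ, hφ, hlim⟩ := hK.isSeqCompact (fun n => hσ (u n))
    have hlim' : Tendsto (fun n => σ (u (φ n))) atTop (𝓝[K] x) :=
      tendsto_nhdsWithin_iff.2 ⟨hlim, .of_forall fun n => hσ _⟩
    have hWx : W x = 0 := tendsto_nhds_unique ((hW x hx).tendsto.comp hlim')
      (hu.comp hφ.tendsto_atTop)
    have h := (hV x hx).tendsto.comp hlim'
    rw [hzero x hx hWx] at h
    exact ⟨φ, hφ, h⟩
  have hle : ∀ s, V (σ s) ≤ 0 := by
    intro s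
    obtain ⟨u, hu1, hu2⟩ := key s
    have hconv : Tendsto (fun n : ℕ => V (σ (s + n))) atTop
        (𝓝 (⨆ n : ℕ, V (σ (s + n)))) := by
      refine tendsto_atTop_ciSup (fun m n hmn => hmono (by gcongr)) ⟨B, ?_⟩
      rintro _ ⟨n, rfl⟩
      exact (le_abs_self _).trans (hB' _)
    have hW0 : Tendsto (fun n => W (σ (u n))) atTop (𝓝 0) := by
      have h1 := (hconv.comp (tendsto_add_atTop_nat 1)).sub hconv
      rw [sub_self] at h1
      refine h1.congr fun n => ?_
      simp only [hu2 n, Function.comp_apply]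
      push_cast
      rw [add_assoc]
    obtain ⟨φ, -, hφ⟩ := hlim u hW0
    refine ge_of_tendsto' hφ fun n => hmono ?_
    have := (hu1 (φ n)).1
    have : (0 : ℝ) ≤ φ n := by positivity
    linarith
  have hge : ∀ s, 0 ≤ V (σ s) := by
    intro s
    -- Backwards in time only the first interval issued by `key` is used: `u n 0` lies between `s -
    -- n - 1` and `s - n`.
    choose u hu1 hu2 using fun n : ℕ => key (s - n - 1)
    have hconv : Tendsto (fun n : ℕ => V (σ (s - n))) atTop
        (𝓝 (⨅ n : ℕ, V (σ (s - n)))) := by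
      refine tendsto_atTop_ciInf (fun m n hmn => hmono (by gcongr)) ⟨-B, ?_⟩
      rintro _ ⟨n, rfl⟩
      exact (abs_le.1 (hB' _)).1
    have hW0 : Tendsto (fun n => W (σ (u n 0))) atTop (𝓝 0) := by
      have h1 := hconv.sub (hconv.comp (tendsto_add_atTop_nat 1))
      rw [sub_self] at h1
      refine h1.congr fun n => ?_
      simp only [hu2 n, Function.comp_apply]
      push_cast
      congr 3 <;> ring
    obtain ⟨φ, -, hφ⟩ := hlim (fun n => u n 0) hW0
    refine le_of_tendsto' hφ fun n => hmono ?_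
    have := (hu1 (φ n) 0).2
    have : (0 : ℝ) ≤ φ n := by positivity
    push_cast at *
    linarith
  have h0 : (fun s => V (σ s)) = fun _ => 0 := funext fun s => le_antisymm (hle s) (hge s)
  have := hder s
  rw [h0] at this
  exact this.unique (hasDerivAt_const s 0)

end FlowExtension

/-! ### Simple connectedness of spheres -/

section SphereSimplyConnected

open unitInterval Metric Module

variable {E : Type*} [NormedAddCommGroup E] [InnerProductSpace ℝ E]

/-- The radial projection onto the unit sphere of a nonzero vector. -/
noncomputable def radialProj (y : E) (hy : y ≠ 0) : sphere (0 : E) 1 :=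
  ⟨‖y‖⁻¹ • y, by
    rw [mem_sphere_zero_iff_norm, norm_smul, norm_inv, norm_norm,
      inv_mul_cancel₀ (norm_ne_zero_iff.2 hy)]⟩

theorem radialProj_coe (x : sphere (0 : E) 1) (h : (x : E) ≠ 0) : radialProj (x : E) h = x := by
  ext
  simp [radialProj]

theorem continuous_radialProj {X : Type*} [TopologicalSpace X] {f : X → E} (hf : Continuous f)
    (h : ∀ x, f x ≠ 0) : Continuous fun x => radialProj (f x) (h x) :=
  ((hf.norm.inv₀ fun x => norm_ne_zero_iff.2 (h x)).smul hf).subtype_mk _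

/-- A loop in the unit sphere is homotopic to the radial projection of any loop in the ambient
space that is uniformly close to it. -/
theorem homotopic_radialProj {x : sphere (0 : E) 1} (γ : Path x x) {g : I → E} (hg : Continuous g)
    (h0 : g 0 = x) (h1 : g 1 = x) (hclose : ∀ t, ‖g t - γ t‖ < 1) :
    ∃ (hne : ∀ t, g t ≠ 0) (δ : Path x x), (∀ t, δ t = radialProj (g t) (hne t)) ∧
      γ.Homotopic δ := by
  -- The straight segment from `γ t` to `g t` is shorter than the norm of `γ t`, so it avoids the
  -- origin and can be projected radially.
  have key : ∀ s t : I, ((γ t : E) + (s : ℝ) • (g t - γ t)) ≠ 0 := by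
    intro s t h
    have h2 : (γ t : E) = -((s : ℝ) • (g t - γ t)) := eq_neg_of_add_eq_zero_left h
    have h3 : ‖(γ t : E)‖ = 1 := norm_eq_of_mem_sphere _
    rw [h2, norm_neg, norm_smul, Real.norm_eq_abs, abs_of_nonneg s.2.1] at h3
    nlinarith [hclose t, s.2.1, s.2.2, norm_nonneg (g t - γ t)]
  have hne : ∀ t, g t ≠ 0 := fun t => by simpa using key 1 t
  have hx : (x : E) ≠ 0 := by rw [← h0]; exact hne 0
  let δ : Path x x :=
    { toFun := fun t => radialProj (g t) (hne t)
      continuous_toFun := continuous_radialProj hg hne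
      source' := by simp [h0, radialProj_coe]
      target' := by simp [h1, radialProj_coe] }
  refine ⟨hne, δ, fun t => rfl, ⟨⟨⟨⟨fun p => radialProj _ (key p.1 p.2), ?_⟩, ?_, ?_⟩, ?_⟩⟩⟩
  · refine continuous_radialProj ?_ _
    fun_prop
  · intro t
    simp [radialProj_coe]
  · intro t
    simp [δ]
  · rintro s t (rfl | rfl) <;> simp [h0, h1, radialProj_coe]

/-- A loop in the unit sphere that misses a point is null-homotopic. -/
theorem homotopic_refl_of_forall_ne {x u : sphere (0 : E) 1} (γ : Path x x)
    (hu : ∀ t, γ t ≠ u) : γ.Homotopic (Path.refl x) := by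
  have hv : ‖(u : E)‖ = 1 := norm_eq_of_mem_sphere u
  set φ := stereographic hv
  have hs : φ.source = {u}ᶜ := stereographic_source hv
  have hcontr : ContractibleSpace φ.source := by
    rw [φ.toHomeomorphSourceTarget.contractibleSpace_iff, show φ.target = univ from
      stereographic_target hv, (Homeomorph.Set.univ _).contractibleSpace_iff]
    infer_instance
  have hmem : ∀ t, γ t ∈ φ.source := fun t => by rw [hs]; exact hu t
  have hx : x ∈ φ.source := by simpa using hmem 0
  let δ : Path (⟨x, hx⟩ : φ.source) ⟨x, hx⟩ :=
    { toFun := fun t => ⟨γ t, hmem t⟩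
      continuous_toFun := γ.continuous.subtype_mk _
      source' := by simp
      target' := by simp }
  have h := (SimplyConnectedSpace.paths_homotopic δ (Path.refl _)).map
    (⟨Subtype.val, continuous_subtype_val⟩ : C(φ.source, sphere (0 : E) 1))
  convert! h using 1

/-- The unit sphere in a real inner product space of finite dimension at least three is simply
connected. -/
theorem simplyConnectedSpace_sphere [FiniteDimensional ℝ E] (hdim : 2 < finrank ℝ E) :
    SimplyConnectedSpace (sphere (0 : E) 1) := by
  rw [simply_connected_iff_loops_nullhomotopic]
  have hrank : 1 < Module.rank ℝ E := by
    rw [← finrank_eq_rank]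
    exact_mod_cast (by omega : 1 < finrank ℝ E)
  refine ⟨isPathConnected_iff_pathConnectedSpace.1 (isPathConnected_sphere hrank 0 zero_le_one),
    fun x γ => ?_⟩
  let f : C(I, E) := ⟨fun t => γ t, continuous_subtype_val.comp γ.continuous⟩
  -- A Bernstein approximation is a polynomial loop with the same base point; `n ≠ 0` is what makes
  -- it interpolate at the end point `1`.
  obtain ⟨n, hn, hn0⟩ := (((Metric.tendsto_nhds.1 (bernsteinApproximation_uniform f) 1 one_pos).and
    (eventually_ne_atTop 0))).exists
  set g := bernsteinApproximation n f with hg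
  have hclose : ∀ t, ‖g t - γ t‖ < 1 := fun t => by
    rw [← dist_eq_norm]
    exact (ContinuousMap.dist_apply_le_dist t).trans_lt hn
  obtain ⟨hne, δ, hδ, hγδ⟩ := homotopic_radialProj γ g.continuous
    (by simp [hg, f]) (by simp [hg, f, hn0]) hclose
  -- The cone over the polynomial loop is a smooth image of the plane, so its complement is dense in
  -- dimension at least three. A vector `w` off the cone gives a point of the sphere missed by the
  -- projected loop, and the loop then contracts by stereographic projection.
  let G : ℝ × ℝ → E := fun p =>
    p.1 • ∑ k : Fin (n + 1), (bernsteinPolynomial ℝ n k).eval p.2 • f (bernstein.z k)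
  have hG : ContDiff ℝ 1 G := by
    refine contDiff_fst.smul (ContDiff.sum fun k _ => ContDiff.smul ?_ contDiff_const)
    simp only [← Polynomial.coe_aeval_eq_eval]
    exact (Polynomial.contDiff_aeval _ _).comp contDiff_snd
  have hgG : ∀ (a : ℝ) (t : I), a • g t = G (a, t) := by
    intro a t
    simp only [hg, G, bernsteinApproximation.apply]
    rfl
  obtain ⟨w, hw⟩ := (hG.dense_compl_range_of_finrank_lt_finrank (by simpa using hdim)).nonempty
  have hw0 : w ≠ 0 := by
    rintro rfl
    exact hw ⟨(0, 0), by simp [G]⟩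
  refine hγδ.trans (homotopic_refl_of_forall_ne (u := radialProj w hw0) δ fun t ht => hw ?_)
  rw [hδ] at ht
  have h1 : ‖g t‖⁻¹ • g t = ‖w‖⁻¹ • w := congrArg Subtype.val ht
  refine ⟨(‖w‖ * ‖g t‖⁻¹, t), ?_⟩
  rw [← hgG, mul_smul, h1, smul_smul, mul_inv_cancel₀ (norm_ne_zero_iff.2 hw0), one_smul]

end SphereSimplyConnected

/-! ### Orthonormal pairs and their double cover by the unit quaternions -/

section QuaternionFrames

open scoped Quaternion
open Metric

/-- The orthonormal pairs of imaginary quaternions. -/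
def quaternionFrames : Set (ℍ[ℝ] × ℍ[ℝ]) :=
  {p | p.1 * p.1 = -1 ∧ p.2 * p.2 = -1 ∧ p.1 * p.2 = -(p.2 * p.1)}

namespace quaternionFrames

def qi : ℍ[ℝ] := ⟨0, 1, 0, 0⟩

def qj : ℍ[ℝ] := ⟨0, 0, 1, 0⟩

@[simp] theorem re_qi : qi.re = 0 := rfl

@[simp] theorem imI_qi : qi.imI = 1 := rfl

@[simp] theorem imJ_qi : qi.imJ = 0 := rfl

@[simp] theorem imK_qi : qi.imK = 0 := rfl

@[simp] theorem re_qj : qj.re = 0 := rfl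

@[simp] theorem imI_qj : qj.imI = 0 := rfl

@[simp] theorem imJ_qj : qj.imJ = 1 := rfl

@[simp] theorem imK_qj : qj.imK = 0 := rfl

theorem qi_mul_qi : qi * qi = -1 := by ext <;> simp

theorem qj_mul_qj : qj * qj = -1 := by ext <;> simp

theorem qi_mul_qj : qi * qj = -(qj * qi) := by ext <;> simp

theorem star_mul_self_of_mem_sphere (q : sphere (0 : ℍ[ℝ]) 1) : star (q : ℍ[ℝ]) * q = 1 := by
  rw [Quaternion.star_mul_self, Quaternion.normSq_eq_norm_mul_self, norm_eq_of_mem_sphere]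
  simp

theorem self_mul_star_of_mem_sphere (q : sphere (0 : ℍ[ℝ]) 1) : (q : ℍ[ℝ]) * star (q : ℍ[ℝ]) = 1 := by
  rw [Quaternion.self_mul_star, Quaternion.normSq_eq_norm_mul_self, norm_eq_of_mem_sphere]
  simp

/-- The rotation by a unit quaternion of the standard frame. -/
noncomputable def rotate (q : sphere (0 : ℍ[ℝ]) 1) : quaternionFrames :=
  ⟨(q * qi * star (q : ℍ[ℝ]), q * qj * star (q : ℍ[ℝ])), by
    have h := star_mul_self_of_mem_sphere q
    have h' := self_mul_star_of_mem_sphere q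
    have key : ∀ u v : ℍ[ℝ], (q * u * star (q : ℍ[ℝ])) * (q * v * star (q : ℍ[ℝ])) =
        q * (u * v) * star (q : ℍ[ℝ]) := by
      intro u v
      calc _ = q * u * (star (q : ℍ[ℝ]) * q) * v * star (q : ℍ[ℝ]) := by noncomm_ring
        _ = _ := by rw [h]; noncomm_ring
    refine ⟨?_, ?_, ?_⟩ <;> simp only [key, qi_mul_qi, qj_mul_qj, qi_mul_qj] <;> simp [h']⟩

theorem continuous_rotate : Continuous rotate := by
  unfold rotate
  fun_prop

/-- A unit quaternion commuting with `i` and `j` is real, hence a sign. -/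
theorem eq_or_eq_neg_of_rotate_eq {p q : sphere (0 : ℍ[ℝ]) 1} (h : rotate p = rotate q) :
    p = q ∨ p = -q := by
  have h1 : (p : ℍ[ℝ]) * qi * star (p : ℍ[ℝ]) = q * qi * star (q : ℍ[ℝ]) :=
    congrArg Prod.fst (congrArg Subtype.val h)
  have h2 : (p : ℍ[ℝ]) * qj * star (p : ℍ[ℝ]) = q * qj * star (q : ℍ[ℝ]) :=
    congrArg Prod.snd (congrArg Subtype.val h)
  have hp := star_mul_self_of_mem_sphere p
  have hq := star_mul_self_of_mem_sphere q
  have hq' := self_mul_star_of_mem_sphere q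
  set c : ℍ[ℝ] := star (q : ℍ[ℝ]) * p with hc
  have key : ∀ u : ℍ[ℝ], (p : ℍ[ℝ]) * u * star (p : ℍ[ℝ]) = q * u * star (q : ℍ[ℝ]) →
      c * u = u * c := by
    intro u hu
    calc c * u = star (q : ℍ[ℝ]) * (p * u * star (p : ℍ[ℝ])) * p := by
          simp only [hc, mul_assoc, hp, mul_one]
      _ = (star (q : ℍ[ℝ]) * q) * u * c := by rw [hu]; simp only [hc, mul_assoc]
      _ = u * c := by rw [hq, one_mul]
  have hi := key _ h1
  have hj := key _ h2
  have c1 : c.imJ = 0 := by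
    have := congrArg QuaternionAlgebra.imK hi
    simp at this
    linarith
  have c2 : c.imK = 0 := by
    have := congrArg QuaternionAlgebra.imJ hi
    simp at this
    linarith
  have c3 : c.imI = 0 := by
    have := congrArg QuaternionAlgebra.imK hj
    simp at this
    linarith
  have hcre : c = ((c.re : ℝ) : ℍ[ℝ]) := by ext <;> simp [c1, c2, c3]
  have hnorm : ‖c‖ = 1 := by
    rw [hc, norm_mul, norm_star, norm_eq_of_mem_sphere, norm_eq_of_mem_sphere, one_mul]
  have hpc : (p : ℍ[ℝ]) = q * c := by rw [hc, ← mul_assoc, hq', one_mul]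
  rw [hcre, Quaternion.norm_coe, Real.norm_eq_abs, abs_eq zero_le_one] at hnorm
  rcases hnorm with h | h
  · left; ext1; rw [hpc, hcre, h]; simp
  · right; ext1; rw [hpc, hcre, h]; simp

/-- Averaging over the quaternion group gives an intertwiner: `A x` is the sum of `g x h⁻¹` where
`h` runs through `1, i, j, ij` and `g` is the corresponding product of `n` and `e`. Hence `n (A x) =
(A x) i` and `e (A x) = (A x) j`, and a nonzero value of `A`, normalized, rotates `(i, j)` to `(n,
e)`. -/
theorem surjective_rotate : Function.Surjective rotate := by
  rintro ⟨⟨n, e⟩, hn, he, hne⟩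
  simp only at hn he hne
  set A : ℍ[ℝ] → ℍ[ℝ] := fun x => x - n * x * qi - e * x * qj + (n * e) * x * (qj * qi) with hA
  have hAi : ∀ x, n * A x = A x * qi := by
    intro x
    have e1 : n * A x = n * x - (n * n) * x * qi - (n * e) * x * qj
        + (n * n) * e * x * (qj * qi) := by
      simp only [hA]; noncomm_ring
    have e2 : A x * qi = x * qi - n * x * (qi * qi) - e * x * (qj * qi)
        + (n * e) * x * qj * (qi * qi) := by
      simp only [hA]; noncomm_ring
    rw [e1, e2, hn, qi_mul_qi]
    noncomm_ring
  have hAj : ∀ x, e * A x = A x * qj := by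
    intro x
    have e1 : e * A x = e * x - (e * n) * x * qi - (e * e) * x * qj
        + (e * n) * e * x * (qj * qi) := by
      simp only [hA]; noncomm_ring
    have e2 : A x * qj = x * qj - n * x * (qi * qj) - e * x * (qj * qj)
        + (n * e) * x * qj * (qi * qj) := by
      simp only [hA]; noncomm_ring
    have h3 : e * n = -(n * e) := by rw [hne, neg_neg]
    have h4 : qj * (qj * qi) = -qi := by rw [← mul_assoc, qj_mul_qj, neg_one_mul]
    have e3 : (n * e) * x * qj * (qj * qi) = - ((n * e) * x * qi) := by
      rw [mul_assoc, h4, mul_neg]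
    have e4 : (n * e) * e * x * (qj * qi) = - (n * x * (qj * qi)) := by
      rw [mul_assoc n, he]; noncomm_ring
    rw [e1, e2, h3, he, qj_mul_qj, qi_mul_qj]
    simp only [neg_mul, mul_neg, e3, e4]
    noncomm_ring
  -- The four components taken below are, up to sign, the diagonal entries of `A` in the basis `1,
  -- i, j, ji`. Only the identity term contributes to the trace, which is four, so `A` is not zero.
  have hex : ∃ x, A x ≠ 0 := by
    by_contra! h
    have a0 := congrArg QuaternionAlgebra.re (h 1)
    have a1 := congrArg QuaternionAlgebra.imI (h qi)
    have a2 := congrArg QuaternionAlgebra.imJ (h qj)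
    have a3 := congrArg QuaternionAlgebra.imK (h (qj * qi))
    have hm : (n * e).re = 0 := by
      have := congrArg QuaternionAlgebra.re hne
      simp at this ⊢
      linarith
    simp [hA] at a0 a1 a2 a3 hm
    linarith
  obtain ⟨x, hx⟩ := hex
  set y := A x with hy
  have hyn : ‖y‖ ≠ 0 := norm_ne_zero_iff.2 hx
  have hu : ‖(‖y‖⁻¹ • y)‖ = 1 := by
    rw [norm_smul, norm_inv, norm_norm, inv_mul_cancel₀ hyn]
  set q : sphere (0 : ℍ[ℝ]) 1 := ⟨‖y‖⁻¹ • y, by simpa using hu⟩ with hq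
  have hqq := self_mul_star_of_mem_sphere q
  refine ⟨q, ?_⟩
  have h1 : (q : ℍ[ℝ]) * qi = n * q := by
    simp only [hq, smul_mul_assoc, mul_smul_comm, hAi x, hy]
  have h2 : (q : ℍ[ℝ]) * qj = e * q := by
    simp only [hq, smul_mul_assoc, mul_smul_comm, hAj x, hy]
  ext1
  simp only [rotate, h1, h2, mul_assoc, hqq, mul_one]

/-- The group of signs acts on the unit quaternions. -/
@[reducible]
noncomputable def signAction : MulAction ℤˣ (sphere (0 : ℍ[ℝ]) 1) where
  smul g q := ⟨((g : ℤ) : ℝ) • (q : ℍ[ℝ]), by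
    rcases Int.units_eq_one_or g with rfl | rfl <;> simp⟩
  one_smul q := by ext1; change (((1 : ℤˣ) : ℤ) : ℝ) • (q : ℍ[ℝ]) = q; simp
  mul_smul g h q := by
    ext1
    change (((g * h : ℤˣ) : ℤ) : ℝ) • (q : ℍ[ℝ]) = ((g : ℤ) : ℝ) • ((h : ℤ) : ℝ) • (q : ℍ[ℝ])
    rw [smul_smul]
    push_cast
    rfl

attribute [local instance] signAction

theorem neg_one_smul_eq (q : sphere (0 : ℍ[ℝ]) 1) : (-1 : ℤˣ) • q = -q := by
  ext1
  change (((-1 : ℤˣ) : ℤ) : ℝ) • (q : ℍ[ℝ]) = -(q : ℍ[ℝ])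
  simp

theorem rotate_neg (q : sphere (0 : ℍ[ℝ]) 1) : rotate (-q) = rotate q := by
  ext1
  simp [rotate]

/-- Compactness of the sphere makes the continuous surjection `rotate` a quotient map, and its
fibres are the pairs of antipodes. The action of the signs is properly discontinuous because no
antipodal pair fits into an open ball of radius one centred on the sphere. -/
theorem isQuotientCoveringMap_rotate : IsQuotientCoveringMap rotate ℤˣ where
  toIsQuotientMap := continuous_rotate.isClosedMap.isQuotientMap continuous_rotate surjective_rotate
  continuous_const_smul g := by
    rcases Int.units_eq_one_or g with rfl | rfl
    · simpa using! continuous_id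
    · simp only [neg_one_smul_eq]
      exact continuous_neg
  apply_eq_iff_mem_orbit {p q} := by
    constructor
    · intro h
      rcases eq_or_eq_neg_of_rotate_eq h with h | h
      · exact ⟨1, by simp [h]⟩
      · exact ⟨-1, by simp [h, neg_one_smul_eq]⟩
    · rintro ⟨g, rfl⟩
      rcases Int.units_eq_one_or g with rfl | rfl
      · simp
      · simp [neg_one_smul_eq, rotate_neg]
  disjoint q := by
    refine ⟨ball q 1, ball_mem_nhds q one_pos, ?_⟩
    rintro g ⟨y, ⟨z, hz, rfl⟩, hy⟩
    rcases Int.units_eq_one_or g with rfl | rfl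
    · rfl
    exfalso
    simp only [neg_one_smul_eq, mem_ball, Subtype.dist_eq, dist_eq_norm] at hz hy
    have hq : ‖(q : ℍ[ℝ])‖ = 1 := norm_eq_of_mem_sphere q
    -- If `z` and `-z` both lay within distance less than one of `q`, the triangle inequality would
    -- give `‖2 q‖ < 2`.
    have h : ‖(2 : ℝ) • (q : ℍ[ℝ])‖ ≤ ‖(z : ℍ[ℝ]) - q‖ + ‖((-z : sphere (0 : ℍ[ℝ]) 1) : ℍ[ℝ]) - q‖ := by
      rw [← norm_neg]
      convert norm_add_le _ _ using 2
      rw [coe_neg_sphere, two_smul]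
      abel
    rw [norm_smul, hq, Real.norm_eq_abs, abs_two] at h
    linarith

instance : SimplyConnectedSpace (sphere (0 : ℍ[ℝ]) 1) :=
  simplyConnectedSpace_sphere (by rw [Quaternion.finrank_eq_four]; norm_num)

/-- A space homeomorphic to the space of orthonormal pairs of imaginary quaternions is path
connected with fundamental group of order two. -/
theorem pathConnectedSpace_and_fundamentalGroup {X : Type*} [TopologicalSpace X]
    (e : quaternionFrames ≃ₜ X) :
    PathConnectedSpace X ∧
      ∀ x : X, Nonempty (FundamentalGroup X x ≃* Multiplicative (ZMod 2)) := by
  -- For a simply connected total space the fundamental group of the quotient is the opposite of the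
  -- acting group, here of order two.
  have hcov := isQuotientCoveringMap_rotate.homeomorph_comp e
  refine ⟨hcov.surjective.pathConnectedSpace hcov.continuous, fun x => ?_⟩
  obtain ⟨q, rfl⟩ := hcov.surjective x
  have hcard : Nat.card ℤˣᵐᵒᵖ = 2 := by
    rw [Nat.card_congr MulOpposite.opEquiv.symm, Nat.card_eq_fintype_card]
    rfl
  have : Fact (Nat.Prime 2) := ⟨Nat.prime_two⟩
  exact ⟨(hcov.fundamentalGroupEquiv ⟨q, rfl⟩).trans
    (mulEquivOfPrimeCardEq (p := 2) hcard (by simp))⟩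

end quaternionFrames

end QuaternionFrames

namespace Kerr

/-! ### Smoothness of the metric coefficients -/

section Smoothness

variable {M a : ℝ} {q : Fin 4 → ℝ}

theorem radius_sq (q : Fin 4 → ℝ) : radius q ^ 2 = q 1 ^ 2 + q 2 ^ 2 + q 3 ^ 2 :=
  Real.sq_sqrt (by positivity)

theorem rhoSq_pos (a : ℝ) (hr : 0 < radius q) : 0 < rhoSq a q := by
  unfold rhoSq; positivity

theorem contDiffAt_radius {n : WithTop ℕ∞} (hr : 0 < radius q) : ContDiffAt ℝ n radius q := by
  have h : q 1 ^ 2 + q 2 ^ 2 + q 3 ^ 2 ≠ 0 := by rw [← radius_sq]; positivity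
  exact ContDiffAt.sqrt (by fun_prop) h

theorem continuous_radius : Continuous radius := by
  unfold radius; fun_prop

theorem contDiffAt_rhoSq (a : ℝ) {n : WithTop ℕ∞} (hr : 0 < radius q) :
    ContDiffAt ℝ n (rhoSq a) q := by
  have h := contDiffAt_radius (n := n) hr
  have h3 : ContDiffAt ℝ n (fun q : Fin 4 → ℝ => q 3) q := by fun_prop
  exact (h.pow 2).add (contDiffAt_const.mul ((h3.div h hr.ne').pow 2))

theorem contDiffAt_Delta (M a : ℝ) {n : WithTop ℕ∞} (hr : 0 < radius q) :
    ContDiffAt ℝ n (Delta M a) q := by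
  have h := contDiffAt_radius (n := n) hr
  exact ((h.pow 2).sub (contDiffAt_const.mul h)).add contDiffAt_const

theorem contDiffAt_dr {n : WithTop ℕ∞} (hr : 0 < radius q) (μ : Fin 4) :
    ContDiffAt ℝ n (fun q => dr q μ) q := by
  have h := contDiffAt_radius (n := n) hr
  have hi : ∀ i : Fin 4, ContDiffAt ℝ n (fun q : Fin 4 → ℝ => q i) q := fun i => by fun_prop
  fin_cases μ
  · exact contDiffAt_const
  · exact (hi 1).div h hr.ne'
  · exact (hi 2).div h hr.ne'
  · exact (hi 3).div h hr.ne'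

theorem contDiffAt_sinSqDphi {n : WithTop ℕ∞} (hr : 0 < radius q) (μ : Fin 4) :
    ContDiffAt ℝ n (fun q => sinSqDphi q μ) q := by
  have h := (contDiffAt_radius (n := n) hr).pow 2
  have hi : ∀ i : Fin 4, ContDiffAt ℝ n (fun q : Fin 4 → ℝ => q i) q := fun i => by fun_prop
  have h0 : radius q ^ 2 ≠ 0 := by positivity
  fin_cases μ
  · exact contDiffAt_const
  · exact (hi 2).neg.div h h0
  · exact (hi 1).div h h0
  · exact contDiffAt_const

theorem contDiffAt_metric {n : WithTop ℕ∞} (hr : 0 < radius q) (hΔ : Delta M a q ≠ 0)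
    (μ ν : Fin 4) : ContDiffAt ℝ n (fun q => metric M a q μ ν) q := by
  have h := contDiffAt_radius (n := n) hr
  have hρ := contDiffAt_rhoSq a (n := n) hr
  have hD := contDiffAt_Delta M a (n := n) hr
  have hρ0 := (rhoSq_pos a hr).ne'
  have hr2 : radius q ^ 2 ≠ 0 := by positivity
  have hω := contDiffAt_sinSqDphi (n := n) hr
  have hd := contDiffAt_dr (n := n) hr
  have h2 : ContDiffAt ℝ n (fun q => 2 * M * radius q) q := contDiffAt_const.mul h
  unfold metric
  refine ((((?_ : ContDiffAt ℝ n _ q).add ?_).add ?_).sub ?_).add ?_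
  · exact (contDiffAt_const.sub (h2.div hρ hρ0)).neg.mul contDiffAt_const
  · exact (hρ.div hD hΔ).mul ((hd μ).mul (hd ν))
  · exact (hρ.div (h.pow 2) hr2).mul (contDiffAt_const.sub ((hd μ).mul (hd ν)))
  · exact ((h2.mul contDiffAt_const).div hρ hρ0).mul
      ((contDiffAt_const.mul (hω ν)).add ((hω μ).mul contDiffAt_const))
  · exact (contDiffAt_const.mul (contDiffAt_const.add (h2.div hρ hρ0))).mul ((hω μ).mul (hω ν))

end Smoothness

/-! ### The separated Hamiltonian and inversion of the metric -/

noncomputable section Hamiltonian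

variable (M a : ℝ)

/-- The radial component of the covector, times the radius. -/
def dilation (q p : Fin 4 → ℝ) : ℝ := q 1 * p 1 + q 2 * p 2 + q 3 * p 3

/-- The component of the angular momentum along the axis. -/
def angMom (q p : Fin 4 → ℝ) : ℝ := q 1 * p 2 - q 2 * p 1

/-- The squared Euclidean length of the spatial part of a covector. -/
def spatialSq (p : Fin 4 → ℝ) : ℝ := p 1 ^ 2 + p 2 ^ 2 + p 3 ^ 2

/-- The separated form of `ρ² g⁻¹(p, p)` in terms of the radius `r`, the dilation `α`, the axial
angular momentum `L`, the time component `e` and the squared spatial length `w` of the covector,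
and the coordinate `z`. -/
def separated (r α L e w z : ℝ) : ℝ :=
  (r ^ 2 - 2 * M * r + a ^ 2) * α ^ 2 / r ^ 2
    - ((r ^ 2 + a ^ 2) * e + a * L) ^ 2 / (r ^ 2 - 2 * M * r + a ^ 2)
    + (r ^ 2 * w - α ^ 2 + 2 * a * e * L + a ^ 2 * e ^ 2 * (1 - z ^ 2 / r ^ 2))

/-- The function `ρ² g⁻¹(p, p)` on the cotangent bundle. -/
def nullFun (q p : Fin 4 → ℝ) : ℝ :=
  separated M a (radius q) (dilation q p) (angMom q p) (p 0) (spatialSq p) (q 3)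

/-- The functions `sepR`, `sepA`, `sepL`, `sepE`, `sepZ` are the partial derivatives of `separated`
in `r`, `α`, `L`, `e`, `z`; the remaining one, in `w`, is `r²`. Working in these scalars keeps all
later computations free of polar angles, hence valid on the axis. -/
def sepR (r α L e w z : ℝ) : ℝ :=
  (2 * (r - M) / r ^ 2 - 2 * (r ^ 2 - 2 * M * r + a ^ 2) / r ^ 3) * α ^ 2
    - (4 * r * e * ((r ^ 2 + a ^ 2) * e + a * L) * (r ^ 2 - 2 * M * r + a ^ 2)
        - ((r ^ 2 + a ^ 2) * e + a * L) ^ 2 * (2 * (r - M))) / (r ^ 2 - 2 * M * r + a ^ 2) ^ 2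
    + 2 * r * w + 2 * a ^ 2 * e ^ 2 * z ^ 2 / r ^ 3

def sepA (r α : ℝ) : ℝ := 2 * (r ^ 2 - 2 * M * r + a ^ 2) * α / r ^ 2 - 2 * α

def sepL (r L e : ℝ) : ℝ :=
  -2 * a * ((r ^ 2 + a ^ 2) * e + a * L) / (r ^ 2 - 2 * M * r + a ^ 2) + 2 * a * e

def sepE (r L e z : ℝ) : ℝ :=
  -2 * ((r ^ 2 + a ^ 2) * e + a * L) * (r ^ 2 + a ^ 2) / (r ^ 2 - 2 * M * r + a ^ 2)
    + 2 * a * L + 2 * a ^ 2 * e * (1 - z ^ 2 / r ^ 2)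

def sepZ (r e z : ℝ) : ℝ := -2 * a ^ 2 * e ^ 2 * z / r ^ 2

variable {M a}

theorem hasDerivAt_separated {r α L e w z : ℝ → ℝ} {r' α' L' e' w' z' s : ℝ}
    (hr : HasDerivAt r r' s) (hα : HasDerivAt α α' s) (hL : HasDerivAt L L' s)
    (he : HasDerivAt e e' s) (hw : HasDerivAt w w' s) (hz : HasDerivAt z z' s) (hr0 : r s ≠ 0)
    (hΔ : r s ^ 2 - 2 * M * r s + a ^ 2 ≠ 0) :
    HasDerivAt (fun s => separated M a (r s) (α s) (L s) (e s) (w s) (z s))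
      (sepR M a (r s) (α s) (L s) (e s) (w s) (z s) * r' + sepA M a (r s) (α s) * α'
        + sepL M a (r s) (L s) (e s) * L' + sepE M a (r s) (L s) (e s) (z s) * e'
        + r s ^ 2 * w' + sepZ a (r s) (e s) (z s) * z') s := by
  have hD : HasDerivAt (fun s => r s ^ 2 - 2 * M * r s + a ^ 2) ((2 * r s - 2 * M) * r') s := by
    convert! (((hr.pow 2).sub (hr.const_mul (2 * M))).add_const (a ^ 2)) using 1
    simp; ring
  have hP : HasDerivAt (fun s => (r s ^ 2 + a ^ 2) * e s + a * L s)
      (2 * r s * r' * e s + (r s ^ 2 + a ^ 2) * e' + a * L') s := by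
    convert! ((((hr.pow 2).add_const (a ^ 2)).mul he).add (hL.const_mul a)) using 1
    simp
  have h1 := (hD.mul (hα.pow 2)).div (hr.pow 2) (pow_ne_zero 2 hr0)
  have h2 := (hP.pow 2).div hD hΔ
  have h3 := ((((hr.pow 2).mul hw).sub (hα.pow 2)).add ((he.const_mul (2 * a)).mul hL)).add
    (((he.pow 2).const_mul (a ^ 2)).mul (((hz.pow 2).div (hr.pow 2) (pow_ne_zero 2 hr0)).const_sub 1))
  convert! (h1.sub h2).add h3 using 1
  simp only [sepR, sepA, sepL, sepE, sepZ]
  simp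
  generalize hDe : r s ^ 2 - 2 * M * r s + a ^ 2 = D at *
  field_simp
  ring

/-- The derivative of `nullFun` with respect to the position. -/
def gradQ (M a : ℝ) (q p : Fin 4 → ℝ) : Fin 4 → ℝ :=
  let NR := sepR M a (radius q) (dilation q p) (angMom q p) (p 0) (spatialSq p) (q 3)
  let NA := sepA M a (radius q) (dilation q p)
  let NL := sepL M a (radius q) (angMom q p) (p 0)
  let NZ := sepZ a (radius q) (p 0) (q 3)
  ![0, NR * (q 1 / radius q) + NA * p 1 + NL * p 2, NR * (q 2 / radius q) + NA * p 2 - NL * p 1,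
    NR * (q 3 / radius q) + NA * p 3 + NZ]

/-- The derivative of `nullFun` with respect to the momentum. -/
def gradP (M a : ℝ) (q p : Fin 4 → ℝ) : Fin 4 → ℝ :=
  let NA := sepA M a (radius q) (dilation q p)
  let NL := sepL M a (radius q) (angMom q p) (p 0)
  ![sepE M a (radius q) (angMom q p) (p 0) (q 3),
    NA * q 1 - NL * q 2 + 2 * radius q ^ 2 * p 1, NA * q 2 + NL * q 1 + 2 * radius q ^ 2 * p 2,
    NA * q 3 + 2 * radius q ^ 2 * p 3]

/-- The velocity with a given momentum. -/
def vel (M a : ℝ) (q p : Fin 4 → ℝ) : Fin 4 → ℝ := (2 * rhoSq a q)⁻¹ • gradP M a q p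

/-- The rate of change of the momentum along a null geodesic. -/
def force (M a : ℝ) (q p : Fin 4 → ℝ) : Fin 4 → ℝ := -((2 * rhoSq a q)⁻¹ • gradQ M a q p)

theorem hasDerivAt_apply {c : ℝ → Fin 4 → ℝ} {c' : Fin 4 → ℝ} {s : ℝ} (h : HasDerivAt c c' s)
    (i : Fin 4) : HasDerivAt (fun s => c s i) (c' i) s := hasDerivAt_pi.1 h i

theorem hasDerivAt_radius {q : ℝ → Fin 4 → ℝ} {q' : Fin 4 → ℝ} {s : ℝ} (hq : HasDerivAt q q' s)
    (hr : 0 < radius (q s)) : HasDerivAt (fun s => radius (q s))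
      ((q s 1 * q' 1 + q s 2 * q' 2 + q s 3 * q' 3) / radius (q s)) s := by
  have h := ((((hasDerivAt_apply hq 1).pow 2).add ((hasDerivAt_apply hq 2).pow 2)).add
    ((hasDerivAt_apply hq 3).pow 2)).sqrt (by
      have := radius_sq (q s)
      simp only [Pi.add_apply, Pi.pow_apply]
      rw [← this]; positivity)
  convert! h using 1
  simp only [radius, Pi.add_apply, Pi.pow_apply]
  rw [← mul_div_mul_left _ _ (two_ne_zero' ℝ)]
  congr 1
  simp
  ring

theorem hasDerivAt_dilation {q p : ℝ → Fin 4 → ℝ} {q' p' : Fin 4 → ℝ} {s : ℝ}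
    (hq : HasDerivAt q q' s) (hp : HasDerivAt p p' s) :
    HasDerivAt (fun s => dilation (q s) (p s)) (dilation q' (p s) + dilation (q s) p') s := by
  have h := (((hasDerivAt_apply hq 1).mul (hasDerivAt_apply hp 1)).add
    ((hasDerivAt_apply hq 2).mul (hasDerivAt_apply hp 2))).add
    ((hasDerivAt_apply hq 3).mul (hasDerivAt_apply hp 3))
  convert! h using 1
  simp only [dilation]; ring

theorem hasDerivAt_angMom {q p : ℝ → Fin 4 → ℝ} {q' p' : Fin 4 → ℝ} {s : ℝ}
    (hq : HasDerivAt q q' s) (hp : HasDerivAt p p' s) :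
    HasDerivAt (fun s => angMom (q s) (p s)) (angMom q' (p s) + angMom (q s) p') s := by
  have h := ((hasDerivAt_apply hq 1).mul (hasDerivAt_apply hp 2)).sub
    ((hasDerivAt_apply hq 2).mul (hasDerivAt_apply hp 1))
  convert! h using 1
  simp only [angMom]; ring

theorem hasDerivAt_spatialSq {p : ℝ → Fin 4 → ℝ} {p' : Fin 4 → ℝ} {s : ℝ}
    (hp : HasDerivAt p p' s) : HasDerivAt (fun s => spatialSq (p s)) (2 * dilation (p s) p') s := by
  have h := (((hasDerivAt_apply hp 1).pow 2).add ((hasDerivAt_apply hp 2).pow 2)).add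
    ((hasDerivAt_apply hp 3).pow 2)
  convert! h using 1
  simp [dilation]; ring

theorem hasDerivAt_nullFun {q p : ℝ → Fin 4 → ℝ} {q' p' : Fin 4 → ℝ} {s : ℝ}
    (hq : HasDerivAt q q' s) (hp : HasDerivAt p p' s) (hr : 0 < radius (q s))
    (hΔ : Delta M a (q s) ≠ 0) :
    HasDerivAt (fun s => nullFun M a (q s) (p s))
      (∑ i, gradQ M a (q s) (p s) i * q' i + ∑ i, gradP M a (q s) (p s) i * p' i) s := by
  convert! hasDerivAt_separated (M := M) (a := a) (hasDerivAt_radius hq hr)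
    (hasDerivAt_dilation hq hp) (hasDerivAt_angMom hq hp) (hasDerivAt_apply hp 0)
    (hasDerivAt_spatialSq hp) (hasDerivAt_apply hq 3) hr.ne' hΔ using 1
  simp only [Fin.sum_univ_four, gradQ, gradP, dilation, angMom]
  simp
  ring

/-- This is Euler's identity: `nullFun` is a quadratic form in the momentum. -/
theorem sum_mul_gradP {q : Fin 4 → ℝ} (p : Fin 4 → ℝ) (hr : 0 < radius q)
    (hΔ : Delta M a q ≠ 0) : ∑ i, p i * gradP M a q p i = 2 * nullFun M a q p := by
  have hΔ' : radius q ^ 2 - 2 * M * radius q + a ^ 2 ≠ 0 := hΔ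
  simp only [Fin.sum_univ_four, gradP, nullFun, separated, sepA, sepL, sepE]
  simp
  generalize radius q ^ 2 - 2 * M * radius q + a ^ 2 = D at *
  have h1 : q 1 * p 1 = dilation q p - q 2 * p 2 - q 3 * p 3 := by simp only [dilation]; ring
  have h2 : q 1 * p 2 = angMom q p + q 2 * p 1 := by simp only [angMom]; ring
  have h3 : p 1 ^ 2 = spatialSq p - p 2 ^ 2 - p 3 ^ 2 := by simp only [spatialSq]; ring
  field_simp
  linear_combination ((D - radius q ^ 2) * D * dilation q p) * h1 +
    ((-a * (p 0 * (radius q ^ 2 + a ^ 2) + a * angMom q p) + D * a * p 0) * radius q ^ 2) * h2 +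
    radius q ^ 4 * D * h3

theorem lower_apply (q v : Fin 4 → ℝ) (μ : Fin 4) :
    lower M a q v μ = -(1 - 2 * M * radius q / rhoSq a q) * v 0 * dt μ
      + rhoSq a q / Delta M a q * (∑ ν, dr q ν * v ν) * dr q μ
      + rhoSq a q / radius q ^ 2 * (![0, v 1, v 2, v 3] μ - (∑ ν, dr q ν * v ν) * dr q μ)
      - 2 * M * radius q * a / rhoSq a q *
        (dt μ * (∑ ν, sinSqDphi q ν * v ν) + sinSqDphi q μ * v 0)
      + a ^ 2 * (1 + 2 * M * radius q / rhoSq a q) * (∑ ν, sinSqDphi q ν * v ν)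
        * sinSqDphi q μ := by
  fin_cases μ <;>
  · simp [lower, metric, Fin.sum_univ_four, dt, dr, sinSqDphi, flat, Matrix.diagonal_apply]
    ring

/-- This is the verification that `nullFun / ρ²` is the quadratic form of the inverse metric. The
metric involves a vector only through its time component, its `dr` and `sin² ϑ dφ` values and its
flat part, so these are computed first; the coefficients of `dt` and of `sin² ϑ dφ` then reduce to
the identities `I2` and `I1`. -/
theorem lower_vel {q : Fin 4 → ℝ} (p : Fin 4 → ℝ) (hr : 0 < radius q) (hΔ : Delta M a q ≠ 0) :
    lower M a q (vel M a q p) = p := by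
  have hρ := (rhoSq_pos a hr).ne'
  have hr0 := hr.ne'
  have hr2 := radius_sq q
  set s : ℝ := 1 - q 3 ^ 2 / radius q ^ 2 with hs
  have hxy : q 1 ^ 2 + q 2 ^ 2 = radius q ^ 2 * s := by
    rw [hs]; field_simp; linarith
  have hρs : rhoSq a q = radius q ^ 2 + a ^ 2 * (1 - s) := by
    rw [rhoSq, hs]; field_simp; ring
  set P := (radius q ^ 2 + a ^ 2) * p 0 + a * angMom q p with hP
  have hv0 : vel M a q p 0 = (rhoSq a q)⁻¹ *
      (-P * (radius q ^ 2 + a ^ 2) / Delta M a q + a * angMom q p + a ^ 2 * p 0 * s) := by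
    have hd : radius q ^ 2 - 2 * M * radius q + a ^ 2 = Delta M a q := rfl
    simp [vel, gradP, sepE, ← hP, ← hs, hd]
    field_simp
  have hvr : ∑ ν, dr q ν * vel M a q p ν =
      Delta M a q * dilation q p / (radius q * rhoSq a q) := by
    have hd : radius q ^ 2 - 2 * M * radius q + a ^ 2 = Delta M a q := rfl
    simp [Fin.sum_univ_four, dr, vel, gradP, sepA, hd]
    field_simp
    simp only [dilation]
    linear_combination (2 * (Delta M a q - radius q ^ 2) *
      (q 1 * p 1 + q 2 * p 2 + q 3 * p 3)) * (-hr2)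
  have hvω : ∑ ν, sinSqDphi q ν * vel M a q p ν = (rhoSq a q)⁻¹ *
      (-P / Delta M a q * a * s + angMom q p + a * p 0 * s) := by
    have hd : radius q ^ 2 - 2 * M * radius q + a ^ 2 = Delta M a q := rfl
    simp [Fin.sum_univ_four, sinSqDphi, vel, gradP, sepL, ← hP, hd]
    field_simp
    simp only [angMom]
    linear_combination (2 * a * (-P + p 0 * Delta M a q)) * hxy
  have hD : Delta M a q = radius q ^ 2 - 2 * M * radius q + a ^ 2 := rfl
  set v0 := vel M a q p 0
  set W := ∑ ν, sinSqDphi q ν * vel M a q p ν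
  set k := 2 * M * radius q / rhoSq a q with hk
  have hkR : k * rhoSq a q = radius q ^ 2 + a ^ 2 - Delta M a q := by
    rw [hk, hD]; field_simp; ring
  have hv0' : v0 * rhoSq a q * Delta M a q = -P * (radius q ^ 2 + a ^ 2) +
      (a * angMom q p + a ^ 2 * p 0 * s) * Delta M a q := by
    rw [hv0]; field_simp; ring
  have hW' : W * rhoSq a q * Delta M a q = -P * a * s +
      (angMom q p + a * p 0 * s) * Delta M a q := by
    rw [hvω]; field_simp; ring
  -- The identities `haW` and `hX` are the two linear relations between `v0` and `W` from which `I1`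
  -- and `I2` follow without further use of the definition of `ρ²`.
  have haW : a * W = v0 + P / Delta M a q := by
    rw [← sub_eq_zero]
    have : (a * W - (v0 + P / Delta M a q)) * (rhoSq a q * Delta M a q) = 0 := by
      field_simp
      linear_combination a * hW' - hv0' - P * hρs
    simpa [hρ, hΔ] using this
  have hX : v0 = -k * P / Delta M a q - p 0 := by
    rw [← sub_eq_zero]
    have : (v0 - (-k * P / Delta M a q - p 0)) * (rhoSq a q * Delta M a q) = 0 := by
      field_simp
      linear_combination hv0' + P * hkR + p 0 * Delta M a q * hρs - Delta M a q * hP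
    simpa [hρ, hΔ] using this
  have I1 : sepL M a (radius q) (angMom q p) (p 0) / 2 - k * a * v0 + a ^ 2 * (1 + k) * W = 0 := by
    have h1 : sepL M a (radius q) (angMom q p) (p 0) / 2 = -a * P / Delta M a q + a * p 0 := by
      rw [sepL, ← hD, ← hP]; ring
    rw [h1]
    linear_combination a * (1 + k) * haW + a * hX
  have I2 : -(1 - k) * v0 - k * a * W = p 0 := by
    linear_combination -k * haW - hX
  have hka : 2 * M * radius q * a / rhoSq a q = k * a := by rw [hk]; ring
  funext μ
  rw [lower_apply, hvr, hka]
  change -(1 - k) * v0 * dt μ + _ + _ - k * a * (dt μ * W + sinSqDphi q μ * v0)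
    + a ^ 2 * (1 + k) * W * sinSqDphi q μ = p μ
  have hvi : ∀ i, vel M a q p i = (2 * rhoSq a q)⁻¹ * gradP M a q p i := fun i => rfl
  fin_cases μ
  · simp only [dt, dr, sinSqDphi]
    simp
    linear_combination I2
  · have e : vel M a q p 1 = (2 * rhoSq a q)⁻¹ * (sepA M a (radius q) (dilation q p) * q 1
        - sepL M a (radius q) (angMom q p) (p 0) * q 2 + 2 * radius q ^ 2 * p 1) := rfl
    simp [dt, dr, sinSqDphi, e]
    rw [sepA, ← hD]
    field_simp
    linear_combination (-2 * radius q ^ 2 * q 2) * I1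
  · have e : vel M a q p 2 = (2 * rhoSq a q)⁻¹ * (sepA M a (radius q) (dilation q p) * q 2
        + sepL M a (radius q) (angMom q p) (p 0) * q 1 + 2 * radius q ^ 2 * p 2) := rfl
    simp [dt, dr, sinSqDphi, e]
    rw [sepA, ← hD]
    field_simp
    linear_combination (2 * radius q ^ 2 * q 1) * I1
  · have e : vel M a q p 3 = (2 * rhoSq a q)⁻¹ * (sepA M a (radius q) (dilation q p) * q 3
        + 2 * radius q ^ 2 * p 3) := rfl
    simp [dt, dr, sinSqDphi, e]
    rw [sepA, ← hD]
    field_simp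
    ring

end Hamiltonian

/-! ### Null geodesics as integral curves of a vector field on the cotangent bundle -/

section Geodesics

variable {M a : ℝ} {q : Fin 4 → ℝ}

/-- A square matrix with a right inverse is injective, so `lower_vel` also gives the inverse on the
other side. -/
theorem vel_lower (v : Fin 4 → ℝ) (hr : 0 < radius q) (hΔ : Delta M a q ≠ 0) :
    vel M a q (lower M a q v) = v := by
  have hsurj : Function.Surjective (metric M a q).mulVec := fun p =>
    ⟨vel M a q p, lower_vel p hr hΔ⟩
  have hinj : Function.Injective (metric M a q).mulVec :=
    Matrix.mulVec_injective_iff_isUnit.2 (Matrix.mulVec_surjective_iff_isUnit.1 hsurj)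
  exact hinj (lower_vel (lower M a q v) hr hΔ)

theorem sum_metric_eq_sum_lower (v : Fin 4 → ℝ) :
    ∑ μ, ∑ ν, metric M a q μ ν * v μ * v ν = ∑ μ, lower M a q v μ * v μ := by
  simp only [lower, Finset.sum_mul]
  exact Finset.sum_congr rfl fun _ _ => Finset.sum_congr rfl fun _ _ => by ring

theorem rhoSq_mul_sum_metric (v : Fin 4 → ℝ) (hr : 0 < radius q) (hΔ : Delta M a q ≠ 0) :
    rhoSq a q * ∑ μ, ∑ ν, metric M a q μ ν * v μ * v ν = nullFun M a q (lower M a q v) := by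
  have hρ := (rhoSq_pos a hr).ne'
  rw [sum_metric_eq_sum_lower]
  have h1 := sum_mul_gradP (lower M a q v) hr hΔ
  have h2 : ∑ μ, lower M a q v μ * v μ =
      (2 * rhoSq a q)⁻¹ * ∑ μ, lower M a q v μ * gradP M a q (lower M a q v) μ := by
    rw [Finset.mul_sum]
    refine Finset.sum_congr rfl fun μ _ => ?_
    conv_lhs => rw [← vel_lower v hr hΔ, lower_vel _ hr hΔ]
    simp only [vel, Pi.smul_apply, smul_eq_mul]
    ring
  rw [h2, h1]
  field_simp

theorem hasDerivAt_metric {c : ℝ → Fin 4 → ℝ} {c' : Fin 4 → ℝ} {s : ℝ} (hc : HasDerivAt c c' s)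
    (hr : 0 < radius (c s)) (hΔ : Delta M a (c s) ≠ 0) (α β : Fin 4) :
    HasDerivAt (fun s => metric M a (c s) α β)
      (fderiv ℝ (fun q => metric M a q α β) (c s) c') s :=
  ((contDiffAt_metric (n := 1) hr hΔ α β).differentiableAt one_ne_zero).hasFDerivAt.comp_hasDerivAt s hc

/-- The geodesic force and the Hamiltonian force agree on null covectors. -/
theorem half_sum_metricPartial (v : Fin 4 → ℝ) (hr : 0 < radius q) (hΔ : Delta M a q ≠ 0)
    (hN : nullFun M a q (lower M a q v) = 0) (μ : Fin 4) :
    1 / 2 * ∑ α, ∑ β, metricPartial M a q μ α β * v α * v β =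
      force M a q (lower M a q v) μ := by
  have hρ := (rhoSq_pos a hr).ne'
  -- The identity `ρ² g(v, v) = nullFun (q, g v)` is differentiated along a coordinate line with `v`
  -- fixed. The derivative of `ρ²` drops out because `v` is null. As `gradP = 2 ρ² v`, the momentum
  -- term contributes `2 ρ² ∂g(v, v)` against `ρ² ∂g(v, v)` on the left, so `gradQ = -ρ² ∂g(v, v)`.
  set c : ℝ → Fin 4 → ℝ := fun u => q + u • Pi.single μ 1 with hc
  have hc0 : c 0 = q := by simp [hc]
  have hcd : HasDerivAt c (Pi.single μ 1) 0 := by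
    simpa [hc] using ((hasDerivAt_id (0 : ℝ)).smul_const (Pi.single μ (1 : ℝ))).const_add q
  have hrc : 0 < radius (c 0) := by rwa [hc0]
  have hΔc : Delta M a (c 0) ≠ 0 := by rwa [hc0]
  have hg : ∀ α β, HasDerivAt (fun u => metric M a (c u) α β) (metricPartial M a q μ α β) 0 := by
    intro α β
    have := hasDerivAt_metric hcd hrc hΔc α β
    rw [hc0] at this
    exact this
  have hΦ : HasDerivAt (fun u => ∑ α, ∑ β, metric M a (c u) α β * v α * v β)
      (∑ α, ∑ β, metricPartial M a q μ α β * v α * v β) 0 :=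
    HasDerivAt.fun_sum fun α _ => HasDerivAt.fun_sum fun β _ => ((hg α β).mul_const _).mul_const _
  have hl : HasDerivAt (fun u => lower M a (c u) v)
      (fun α => ∑ β, metricPartial M a q μ α β * v β) 0 :=
    hasDerivAt_pi.2 fun α => HasDerivAt.fun_sum fun β _ => (hg α β).mul_const _
  have hn := hasDerivAt_nullFun hcd hl hrc hΔc
  rw [hc0] at hn
  have hρd : DifferentiableAt ℝ (fun u => rhoSq a (c u)) 0 := by
    have h1 := (contDiffAt_rhoSq a (n := 1) hrc).differentiableAt one_ne_zero
    exact h1.comp 0 hcd.differentiableAt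
  have hprod := hρd.hasDerivAt.mul hΦ
  have hcc : ContinuousAt c 0 := hcd.continuousAt
  have hev : ∀ᶠ u in 𝓝 (0 : ℝ), 0 < radius (c u) ∧ Delta M a (c u) ≠ 0 := by
    have h1 : ContinuousAt (fun u => radius (c u)) 0 :=
      continuous_radius.continuousAt.comp hcc
    have h2 : ContinuousAt (fun u => Delta M a (c u)) 0 := by
      have := (contDiffAt_Delta M a (n := 1) hrc).continuousAt
      exact this.comp hcc
    exact (h1.eventually (lt_mem_nhds hrc)).and (h2.eventually_ne hΔc)
  have heq : (fun u => nullFun M a (c u) (lower M a (c u) v)) =ᶠ[𝓝 0]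
      (fun u => rhoSq a (c u)) * fun u => ∑ α, ∑ β, metric M a (c u) α β * v α * v β := by
    filter_upwards [hev] with u hu
    exact (rhoSq_mul_sum_metric v hu.1 hu.2).symm
  have hd := (hprod.congr_of_eventuallyEq heq).unique hn
  have hΦ0 : ∑ α, ∑ β, metric M a q α β * v α * v β = 0 := by
    have := rhoSq_mul_sum_metric v hr hΔ
    rw [hN] at this
    exact (mul_eq_zero.1 this).resolve_left hρ
  have hgr : ∀ i, gradP M a q (lower M a q v) i = 2 * rhoSq a q * v i := by
    intro i
    have : vel M a q (lower M a q v) i = v i := by rw [vel_lower v hr hΔ]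
    rw [← this]
    simp only [vel, Pi.smul_apply, smul_eq_mul]
    field_simp
  have hsum : ∑ i, gradP M a q (lower M a q v) i * ∑ β, metricPartial M a q μ i β * v β =
      2 * rhoSq a q * ∑ α, ∑ β, metricPartial M a q μ α β * v α * v β := by
    rw [Finset.mul_sum]
    refine Finset.sum_congr rfl fun i _ => ?_
    rw [hgr, Finset.mul_sum, Finset.mul_sum]
    exact Finset.sum_congr rfl fun β _ => by ring
  have hsingle : ∑ i, gradQ M a q (lower M a q v) i * (Pi.single μ 1 : Fin 4 → ℝ) i =
      gradQ M a q (lower M a q v) μ := by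
    simp [Pi.single_apply]
  rw [hsum, hsingle] at hd
  simp only [hc0, hΦ0, mul_zero, zero_add] at hd
  simp only [force, Pi.neg_apply, Pi.smul_apply, smul_eq_mul]
  field_simp
  linarith

/-- The vector field of the null geodesics on the cotangent bundle. -/
noncomputable def nullField (M a : ℝ) (w : (Fin 4 → ℝ) × (Fin 4 → ℝ)) :
    (Fin 4 → ℝ) × (Fin 4 → ℝ) := (vel M a w.1 w.2, force M a w.1 w.2)

section Smooth

variable {X : Type*} [NormedAddCommGroup X] [NormedSpace ℝ X] {n : WithTop ℕ∞} {x : X}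
  {r α L e w z : X → ℝ}

theorem contDiffAt_sepR (hr : ContDiffAt ℝ n r x) (hα : ContDiffAt ℝ n α x)
    (hL : ContDiffAt ℝ n L x) (he : ContDiffAt ℝ n e x) (hw : ContDiffAt ℝ n w x)
    (hz : ContDiffAt ℝ n z x) (h0 : r x ≠ 0) (hΔ : r x ^ 2 - 2 * M * r x + a ^ 2 ≠ 0) :
    ContDiffAt ℝ n (fun x => sepR M a (r x) (α x) (L x) (e x) (w x) (z x)) x := by
  unfold sepR
  have h2 := pow_ne_zero 2 h0
  have h3 := pow_ne_zero 3 h0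
  have h4 := pow_ne_zero 2 hΔ
  fun_prop (disch := assumption)

theorem contDiffAt_sepA (hr : ContDiffAt ℝ n r x) (hα : ContDiffAt ℝ n α x) (h0 : r x ≠ 0) :
    ContDiffAt ℝ n (fun x => sepA M a (r x) (α x)) x := by
  unfold sepA
  have h2 := pow_ne_zero 2 h0
  fun_prop (disch := assumption)

theorem contDiffAt_sepL (hr : ContDiffAt ℝ n r x) (hL : ContDiffAt ℝ n L x)
    (he : ContDiffAt ℝ n e x) (hΔ : r x ^ 2 - 2 * M * r x + a ^ 2 ≠ 0) :
    ContDiffAt ℝ n (fun x => sepL M a (r x) (L x) (e x)) x := by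
  unfold sepL
  fun_prop (disch := assumption)

theorem contDiffAt_sepE (hr : ContDiffAt ℝ n r x) (hL : ContDiffAt ℝ n L x)
    (he : ContDiffAt ℝ n e x) (hz : ContDiffAt ℝ n z x) (h0 : r x ≠ 0)
    (hΔ : r x ^ 2 - 2 * M * r x + a ^ 2 ≠ 0) :
    ContDiffAt ℝ n (fun x => sepE M a (r x) (L x) (e x) (z x)) x := by
  unfold sepE
  have h2 := pow_ne_zero 2 h0
  fun_prop (disch := assumption)

theorem contDiffAt_sepZ (hr : ContDiffAt ℝ n r x) (he : ContDiffAt ℝ n e x)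
    (hz : ContDiffAt ℝ n z x) (h0 : r x ≠ 0) :
    ContDiffAt ℝ n (fun x => sepZ a (r x) (e x) (z x)) x := by
  unfold sepZ
  have h2 := pow_ne_zero 2 h0
  fun_prop (disch := assumption)

end Smooth

theorem contDiffAt_nullField {n : WithTop ℕ∞} {w : (Fin 4 → ℝ) × (Fin 4 → ℝ)}
    (hr : 0 < radius w.1) (hΔ : Delta M a w.1 ≠ 0) : ContDiffAt ℝ n (nullField M a) w := by
  have h0 := hr.ne'
  have hrad : ContDiffAt ℝ n (fun w : (Fin 4 → ℝ) × (Fin 4 → ℝ) => radius w.1) w :=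
    (contDiffAt_radius hr).comp w contDiffAt_fst
  have hρ : ContDiffAt ℝ n (fun w : (Fin 4 → ℝ) × (Fin 4 → ℝ) => (2 * rhoSq a w.1)⁻¹) w :=
    ((contDiffAt_const.mul ((contDiffAt_rhoSq a hr).comp w contDiffAt_fst))).inv
      (by have := rhoSq_pos a hr; simpa using this.ne')
  have hα : ContDiffAt ℝ n (fun w : (Fin 4 → ℝ) × (Fin 4 → ℝ) => dilation w.1 w.2) w := by
    unfold dilation; fun_prop
  have hL : ContDiffAt ℝ n (fun w : (Fin 4 → ℝ) × (Fin 4 → ℝ) => angMom w.1 w.2) w := by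
    unfold angMom; fun_prop
  have hw : ContDiffAt ℝ n (fun w : (Fin 4 → ℝ) × (Fin 4 → ℝ) => spatialSq w.2) w := by
    unfold spatialSq; fun_prop
  have hq : ∀ i, ContDiffAt ℝ n (fun w : (Fin 4 → ℝ) × (Fin 4 → ℝ) => w.1 i) w := fun i => by
    fun_prop
  have hp : ∀ i, ContDiffAt ℝ n (fun w : (Fin 4 → ℝ) × (Fin 4 → ℝ) => w.2 i) w := fun i => by
    fun_prop
  have hR := contDiffAt_sepR (M := M) (a := a) hrad hα hL (hp 0) hw (hq 3) h0 hΔ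
  have hA := contDiffAt_sepA (M := M) (a := a) hrad hα h0
  have hNL := contDiffAt_sepL (M := M) (a := a) hrad hL (hp 0) hΔ
  have hE := contDiffAt_sepE (M := M) (a := a) hrad hL (hp 0) (hq 3) h0 hΔ
  have hZ := contDiffAt_sepZ (a := a) hrad (hp 0) (hq 3) h0
  have hP : ContDiffAt ℝ n (fun w : (Fin 4 → ℝ) × (Fin 4 → ℝ) => gradP M a w.1 w.2) w := by
    rw [contDiffAt_pi]
    intro i
    fin_cases i
    · exact hE
    · exact ((hA.mul (hq 1)).sub (hNL.mul (hq 2))).add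
        ((contDiffAt_const.mul (hrad.pow 2)).mul (hp 1))
    · exact ((hA.mul (hq 2)).add (hNL.mul (hq 1))).add
        ((contDiffAt_const.mul (hrad.pow 2)).mul (hp 2))
    · exact (hA.mul (hq 3)).add ((contDiffAt_const.mul (hrad.pow 2)).mul (hp 3))
  have hQ : ContDiffAt ℝ n (fun w : (Fin 4 → ℝ) × (Fin 4 → ℝ) => gradQ M a w.1 w.2) w := by
    rw [contDiffAt_pi]
    intro i
    fin_cases i
    · exact contDiffAt_const
    · exact ((hR.mul ((hq 1).div hrad h0)).add (hA.mul (hp 1))).add (hNL.mul (hp 2))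
    · exact ((hR.mul ((hq 2).div hrad h0)).add (hA.mul (hp 2))).sub (hNL.mul (hp 1))
    · exact ((hR.mul ((hq 3).div hrad h0)).add (hA.mul (hp 3))).add hZ
  exact (hρ.smul hP).prodMk (hρ.smul hQ).neg

theorem isOpen_DOC (M a : ℝ) : IsOpen (DOC M a) :=
  isOpen_lt continuous_const continuous_radius

theorem radius_pos_of_mem_DOC (haM : a < M) (ha : 0 ≤ a) (hq : q ∈ DOC M a) : 0 < radius q := by
  have h1 : M + √(M ^ 2 - a ^ 2) < radius q := hq
  have := Real.sqrt_nonneg (M ^ 2 - a ^ 2)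
  linarith

theorem Delta_pos_of_mem_DOC (haM : a < M) (ha : 0 ≤ a) (hq : q ∈ DOC M a) :
    0 < Delta M a q := by
  have h1 : M + √(M ^ 2 - a ^ 2) < radius q := hq
  have h2 := Real.sqrt_nonneg (M ^ 2 - a ^ 2)
  have h3 : √(M ^ 2 - a ^ 2) ^ 2 = M ^ 2 - a ^ 2 := Real.sq_sqrt (by nlinarith)
  unfold Delta
  nlinarith

/-- Solutions of the null Hamiltonian system project to geodesics. -/
theorem isGeodesicOn_of_nullField (haM : a < M) (ha : 0 ≤ a) {J : Set ℝ} (hJ : IsOpen J)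
    (hJc : J.OrdConnected) {w : ℝ → (Fin 4 → ℝ) × (Fin 4 → ℝ)}
    (hw : ∀ s ∈ J, HasDerivAt w (nullField M a (w s)) s) (hD : ∀ s ∈ J, (w s).1 ∈ DOC M a)
    (hN : ∀ s ∈ J, nullFun M a (w s).1 (w s).2 = 0) :
    IsGeodesicOn M a (fun s => (w s).1) J := by
  have hq : ∀ s ∈ J, HasDerivAt (fun s => (w s).1) (vel M a (w s).1 (w s).2) s := fun s hs =>
    (hw s hs).fst
  have hp : ∀ s ∈ J, HasDerivAt (fun s => (w s).2) (force M a (w s).1 (w s).2) s := fun s hs =>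
    (hw s hs).snd
  have hfield : ∀ s ∈ J, ContDiffAt ℝ 1 (nullField M a) (w s) := fun s hs =>
    contDiffAt_nullField (radius_pos_of_mem_DOC haM ha (hD s hs))
      (Delta_pos_of_mem_DOC haM ha (hD s hs)).ne'
  have hcw : ContinuousOn w J := fun s hs => (hw s hs).continuousAt.continuousWithinAt
  -- Bootstrap: continuity of `w` makes its derivative continuous, and `C¹` regularity of `w` makes
  -- its derivative `C¹`.
  have hw1 : ContDiffOn ℝ 1 w J := by
    have h01 : ((0 : WithTop ℕ∞) + 1) = 1 := zero_add 1
    rw [← h01, contDiffOn_succ_iff_deriv_of_isOpen hJ]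
    refine ⟨fun s hs => (hw s hs).differentiableAt.differentiableWithinAt, by simp, ?_⟩
    rw [contDiffOn_zero]
    refine ContinuousOn.congr (f := fun s => nullField M a (w s)) (fun s hs => ?_)
      fun s hs => (hw s hs).deriv
    exact ((hfield s hs).continuousAt.comp (hw s hs).continuousAt).continuousWithinAt
  have hw2 : ContDiffOn ℝ 2 w J := by
    have h11 : ((1 : WithTop ℕ∞) + 1) = 2 := one_add_one_eq_two
    rw [← h11, contDiffOn_succ_iff_deriv_of_isOpen hJ]
    refine ⟨fun s hs => (hw s hs).differentiableAt.differentiableWithinAt, by simp, ?_⟩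
    refine ContDiffOn.congr (f := fun s => nullField M a (w s)) (fun s hs => ?_)
      fun s hs => (hw s hs).deriv
    exact (hfield s hs).comp_contDiffWithinAt s (hw1 s hs)
  have hlow : ∀ s ∈ J, lower M a (w s).1 (deriv (fun s => (w s).1) s) = (w s).2 := by
    intro s hs
    rw [(hq s hs).deriv]
    exact lower_vel _ (radius_pos_of_mem_DOC haM ha (hD s hs))
      (Delta_pos_of_mem_DOC haM ha (hD s hs)).ne'
  refine ⟨hJ, hJc, contDiff_fst.comp_contDiffOn hw2, hD, fun s hs μ => ?_⟩
  have hev : (fun s' => lower M a (w s').1 (deriv (fun s => (w s).1) s') μ) =ᶠ[𝓝 s]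
      fun s' => (w s').2 μ := by
    filter_upwards [hJ.mem_nhds hs] with u hu
    rw [hlow u hu]
  rw [hev.deriv_eq, (hasDerivAt_apply (hp s hs) μ).deriv, half_sum_metricPartial _
    (radius_pos_of_mem_DOC haM ha (hD s hs)) (Delta_pos_of_mem_DOC haM ha (hD s hs)).ne', hlow s hs]
  rw [hlow s hs]
  exact hN s hs

/-- The null condition is equivalent to the vanishing of the Hamiltonian. -/
theorem sum_metric_eq_zero_iff (v : Fin 4 → ℝ) (hr : 0 < radius q) (hΔ : Delta M a q ≠ 0) :
    ∑ μ, ∑ ν, metric M a q μ ν * v μ * v ν = 0 ↔ nullFun M a q (lower M a q v) = 0 := by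
  rw [← rhoSq_mul_sum_metric v hr hΔ, mul_eq_zero, or_iff_right (rhoSq_pos a hr).ne']

/-- The momentum of a null geodesic solves the null Hamiltonian system. -/
theorem hasDerivAt_nullField_of_isGeodesicOn (haM : a < M) (ha : 0 ≤ a) {γ : ℝ → Fin 4 → ℝ}
    {J : Set ℝ} (hγ : IsGeodesicOn M a γ J)
    (hnull : ∀ s ∈ J, ∑ μ, ∑ ν, metric M a (γ s) μ ν * deriv γ s μ * deriv γ s ν = 0)
    {s : ℝ} (hs : s ∈ J) :
    HasDerivAt (fun s => (γ s, lower M a (γ s) (deriv γ s)))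
      (nullField M a (γ s, lower M a (γ s) (deriv γ s))) s := by
  have hr := radius_pos_of_mem_DOC haM ha (hγ.mem_DOC s hs)
  have hΔ := (Delta_pos_of_mem_DOC haM ha (hγ.mem_DOC s hs)).ne'
  have hsm := hγ.contDiffOn
  have h11 : ((1 : WithTop ℕ∞) + 1) = 2 := one_add_one_eq_two
  rw [← h11, contDiffOn_succ_iff_deriv_of_isOpen hγ.isOpen] at hsm
  have hd : HasDerivAt γ (deriv γ s) s :=
    ((hsm.1 s hs).differentiableAt (hγ.isOpen.mem_nhds hs)).hasDerivAt
  have hdd : DifferentiableAt ℝ (deriv γ) s :=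
    ((hsm.2.2.differentiableOn one_ne_zero) s hs).differentiableAt (hγ.isOpen.mem_nhds hs)
  refine HasDerivAt.prodMk ?_ ?_
  · simp only [vel_lower _ hr hΔ]
    exact hd
  · rw [hasDerivAt_pi]
    intro μ
    change HasDerivAt _ (force M a (γ s) (lower M a (γ s) (deriv γ s)) μ) s
    rw [← half_sum_metricPartial _ hr hΔ ((sum_metric_eq_zero_iff _ hr hΔ).1 (hnull s hs)),
      ← hγ.equation s hs μ]
    have hdiff : DifferentiableAt ℝ (fun s => lower M a (γ s) (deriv γ s) μ) s := by
      unfold lower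
      refine DifferentiableAt.fun_sum fun ν _ => ?_
      exact (hasDerivAt_metric hd hr hΔ μ ν).differentiableAt.mul
        (differentiableAt_pi.1 hdd ν)
    exact hdiff.hasDerivAt

end Geodesics

/-! ### Constants of motion, the radial equation, and a priori bounds -/

section Trapping

variable {M a : ℝ}

/-- Half the numerator of the derivative of `(r² + a² - a L)² / Δ`, without the factor
`r² + a² - a L`. -/
def critFun (M a r L : ℝ) : ℝ :=
  2 * r * (r ^ 2 - 2 * M * r + a ^ 2) - (r - M) * (r ^ 2 + a ^ 2 - a * L)

/-- `critFun` divided by `r - M`. -/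
noncomputable def critQuot (M a r L : ℝ) : ℝ :=
  (r - M) ^ 2 + (a ^ 2 + a * L - 3 * M ^ 2) - 2 * M * (M ^ 2 - a ^ 2) / (r - M)

theorem critFun_eq {r : ℝ} (L : ℝ) (hr : r ≠ M) :
    critFun M a r L = (r - M) * critQuot M a r L := by
  have h : r - M ≠ 0 := sub_ne_zero.2 hr
  simp only [critFun, critQuot]
  field_simp
  ring

/-- A photon covector: it is null, and has constant radius. The condition is that
`(r² + a² - a L)² / Δ` is stationary. -/
def photonSet (M a : ℝ) : Set ((Fin 4 → ℝ) × (Fin 4 → ℝ)) :=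
  {w | w.1 0 = 0 ∧ w.2 0 = -1 ∧ w.1 ∈ DOC M a ∧ dilation w.1 w.2 = 0 ∧
    critFun M a (radius w.1) (angMom w.1 w.2) = 0 ∧ nullFun M a w.1 w.2 = 0}

section AlongSolutions

variable {w : ℝ → (Fin 4 → ℝ) × (Fin 4 → ℝ)} {s : ℝ}

/-- The Hamiltonian does not depend on `t`, so the conjugate momentum is conserved; rotational
symmetry about the axis does the same for `angMom` in the next lemma. -/
theorem hasDerivAt_energy (hw : HasDerivAt w (nullField M a (w s)) s) :
    HasDerivAt (fun s => (w s).2 0) 0 s := by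
  have := hasDerivAt_apply hw.snd 0
  convert! this using 1
  simp [nullField, force, gradQ]

theorem hasDerivAt_angMom_nullField (hw : HasDerivAt w (nullField M a (w s)) s) :
    HasDerivAt (fun s => angMom (w s).1 (w s).2) 0 s := by
  convert! hasDerivAt_angMom hw.fst hw.snd using 1
  simp [nullField, force, vel, gradQ, gradP, angMom]
  ring

theorem hasDerivAt_nullFun_nullField (hw : HasDerivAt w (nullField M a (w s)) s)
    (hr : 0 < radius (w s).1) (hΔ : Delta M a (w s).1 ≠ 0) :
    HasDerivAt (fun s => nullFun M a (w s).1 (w s).2) 0 s := by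
  convert! hasDerivAt_nullFun hw.fst hw.snd hr hΔ using 1
  simp only [nullField, force, vel, Pi.neg_apply, Pi.smul_apply, smul_eq_mul, Fin.sum_univ_four]
  ring

theorem hasDerivAt_radius_nullField (hw : HasDerivAt w (nullField M a (w s)) s)
    (hr : 0 < radius (w s).1) :
    HasDerivAt (fun s => radius (w s).1)
      (Delta M a (w s).1 * dilation (w s).1 (w s).2 / (radius (w s).1 * rhoSq a (w s).1)) s := by
  have hρ := (rhoSq_pos a hr).ne'
  have hr0 := hr.ne'
  have hr2 := radius_sq (w s).1
  convert! hasDerivAt_radius hw.fst hr using 1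
  have hd : radius (w s).1 ^ 2 - 2 * M * radius (w s).1 + a ^ 2 = Delta M a (w s).1 := rfl
  simp [nullField, vel, gradP, sepA, hd]
  field_simp
  simp only [dilation]
  linear_combination (2 * (Delta M a (w s).1 - radius (w s).1 ^ 2) *
    ((w s).1 1 * (w s).2 1 + (w s).1 2 * (w s).2 2 + (w s).1 3 * (w s).2 3)) * hr2

theorem hasDerivAt_dilation_nullField (hw : HasDerivAt w (nullField M a (w s)) s)
    (hr : 0 < radius (w s).1) (hΔ : Delta M a (w s).1 ≠ 0) (he : (w s).2 0 = -1) :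
    HasDerivAt (fun s => dilation (w s).1 (w s).2)
      ((rhoSq a (w s).1)⁻¹ * (-(radius (w s).1 * (radius (w s).1 - M)
          - Delta M a (w s).1) * (dilation (w s).1 (w s).2) ^ 2 / radius (w s).1 ^ 2
        + radius (w s).1 * (radius (w s).1 ^ 2 + a ^ 2 - a * angMom (w s).1 (w s).2) *
          critFun M a (radius (w s).1) (angMom (w s).1 (w s).2) / Delta M a (w s).1 ^ 2)) s := by
  have hρ := (rhoSq_pos a hr).ne'
  have hr0 := hr.ne'
  have hr2 := radius_sq (w s).1
  convert! hasDerivAt_dilation hw.fst hw.snd using 1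
  have e1 : dilation (nullField M a (w s)).1 (w s).2 + dilation (w s).1 (nullField M a (w s)).2 =
      (2 * rhoSq a (w s).1)⁻¹ * (2 * radius (w s).1 ^ 2 * spatialSq (w s).2
        - radius (w s).1 * sepR M a (radius (w s).1) (dilation (w s).1 (w s).2)
          (angMom (w s).1 (w s).2) ((w s).2 0) (spatialSq (w s).2) ((w s).1 3)
        - (w s).1 3 * sepZ a (radius (w s).1) ((w s).2 0) ((w s).1 3)) := by
    simp only [nullField, force, vel, gradQ, gradP]
    generalize sepR M a (radius (w s).1) (dilation (w s).1 (w s).2)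
          (angMom (w s).1 (w s).2) ((w s).2 0) (spatialSq (w s).2) ((w s).1 3) = NR
    simp [dilation, spatialSq]
    field_simp
    linear_combination NR * hr2
  rw [e1, he]
  have hd : radius (w s).1 ^ 2 - 2 * M * radius (w s).1 + a ^ 2 = Delta M a (w s).1 := rfl
  simp only [sepR, sepZ, critFun, hd]
  field_simp
  ring

/-- The rescaled radial momentum. -/
noncomputable def radialMom (M a : ℝ) (w : (Fin 4 → ℝ) × (Fin 4 → ℝ)) : ℝ :=
  √(Delta M a w.1) * dilation w.1 w.2 / radius w.1

/-- The factor `√Δ` is chosen so that the term quadratic in the radial momentum cancels. What is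
left is `√Δ / ρ²` times half the `r`-derivative of `(r² + a² - a L)² / Δ`, a force depending on `r`
and `L` alone, while `r` itself moves at the rate `√Δ / ρ²` times `radialMom`. -/
theorem hasDerivAt_radialMom (hw : HasDerivAt w (nullField M a (w s)) s)
    (hr : 0 < radius (w s).1) (hΔ : 0 < Delta M a (w s).1) (he : (w s).2 0 = -1) :
    HasDerivAt (fun s => radialMom M a (w s))
      (√(Delta M a (w s).1) / rhoSq a (w s).1 *
        ((radius (w s).1 ^ 2 + a ^ 2 - a * angMom (w s).1 (w s).2) *
          critFun M a (radius (w s).1) (angMom (w s).1 (w s).2) / Delta M a (w s).1 ^ 2)) s := by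
  have hρ := (rhoSq_pos a hr).ne'
  have hr0 := hr.ne'
  have h1 := hasDerivAt_radius_nullField hw hr
  have h2 := hasDerivAt_dilation_nullField hw hr hΔ.ne' he
  have h3 : HasDerivAt (fun s => Delta M a (w s).1) (2 * (radius (w s).1 - M) *
      (Delta M a (w s).1 * dilation (w s).1 (w s).2 / (radius (w s).1 * rhoSq a (w s).1))) s := by
    convert! ((h1.pow 2).sub (h1.const_mul (2 * M))).add_const (a ^ 2) using 1
    simp; ring
  have h4 := ((h3.sqrt hΔ.ne').mul h2).div h1 hr0
  convert! h4 using 1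
  set S := √(Delta M a (w s).1) with hS
  have hS0 : S ≠ 0 := (Real.sqrt_pos.2 hΔ).ne'
  have hS2 : Delta M a (w s).1 = S ^ 2 := (Real.sq_sqrt hΔ.le).symm
  simp only [Pi.mul_apply, ← hS]
  rw [hS2]
  field_simp
  ring

end AlongSolutions

theorem angMom_sq_le (q p : Fin 4 → ℝ) :
    angMom q p ^ 2 ≤ (q 1 ^ 2 + q 2 ^ 2) * spatialSq p := by
  simp only [angMom, spatialSq]
  nlinarith [sq_nonneg (q 1 * p 1 + q 2 * p 2), mul_nonneg (add_nonneg (sq_nonneg (q 1))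
    (sq_nonneg (q 2))) (sq_nonneg (p 3))]

theorem dilation_sq_le (q p : Fin 4 → ℝ) :
    dilation q p ^ 2 ≤ radius q ^ 2 * spatialSq p := by
  rw [radius_sq]
  simp only [dilation, spatialSq]
  nlinarith [sq_nonneg (q 1 * p 2 - q 2 * p 1), sq_nonneg (q 1 * p 3 - q 3 * p 1),
    sq_nonneg (q 2 * p 3 - q 3 * p 2)]

/-- The square of the sine of the polar angle. -/
theorem sinSq_eq {q : Fin 4 → ℝ} (hr : 0 < radius q) :
    1 - q 3 ^ 2 / radius q ^ 2 = (q 1 ^ 2 + q 2 ^ 2) / radius q ^ 2 := by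
  have := radius_sq q
  have := hr.ne'
  field_simp
  linarith

theorem sinSq_mem {q : Fin 4 → ℝ} (hr : 0 < radius q) :
    0 ≤ 1 - q 3 ^ 2 / radius q ^ 2 ∧ 1 - q 3 ^ 2 / radius q ^ 2 ≤ 1 := by
  constructor
  · rw [sinSq_eq hr]; positivity
  · have : 0 ≤ q 3 ^ 2 / radius q ^ 2 := by positivity
    linarith

/-- The null condition with unit energy. -/
theorem nullFun_eq {q p : Fin 4 → ℝ} (he : p 0 = -1) :
    nullFun M a q p = Delta M a q * dilation q p ^ 2 / radius q ^ 2
      - (radius q ^ 2 + a ^ 2 - a * angMom q p) ^ 2 / Delta M a q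
      + (radius q ^ 2 * spatialSq p - dilation q p ^ 2 - 2 * a * angMom q p
        + a ^ 2 * (1 - q 3 ^ 2 / radius q ^ 2)) := by
  simp only [nullFun, separated, he, Delta]
  ring

theorem radialMom_sq {w : (Fin 4 → ℝ) × (Fin 4 → ℝ)} (hΔ : 0 < Delta M a w.1) :
    radialMom M a w ^ 2 = Delta M a w.1 * dilation w.1 w.2 ^ 2 / radius w.1 ^ 2 := by
  rw [radialMom, div_pow, mul_pow, Real.sq_sqrt hΔ.le]

theorem abs_sub_angMom_le {r₂ L r : ℝ} (hr : 0 ≤ r) (h2 : r ≤ r₂) :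
    |r ^ 2 + a ^ 2 - a * L| ≤ r₂ ^ 2 + a ^ 2 + |a * L| := by
  have hr2 : r ^ 2 ≤ r₂ ^ 2 := by gcongr
  rw [abs_le]
  constructor <;> nlinarith [neg_abs_le (a * L), le_abs_self (a * L), sq_nonneg r, sq_nonneg a]

theorem Delta_mono {r₁ : ℝ} {q : Fin 4 → ℝ} (hMr : M ≤ r₁) (h1 : r₁ ≤ radius q) :
    r₁ ^ 2 - 2 * M * r₁ + a ^ 2 ≤ Delta M a q := by
  unfold Delta
  nlinarith

/-- The spatial momenta of photons at a given angular momentum and in a bounded range of radii are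
bounded. -/
theorem spatialSq_bound {r₁ r₂ L : ℝ} (hr₁ : 0 < r₁) (hMr : M ≤ r₁)
    (hΔ₁ : 0 < r₁ ^ 2 - 2 * M * r₁ + a ^ 2) :
    ∃ B : ℝ, 0 ≤ B ∧ ∀ q p : Fin 4 → ℝ, r₁ ≤ radius q → radius q ≤ r₂ → p 0 = -1 →
      angMom q p = L → nullFun M a q p = 0 → radialMom M a (q, p) ^ 2 ≤ B ∧ spatialSq p ≤ B := by
  obtain ⟨δ, hδ⟩ : ∃ δ, δ = r₁ ^ 2 - 2 * M * r₁ + a ^ 2 := ⟨_, rfl⟩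
  rw [← hδ] at hΔ₁
  obtain ⟨U, hU⟩ : ∃ U, U = r₂ ^ 2 + a ^ 2 + |a * L| := ⟨_, rfl⟩
  -- The null condition writes the sum of `Δ α² / r²` and `r² w - α²`, both nonnegative, as a
  -- quantity at most `B₁`. The first bound controls `α²`, and the second then gives the bound `B₂`
  -- on the spatial momentum.
  obtain ⟨B₁, hB₁⟩ : ∃ B₁, B₁ = U ^ 2 / δ + 2 * |a * L| := ⟨_, rfl⟩
  obtain ⟨B₂, hB₂⟩ : ∃ B₂, B₂ = (B₁ + B₁ * r₂ ^ 2 / δ) / r₁ ^ 2 := ⟨_, rfl⟩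
  have hB₁0 : 0 ≤ B₁ := by rw [hB₁]; positivity
  have hB₂0 : 0 ≤ B₂ := by rw [hB₂]; positivity
  refine ⟨B₁ + B₂, by positivity, fun q p h1 h2 he hL hN => ?_⟩
  have hr : 0 < radius q := hr₁.trans_le h1
  have hΔδ : δ ≤ Delta M a q := by rw [hδ]; exact Delta_mono hMr h1
  have hΔ : 0 < Delta M a q := hΔ₁.trans_le hΔδ
  have hr2 : radius q ^ 2 ≤ r₂ ^ 2 := by gcongr
  have hr1 : r₁ ^ 2 ≤ radius q ^ 2 := by gcongr
  have hu : |radius q ^ 2 + a ^ 2 - a * L| ≤ U := by rw [hU]; exact abs_sub_angMom_le hr.le h2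
  have hs0 := (sinSq_mem hr).1
  rw [nullFun_eq he, hL] at hN
  have hcs := dilation_sq_le q p
  have hfrac : (radius q ^ 2 + a ^ 2 - a * L) ^ 2 / Delta M a q ≤ U ^ 2 / δ := by
    have : (radius q ^ 2 + a ^ 2 - a * L) ^ 2 ≤ U ^ 2 := by
      rw [← sq_abs]; gcongr
    gcongr
  have hLabs := le_abs_self (a * L)
  have ht : 0 ≤ a ^ 2 * (1 - q 3 ^ 2 / radius q ^ 2) := by positivity
  have hy : Delta M a q * dilation q p ^ 2 / radius q ^ 2 ≤ B₁ := by
    rw [hB₁]; linarith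
  have hw : radius q ^ 2 * spatialSq p ≤ B₁ + dilation q p ^ 2 := by
    have : 0 ≤ Delta M a q * dilation q p ^ 2 / radius q ^ 2 := by positivity
    rw [hB₁]; linarith
  have hα : dilation q p ^ 2 ≤ B₁ * r₂ ^ 2 / δ := by
    rw [le_div_iff₀ hΔ₁]
    have h1 := mul_le_mul_of_nonneg_left hΔδ (sq_nonneg (dilation q p))
    have h2 := mul_le_mul_of_nonneg_left hr2 hB₁0
    have h3 := (div_le_iff₀ (by positivity)).1 hy
    linarith
  have hsp : spatialSq p ≤ B₂ := by
    rw [hB₂, le_div_iff₀ (by positivity)]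
    have h0 : 0 ≤ spatialSq p := by unfold spatialSq; positivity
    have := mul_le_mul_of_nonneg_right hr1 h0
    linarith
  rw [radialMom_sq (w := (q, p)) hΔ]
  exact ⟨hy.trans (by linarith), by linarith⟩

/-- The time component of the velocity of photons at a given angular momentum and in a bounded
range of radii is bounded. -/
theorem vel_zero_bound {r₁ r₂ L : ℝ} (hr₁ : 0 < r₁) (hMr : M ≤ r₁)
    (hΔ₁ : 0 < r₁ ^ 2 - 2 * M * r₁ + a ^ 2) :
    ∃ B : ℝ, 0 ≤ B ∧ ∀ q p : Fin 4 → ℝ, r₁ ≤ radius q → radius q ≤ r₂ → p 0 = -1 →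
      angMom q p = L → |vel M a q p 0| ≤ B := by
  obtain ⟨δ, hδ⟩ : ∃ δ, δ = r₁ ^ 2 - 2 * M * r₁ + a ^ 2 := ⟨_, rfl⟩
  rw [← hδ] at hΔ₁
  obtain ⟨U, hU⟩ : ∃ U, U = r₂ ^ 2 + a ^ 2 + |a * L| := ⟨_, rfl⟩
  have hU0 : 0 ≤ U := by rw [hU]; positivity
  refine ⟨(2 * U * (r₂ ^ 2 + a ^ 2) / δ + 2 * |a * L| + 2 * a ^ 2) / (2 * r₁ ^ 2), by positivity,
    fun q p h1 h2 he hL => ?_⟩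
  have hr : 0 < radius q := hr₁.trans_le h1
  have hΔδ : δ ≤ Delta M a q := by rw [hδ]; exact Delta_mono hMr h1
  have hΔ : 0 < Delta M a q := hΔ₁.trans_le hΔδ
  have hr2 : radius q ^ 2 ≤ r₂ ^ 2 := by gcongr
  have hr1 : r₁ ^ 2 ≤ radius q ^ 2 := by gcongr
  have hu : |radius q ^ 2 + a ^ 2 - a * L| ≤ U := by rw [hU]; exact abs_sub_angMom_le hr.le h2
  obtain ⟨hs0, hs1⟩ := sinSq_mem hr
  have e : vel M a q p 0 = (2 * rhoSq a q)⁻¹ * sepE M a (radius q) (angMom q p) (p 0) (q 3) := rfl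
  have hρ : r₁ ^ 2 ≤ rhoSq a q := by
    have : 0 ≤ a ^ 2 * (q 3 / radius q) ^ 2 := by positivity
    unfold rhoSq; linarith
  have hρ0 : 0 < rhoSq a q := rhoSq_pos a hr
  have e2 : sepE M a (radius q) (angMom q p) (p 0) (q 3) =
      2 * (radius q ^ 2 + a ^ 2 - a * L) * (radius q ^ 2 + a ^ 2) / Delta M a q
        + 2 * (a * L) - 2 * a ^ 2 * (1 - q 3 ^ 2 / radius q ^ 2) := by
    simp only [sepE, he, hL, Delta]; ring
  have t1 : |2 * (radius q ^ 2 + a ^ 2 - a * L) * (radius q ^ 2 + a ^ 2) / Delta M a q| ≤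
      2 * U * (r₂ ^ 2 + a ^ 2) / δ := by
    rw [abs_div, abs_mul, abs_mul, abs_two, abs_of_pos hΔ,
      abs_of_nonneg (show 0 ≤ radius q ^ 2 + a ^ 2 by positivity)]
    gcongr
  have t2 : |2 * (a * L)| = 2 * |a * L| := by rw [abs_mul, abs_two]
  have t3 : |2 * a ^ 2 * (1 - q 3 ^ 2 / radius q ^ 2)| ≤ 2 * a ^ 2 := by
    rw [abs_of_nonneg (by positivity)]
    have := mul_le_mul_of_nonneg_left hs1 (show 0 ≤ 2 * a ^ 2 by positivity)
    linarith
  have hE : |sepE M a (radius q) (angMom q p) (p 0) (q 3)| ≤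
      2 * U * (r₂ ^ 2 + a ^ 2) / δ + 2 * |a * L| + 2 * a ^ 2 := by
    rw [e2]
    refine (abs_sub _ _).trans (add_le_add ((abs_add_le _ _).trans (add_le_add t1 t2.le)) t3)
  rw [e, abs_mul, abs_inv, abs_of_pos (by positivity : 0 < 2 * rhoSq a q), inv_mul_eq_div]
  gcongr

theorem abs_apply_le {p : Fin 4 → ℝ} {B : ℝ} (hB : 0 ≤ B) (he : p 0 = -1) (h : spatialSq p ≤ B)
    (i : Fin 4) : |p i| ≤ B + 1 := by
  -- Since `B + 1 ≥ 1`, a bound on the square by `B + 1` is also one by `(B + 1)²`.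
  have key : p i ^ 2 ≤ B + 1 := by
    unfold spatialSq at h
    fin_cases i
    · simp only [Fin.zero_eta, he]; linarith
    · simp only [Fin.mk_one]; nlinarith [sq_nonneg (p 2), sq_nonneg (p 3)]
    · change p 2 ^ 2 ≤ _; nlinarith [sq_nonneg (p 1), sq_nonneg (p 3)]
    · change p 3 ^ 2 ≤ _; nlinarith [sq_nonneg (p 1), sq_nonneg (p 2)]
  exact abs_le_of_sq_le_sq (by nlinarith) (by positivity)

theorem isCompact_box (r₁ r₂ R : ℝ) :
    IsCompact {w : (Fin 4 → ℝ) × (Fin 4 → ℝ) | |w.1 0| ≤ R ∧ r₁ ≤ radius w.1 ∧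
      radius w.1 ≤ r₂ ∧ ∀ i, |w.2 i| ≤ R} := by
  set C := max R r₂
  refine (isCompact_Icc (a := ((fun _ => -C, fun _ => -C) : (Fin 4 → ℝ) × (Fin 4 → ℝ)))
    (b := (fun _ => C, fun _ => C))).of_isClosed_subset ?_ ?_
  · have hr : Continuous fun w : (Fin 4 → ℝ) × (Fin 4 → ℝ) => radius w.1 :=
      continuous_radius.comp continuous_fst
    have hp : IsClosed {w : (Fin 4 → ℝ) × (Fin 4 → ℝ) | ∀ i, |w.2 i| ≤ R} := by
      rw [ofPred_forall]
      exact isClosed_iInter fun i =>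
        isClosed_le (((continuous_apply i).comp continuous_snd).abs) continuous_const
    exact (isClosed_le (((continuous_apply 0).comp continuous_fst).abs) continuous_const).inter
      ((isClosed_le continuous_const hr).inter ((isClosed_le hr continuous_const).inter hp))
  · rintro ⟨q, p⟩ ⟨h0, -, h2, h3⟩
    have hq : ∀ i, |q i| ≤ C := by
      have h := radius_sq q
      have hpos : 0 ≤ radius q := Real.sqrt_nonneg _
      intro i
      fin_cases i
      · exact h0.trans (le_max_left _ _)
      all_goals
        refine (abs_le_of_sq_le_sq ?_ hpos).trans (h2.trans (le_max_right _ _))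
        simp
        nlinarith [sq_nonneg (q 1), sq_nonneg (q 2), sq_nonneg (q 3)]
    have hp : ∀ i, |p i| ≤ C := fun i => (h3 i).trans (le_max_left _ _)
    exact ⟨⟨fun i => (abs_le.1 (hq i)).1, fun i => (abs_le.1 (hp i)).1⟩,
      ⟨fun i => (abs_le.1 (hq i)).2, fun i => (abs_le.1 (hp i)).2⟩⟩

end Trapping

/-! ### Trapped photons have constant radius -/

section TrappedPhotons

variable {M a : ℝ}

theorem eq_of_hasDerivAt_zero {J : Set ℝ} (hJc : J.OrdConnected) {f : ℝ → ℝ}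
    (hf : ∀ s ∈ J, HasDerivAt f 0 s) {s t : ℝ} (hs : s ∈ J) (ht : t ∈ J) : f s = f t := by
  have := hJc.convex.norm_image_sub_le_of_norm_hasDerivWithin_le (f := f) (f' := fun _ => 0) (C := 0)
    (fun x hx => (hf x hx).hasDerivWithinAt) (by simp) ht hs
  simpa [sub_eq_zero] using this

/-- The radius of a trapped photon is bounded, and bounded away from the horizon. -/
theorem exists_radius_bounds {γ : ℝ → Fin 4 → ℝ} {J : Set ℝ} (h0 : 0 ∈ J)
    (htr : IsTrapped M a γ J) :
    ∃ r₁ r₂ : ℝ, M + √(M ^ 2 - a ^ 2) < r₁ ∧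
      ∀ s ∈ J, r₁ ≤ radius (γ s) ∧ radius (γ s) ≤ r₂ := by
  obtain ⟨K, hK, hKD, hγ⟩ := htr
  set ρ : (Fin 3 → ℝ) → ℝ := fun x => √(x 0 ^ 2 + x 1 ^ 2 + x 2 ^ 2) with hρ
  have hρc : Continuous ρ := by fun_prop
  have hρr : ∀ q, ρ (spatial q) = radius q := fun q => rfl
  obtain ⟨x₁, hx₁, h₁⟩ := hK.exists_isMinOn ⟨_, hγ 0 h0⟩ hρc.continuousOn
  obtain ⟨x₂, hx₂, h₂⟩ := hK.exists_isMaxOn ⟨_, hγ 0 h0⟩ hρc.continuousOn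
  obtain ⟨q, hq, rfl⟩ := hKD hx₁
  exact ⟨radius q, ρ x₂, hq, fun s hs => ⟨h₁ (hγ s hs), h₂ (hγ s hs)⟩⟩

/-- The parameter interval of a trapped photon is the whole line. -/
theorem eq_univ_of_isTrapped (haM : a < M) (ha : 0 ≤ a) {γ : ℝ → Fin 4 → ℝ} {J : Set ℝ}
    (h0 : 0 ∈ J) (hph : IsFuturePhoton M a γ J) (htr : IsTrapped M a γ J)
    (he : lower M a (γ 0) (deriv γ 0) 0 = -1) : J = univ := by
  obtain ⟨⟨hgeo, hmax⟩, hfut⟩ := hph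
  have hnull := fun s hs => (hfut s hs).1
  set w : ℝ → (Fin 4 → ℝ) × (Fin 4 → ℝ) := fun s => (γ s, lower M a (γ s) (deriv γ s)) with hwdef
  have hw : ∀ s ∈ J, HasDerivAt w (nullField M a (w s)) s := fun s hs =>
    hasDerivAt_nullField_of_isGeodesicOn haM ha hgeo hnull hs
  have hr : ∀ s ∈ J, 0 < radius (γ s) := fun s hs =>
    radius_pos_of_mem_DOC haM ha (hgeo.mem_DOC s hs)
  have hΔ : ∀ s ∈ J, 0 < Delta M a (γ s) := fun s hs =>
    Delta_pos_of_mem_DOC haM ha (hgeo.mem_DOC s hs)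
  have hN : ∀ s ∈ J, nullFun M a (w s).1 (w s).2 = 0 := fun s hs =>
    (sum_metric_eq_zero_iff _ (hr s hs) (hΔ s hs).ne').1 (hnull s hs)
  have hE : ∀ s ∈ J, (w s).2 0 = -1 := fun s hs => by
    rw [← he]
    exact eq_of_hasDerivAt_zero (f := fun s => (w s).2 0) hgeo.ordConnected
      (fun s hs => hasDerivAt_energy (hw s hs)) hs h0
  have hL : ∀ s ∈ J, angMom (w s).1 (w s).2 = angMom (w 0).1 (w 0).2 := fun s hs =>
    eq_of_hasDerivAt_zero (f := fun s => angMom (w s).1 (w s).2) hgeo.ordConnected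
      (fun s hs => hasDerivAt_angMom_nullField (hw s hs)) hs h0
  obtain ⟨r₁, r₂, hr₁, hrb⟩ := exists_radius_bounds h0 htr
  have hsq := Real.sqrt_nonneg (M ^ 2 - a ^ 2)
  have hr₁0 : 0 < r₁ := by linarith
  have hΔ₁ : 0 < r₁ ^ 2 - 2 * M * r₁ + a ^ 2 := by
    have h3 : √(M ^ 2 - a ^ 2) ^ 2 = M ^ 2 - a ^ 2 := Real.sq_sqrt (by nlinarith)
    nlinarith
  obtain ⟨B, hB0, hB⟩ := spatialSq_bound (r₂ := r₂) (L := angMom (w 0).1 (w 0).2) hr₁0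
    (by linarith : M ≤ r₁) hΔ₁
  obtain ⟨C, hC0, hC⟩ := vel_zero_bound (r₂ := r₂) (L := angMom (w 0).1 (w 0).2) hr₁0
    (by linarith : M ≤ r₁) hΔ₁
  have hp : ∀ s ∈ J, ∀ i, |(w s).2 i| ≤ B + 1 := fun s hs =>
    abs_apply_le hB0 (hE s hs)
      (hB _ _ (hrb s hs).1 (hrb s hs).2 (hE s hs) (hL s hs) (hN s hs)).2
  -- The time coordinate is not bounded by trapping, but it grows at most linearly; over a bounded
  -- parameter range the covector therefore stays in a compact box.
  have ht : ∀ s ∈ J, |γ s 0| ≤ |γ 0 0| + C * |s| := by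
    intro s hs
    have h1 := hgeo.ordConnected.convex.norm_image_sub_le_of_norm_hasDerivWithin_le
      (f := fun s => γ s 0) (f' := fun s => vel M a (w s).1 (w s).2 0) (C := C)
      (fun x hx => (hasDerivAt_apply (hw x hx).fst 0).hasDerivWithinAt)
      (fun x hx => hC _ _ (hrb x hx).1 (hrb x hx).2 (hE x hx) (hL x hx)) h0 hs
    simp only [Real.norm_eq_abs, sub_zero] at h1
    have := abs_sub_abs_le_abs_sub (γ s 0) (γ 0 0)
    linarith
  set U : Set ((Fin 4 → ℝ) × (Fin 4 → ℝ)) := Prod.fst ⁻¹' DOC M a with hU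
  have hUo : IsOpen U := (isOpen_DOC M a).preimage continuous_fst
  have hv : ContDiffOn ℝ 1 (nullField M a) U := fun x hx =>
    (contDiffAt_nullField (radius_pos_of_mem_DOC haM ha hx)
      (Delta_pos_of_mem_DOC haM ha hx).ne').contDiffWithinAt
  have hbox : ∀ R, {w : (Fin 4 → ℝ) × (Fin 4 → ℝ) | |w.1 0| ≤ R ∧ r₁ ≤ radius w.1 ∧
      radius w.1 ≤ r₂ ∧ ∀ i, |w.2 i| ≤ R} ⊆ U := fun R x hx => hr₁.trans_le hx.2.1
  have hmem : ∀ b : ℝ, ∀ s ∈ J, |s| ≤ b → w s ∈ {w : (Fin 4 → ℝ) × (Fin 4 → ℝ) |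
      |w.1 0| ≤ |γ 0 0| + C * b + (B + 1) ∧ r₁ ≤ radius w.1 ∧
      radius w.1 ≤ r₂ ∧ ∀ i, |w.2 i| ≤ |γ 0 0| + C * b + (B + 1)} := by
    intro b s hs hsb
    have hb : 0 ≤ b := (abs_nonneg s).trans hsb
    have h1 := ht s hs
    have h2 : C * |s| ≤ C * b := by gcongr
    have h3 : 0 ≤ C * b := by positivity
    refine ⟨?_, (hrb s hs).1, (hrb s hs).2, fun i => (hp s hs i).trans ?_⟩
    · change |γ s 0| ≤ _
      linarith
    · have := abs_nonneg (γ 0 0)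
      linarith
  -- An extension of the Hamiltonian solution remains null, hence projects to a geodesic extending
  -- `γ`, against maximality.
  have hext : ¬ ∃ (J' : Set ℝ) (y : ℝ → (Fin 4 → ℝ) × (Fin 4 → ℝ)), IsOpen J' ∧
      J'.OrdConnected ∧ J ⊂ J' ∧ EqOn w y J ∧
      ∀ s ∈ J', HasDerivAt y (nullField M a (y s)) s ∧ y s ∈ U := by
    rintro ⟨J', y, h1, h2, h3, h4, h5⟩
    refine h3.ne (hmax (fun s => (y s).1) J' ?_ h3.1 fun s hs => ?_).symm
    · refine isGeodesicOn_of_nullField haM ha h1 h2 (fun s hs => (h5 s hs).1)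
        (fun s hs => (h5 s hs).2) fun s hs => ?_
      rw [← hN 0 h0, h4 h0]
      exact eq_of_hasDerivAt_zero (f := fun s => nullFun M a (y s).1 (y s).2) h2
        (fun s hs => hasDerivAt_nullFun_nullField (h5 s hs).1
          (radius_pos_of_mem_DOC haM ha (h5 s hs).2)
          (Delta_pos_of_mem_DOC haM ha (h5 s hs).2).ne') hs (h3.1 h0)
    · change γ s = (y s).1
      rw [← h4 hs]
  have hnb : ¬ BddAbove J := by
    rintro ⟨b, hb⟩
    refine hext (exists_extension_right hUo hv (isCompact_box r₁ r₂ _) (hbox _) hgeo.isOpen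
      hgeo.ordConnected h0 hw hgeo.mem_DOC (fun s hs h => hmem b s hs ?_) ⟨b, hb⟩)
    rw [abs_of_nonneg h]
    exact hb hs
  have hnb' : ¬ BddBelow J := by
    rintro ⟨b, hb⟩
    refine hext (exists_extension_left hUo hv (isCompact_box r₁ r₂ _) (hbox _) hgeo.isOpen
      hgeo.ordConnected h0 hw hgeo.mem_DOC (fun s hs h => hmem (-b) s hs ?_) ⟨b, hb⟩)
    rw [abs_of_nonpos h]
    exact neg_le_neg (hb hs)
  refine eq_univ_of_forall fun s => ?_
  obtain ⟨x, hx, hsx⟩ := not_bddAbove_iff.1 hnb s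
  obtain ⟨y, hy, hsy⟩ := not_bddBelow_iff.1 hnb' s
  exact hgeo.ordConnected.out hy hx ⟨hsy.le, hsx.le⟩

/-- The angular momentum of a photon with vanishing radial momentum and vanishing
`r² + a² - a L` would be too large. -/
theorem ne_zero_of_nullFun {q p : Fin 4 → ℝ} (hr : 0 < radius q) (he : p 0 = -1)
    (hN : nullFun M a q p = 0) (hα : dilation q p = 0) :
    radius q ^ 2 + a ^ 2 - a * angMom q p ≠ 0 := by
  intro hu
  rw [nullFun_eq he, hu, hα] at hN
  obtain ⟨hs0, hs1⟩ := sinSq_mem hr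
  have hL := angMom_sq_le q p
  have hs : q 1 ^ 2 + q 2 ^ 2 = radius q ^ 2 * (1 - q 3 ^ 2 / radius q ^ 2) := by
    rw [sinSq_eq hr]
    have := hr.ne'
    field_simp
  rw [hs] at hL
  set σ := 1 - q 3 ^ 2 / radius q ^ 2
  set L := angMom q p
  have h1 : radius q ^ 2 * spatialSq p = 2 * a * L - a ^ 2 * σ := by
    simp at hN
    linarith
  -- Cauchy-Schwarz gives `L² ≤ σ (2 a L - a² σ)`, which is a vanishing square. With `L = a σ` the
  -- quantity `r² + a² - a L` is `r² + a² (1 - σ)`, which is positive.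
  have h2 : (L - a * σ) ^ 2 ≤ 0 := by
    have : L ^ 2 ≤ σ * (2 * a * L - a ^ 2 * σ) := by rw [← h1]; linarith
    nlinarith
  have h3 : L = a * σ := by
    have := pow_eq_zero_iff (two_ne_zero) |>.1 (le_antisymm h2 (sq_nonneg _))
    linarith
  rw [h3] at hu
  nlinarith [sq_nonneg a, mul_nonneg (sq_nonneg a) (sub_nonneg.2 hs1), pow_pos hr 2]

theorem hasDerivAt_critQuot {r : ℝ} (L : ℝ) (hr : r ≠ M) :
    HasDerivAt (fun r => critQuot M a r L)
      (2 * (r - M) + 2 * M * (M ^ 2 - a ^ 2) / (r - M) ^ 2) r := by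
  have h : r - M ≠ 0 := sub_ne_zero.2 hr
  have h1 : HasDerivAt (fun r => r - M) 1 r := (hasDerivAt_id r).sub_const M
  have h2 := (((h1.pow 2).add_const (a ^ 2 + a * L - 3 * M ^ 2))).sub
    ((h1.inv h).const_mul (2 * M * (M ^ 2 - a ^ 2)))
  convert! h2 using 1
  simp
  ring

/-- For `r > M` the term `(r - M)²` increases strictly and the term in `1 / (r - M)` does not
decrease, by the sign hypothesis `hM`. So `critFun` has at most one zero beyond `M`, which makes the
stationary radius unique for a given `L`. -/
theorem critQuot_lt {r r' : ℝ} (L : ℝ) (hM : 0 ≤ M * (M ^ 2 - a ^ 2)) (hr : M < r) (hrr : r < r') :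
    critQuot M a r L < critQuot M a r' L := by
  have h0 : 0 < r - M := by linarith
  have h1 : (r - M) ^ 2 < (r' - M) ^ 2 := by gcongr
  have h2 : 2 * M * (M ^ 2 - a ^ 2) / (r' - M) ≤ 2 * M * (M ^ 2 - a ^ 2) / (r - M) := by
    have : 0 ≤ 2 * M * (M ^ 2 - a ^ 2) := by linarith
    gcongr
  simp only [critQuot]
  linarith

/-- Trapped photons have constant radius, at the minimum of `(r² + a² - a L)² / Δ`. -/
theorem mem_photonSet_of_isTrapped (haM : a < M) (ha : 0 ≤ a) {γ : ℝ → Fin 4 → ℝ} {J : Set ℝ}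
    (h0 : 0 ∈ J) (hph : IsFuturePhoton M a γ J) (htr : IsTrapped M a γ J)
    (ht : γ 0 0 = 0) (he : lower M a (γ 0) (deriv γ 0) 0 = -1) :
    (γ 0, lower M a (γ 0) (deriv γ 0)) ∈ photonSet M a := by
  obtain rfl := eq_univ_of_isTrapped haM ha h0 hph htr he
  obtain ⟨⟨hgeo, -⟩, hfut⟩ := hph
  have hnull := fun s hs => (hfut s hs).1
  set w : ℝ → (Fin 4 → ℝ) × (Fin 4 → ℝ) := fun s => (γ s, lower M a (γ s) (deriv γ s)) with hwdef
  have hw : ∀ s, HasDerivAt w (nullField M a (w s)) s := fun s =>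
    hasDerivAt_nullField_of_isGeodesicOn haM ha hgeo hnull (mem_univ s)
  have hr : ∀ s, 0 < radius (w s).1 := fun s =>
    radius_pos_of_mem_DOC haM ha (hgeo.mem_DOC s trivial)
  have hΔ : ∀ s, 0 < Delta M a (w s).1 := fun s =>
    Delta_pos_of_mem_DOC haM ha (hgeo.mem_DOC s trivial)
  have hN : ∀ s, nullFun M a (w s).1 (w s).2 = 0 := fun s =>
    (sum_metric_eq_zero_iff _ (hr s) (hΔ s).ne').1 (hnull s trivial)
  have hE : ∀ s, (w s).2 0 = -1 := fun s => by
    rw [← he]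
    exact eq_of_hasDerivAt_zero (f := fun s => (w s).2 0) hgeo.ordConnected
      (fun s _ => hasDerivAt_energy (hw s)) trivial h0
  obtain ⟨L, hLdef⟩ : ∃ L, L = angMom (w 0).1 (w 0).2 := ⟨_, rfl⟩
  have hL : ∀ s, angMom (w s).1 (w s).2 = L := fun s => by
    rw [hLdef]
    exact eq_of_hasDerivAt_zero (f := fun s => angMom (w s).1 (w s).2) hgeo.ordConnected
      (fun s _ => hasDerivAt_angMom_nullField (hw s)) trivial h0
  obtain ⟨r₁, r₂, hr₁, hrb'⟩ := exists_radius_bounds h0 htr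
  have hrb : ∀ s, r₁ ≤ radius (w s).1 ∧ radius (w s).1 ≤ r₂ := fun s => hrb' s trivial
  have hsq : 0 < √(M ^ 2 - a ^ 2) := Real.sqrt_pos.2 (by nlinarith)
  have hsq2 : √(M ^ 2 - a ^ 2) ^ 2 = M ^ 2 - a ^ 2 := Real.sq_sqrt (by nlinarith)
  set c := √(M ^ 2 - a ^ 2) with hc
  have hM0 : 0 < M := by linarith
  have hr₁0 : 0 < r₁ := by linarith
  have hΔr : ∀ r, r₁ ≤ r → 0 < r ^ 2 - 2 * M * r + a ^ 2 := fun r h => by nlinarith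
  obtain ⟨B, hB0, hB⟩ := spatialSq_bound (r₂ := r₂) (L := L) hr₁0
    (by linarith : M ≤ r₁) (hΔr r₁ le_rfl)
  -- Only the radius, the radial momentum and `ρ²` enter the radial equations. This reduced orbit
  -- stays in a compact set although `t` is unbounded.
  set σ : ℝ → ℝ × ℝ × ℝ := fun s => (radius (w s).1, radialMom M a (w s), rhoSq a (w s).1) with hσ
  set K : Set (ℝ × ℝ × ℝ) := Icc r₁ r₂ ×ˢ Icc (-(B + 1)) (B + 1) ×ˢ Icc (r₁ ^ 2) (r₂ ^ 2 + a ^ 2)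
    with hKdef
  have hK : IsCompact K := isCompact_Icc.prod (isCompact_Icc.prod isCompact_Icc)
  have hσK : ∀ s, σ s ∈ K := by
    intro s
    refine ⟨hrb s, abs_le.1 ?_, ?_, ?_⟩
    · have := (hB _ _ (hrb s).1 (hrb s).2 (hE s) (hL s) (hN s)).1
      exact abs_le_of_sq_le_sq (by nlinarith) (by positivity)
    · have h1 : r₁ ^ 2 ≤ radius (w s).1 ^ 2 := by have := (hrb s).1; gcongr
      have : 0 ≤ a ^ 2 * ((w s).1 3 / radius (w s).1) ^ 2 := by positivity
      simp only [hσ, rhoSq]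
      linarith
    · have h1 : radius (w s).1 ^ 2 ≤ r₂ ^ 2 := by
        have := (hrb s).2; have := (hr s).le; gcongr
      have h2 := (sinSq_mem (hr s)).1
      simp only [hσ, rhoSq, div_pow]
      nlinarith [sq_nonneg a]
  set u : ℝ → ℝ := fun r => r ^ 2 + a ^ 2 - a * L with hu
  -- The Lyapunov function is `Ξ(r) y` with `y` the radial momentum. Its rate is `√Δ / ρ²` times `Ξ'
  -- y² + Ξ u critFun / Δ²`, a sum of nonnegative terms; where it vanishes `y = 0`, so `Ξ y`
  -- vanishes as well and LaSalle applies.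
  have hsol : ∀ (Ξ Ξ' : ℝ → ℝ), (∀ r, r₁ ≤ r → HasDerivAt Ξ (Ξ' r) r) →
      (∀ r, r₁ ≤ r → 0 < Ξ' r) → ContinuousOn Ξ' (Icc r₁ r₂) →
      (∀ r, r₁ ≤ r → 0 ≤ Ξ r * (u r * critFun M a r L)) →
      dilation (w 0).1 (w 0).2 = 0 ∧
        Ξ (radius (w 0).1) * (u (radius (w 0).1) * critFun M a (radius (w 0).1) L) = 0 := by
    intro Ξ Ξ' hΞ hΞpos hΞc hΞu
    set V : ℝ × ℝ × ℝ → ℝ := fun x => Ξ x.1 * x.2.1 with hV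
    set D : ℝ → ℝ := fun r => r ^ 2 - 2 * M * r + a ^ 2 with hD
    set W : ℝ × ℝ × ℝ → ℝ := fun x => √(D x.1) / x.2.2 * (Ξ' x.1 * x.2.1 ^ 2 +
      Ξ x.1 * (u x.1 * critFun M a x.1 L / D x.1 ^ 2)) with hW
    have hfst : MapsTo (Prod.fst : ℝ × ℝ × ℝ → ℝ) K (Icc r₁ r₂) := fun x hx => hx.1
    have hΞc' : ContinuousOn (fun x : ℝ × ℝ × ℝ => Ξ x.1) K :=
      ContinuousOn.comp (fun r hr => (hΞ r hr.1).continuousAt.continuousWithinAt)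
        continuous_fst.continuousOn hfst
    have hΞc'' : ContinuousOn (fun x : ℝ × ℝ × ℝ => Ξ' x.1) K :=
      hΞc.comp continuous_fst.continuousOn hfst
    have hVc : ContinuousOn V K := hΞc'.mul (by fun_prop)
    have hDpos : ∀ x ∈ K, 0 < D x.1 := fun x hx => hΔr _ hx.1.1
    have hρpos : ∀ x ∈ K, 0 < x.2.2 := fun x hx => (pow_pos hr₁0 2).trans_le hx.2.2.1
    have hWc : ContinuousOn W K := by
      have hDc : Continuous fun x : ℝ × ℝ × ℝ => D x.1 := by fun_prop
      refine (ContinuousOn.div (by fun_prop) (by fun_prop) fun x hx => (hρpos x hx).ne').mul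
        ((hΞc''.mul (by fun_prop)).add (hΞc'.mul (ContinuousOn.div ?_ (by fun_prop)
          fun x hx => (pow_pos (hDpos x hx) 2).ne')))
      unfold critFun
      fun_prop
    have hrad : ∀ s, HasDerivAt (fun s => radius (w s).1)
        (√(D (radius (w s).1)) / rhoSq a (w s).1 * radialMom M a (w s)) s := by
      intro s
      convert! hasDerivAt_radius_nullField (hw s) (hr s) using 1
      have h1 : D (radius (w s).1) = Delta M a (w s).1 := rfl
      have h3 := (hr s).ne'
      have h4 := (rhoSq_pos a (hr s)).ne'
      rw [h1, radialMom]
      field_simp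
      rw [Real.sq_sqrt (hΔ s).le]
      ring
    have hder : ∀ s, HasDerivAt (fun s => V (σ s)) (W (σ s)) s := by
      intro s
      have h1 := ((hΞ _ (hrb s).1).comp s (hrad s)).mul
        (hasDerivAt_radialMom (hw s) (hr s) (hΔ s) (hE s))
      convert! h1 using 1
      have h2 : D (radius (w s).1) = Delta M a (w s).1 := rfl
      simp only [hW, hσ, hL, h2, Function.comp_apply, hu]
      ring
    have hpos1 : ∀ x ∈ K, 0 ≤ Ξ x.1 * (u x.1 * critFun M a x.1 L / D x.1 ^ 2) := fun x hx => by
      rw [← mul_div_assoc]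
      exact div_nonneg (hΞu _ hx.1.1) (by positivity)
    have hcoef : ∀ x ∈ K, 0 < √(D x.1) / x.2.2 := fun x hx =>
      div_pos (Real.sqrt_pos.2 (hDpos x hx)) (hρpos x hx)
    have hpos : ∀ x ∈ K, 0 ≤ W x := fun x hx =>
      mul_nonneg (hcoef x hx).le (add_nonneg
        (mul_nonneg (hΞpos _ hx.1.1).le (sq_nonneg _)) (hpos1 x hx))
    have hWz : ∀ x ∈ K, W x = 0 →
        x.2.1 = 0 ∧ Ξ x.1 * (u x.1 * critFun M a x.1 L / D x.1 ^ 2) = 0 := by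
      intro x hx h
      have h1 := (mul_eq_zero.1 h).resolve_left (hcoef x hx).ne'
      have h2 := mul_nonneg (hΞpos _ hx.1.1).le (sq_nonneg x.2.1)
      have h3 := hpos1 x hx
      have h4 : Ξ' x.1 * x.2.1 ^ 2 = 0 := by linarith
      refine ⟨?_, by linarith⟩
      simpa using (mul_eq_zero.1 h4).resolve_left (hΞpos _ hx.1.1).ne'
    have hfin := rate_eq_zero_of_mem_compact hK hVc hWc hσK hder hpos
      (fun x hx h => by simp [hV, (hWz x hx h).1]) 0
    obtain ⟨h1, h2⟩ := hWz _ (hσK 0) hfin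
    constructor
    · have h3 : √(Delta M a (w 0).1) * dilation (w 0).1 (w 0).2 / radius (w 0).1 = 0 := h1
      have h4 := (Real.sqrt_pos.2 (hΔ 0)).ne'
      simpa [h4, (hr 0).ne'] using h3
    · rw [← mul_div_assoc] at h2
      exact (div_eq_zero_iff.1 h2).resolve_right (pow_pos (hDpos _ (hσK 0)) 2).ne'
  have hMc : 0 ≤ M * (M ^ 2 - a ^ 2) := by rw [← hsq2]; positivity
  have hr0M : ∀ r, r₁ ≤ r → M < r := fun r h => by linarith
  have hcrit : critFun M a (radius (w 0).1) L = 0 ∧ dilation (w 0).1 (w 0).2 = 0 := by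
    -- If `u` is positive at the horizon it is positive outside, and `Ξ = critQuot` works: the force
    -- term is `u (r - M) critQuot²`.
    rcases lt_or_ge 0 (u (M + c)) with hpos | hneg
    · have hupos : ∀ r, r₁ ≤ r → 0 < u r := fun r h => by
        have : (M + c) ^ 2 ≤ r ^ 2 := by gcongr; linarith
        simp only [hu] at hpos ⊢
        linarith
      obtain ⟨h1, h2⟩ := hsol (fun r => critQuot M a r L)
        (fun r => 2 * (r - M) + 2 * M * (M ^ 2 - a ^ 2) / (r - M) ^ 2)
        (fun r h => hasDerivAt_critQuot L (hr0M r h).ne')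
        (fun r h => by
          have := hr0M r h
          have h5 : 0 ≤ 2 * M * (M ^ 2 - a ^ 2) / (r - M) ^ 2 :=
            div_nonneg (by linarith) (sq_nonneg _)
          linarith)
        (ContinuousOn.add (by fun_prop) (ContinuousOn.div (by fun_prop) (by fun_prop)
          fun r h => pow_ne_zero 2 (sub_pos.2 (hr0M r h.1)).ne'))
        (fun r h => by
          have := hr0M r h
          have := hupos r h
          rw [critFun_eq L (hr0M r h).ne']
          have h5 : 0 ≤ u r * (r - M) * critQuot M a r L ^ 2 :=
            mul_nonneg (mul_nonneg (by linarith) (by linarith)) (sq_nonneg _)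
          linarith)
      refine ⟨?_, h1⟩
      rcases mul_eq_zero.1 h2 with h3 | h3
      · rw [critFun_eq L (hr0M _ (hrb 0).1).ne']
        have h4 : critQuot M a (radius (w 0).1) L = 0 := h3
        rw [h4, mul_zero]
      · exact (mul_eq_zero.1 h3).resolve_left (hupos _ (hrb 0).1).ne'
    -- At the horizon `critFun` equals `-c u`, nonnegative in this case, so by monotonicity of
    -- `critQuot` it is positive outside. Then `Ξ = u` works, with force term `u² critFun`; the
    -- conclusion `u = 0` contradicts the null condition.
    · have hcr : ∀ r, r₁ ≤ r → 0 < critFun M a r L := fun r h => by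
        have hMr := hr0M r h
        rw [critFun_eq L hMr.ne']
        refine mul_pos (by linarith) (lt_of_le_of_lt ?_
          (critQuot_lt L hMc (by linarith : M < M + c) (by linarith : M + c < r)))
        have h5 : (M + c - M) * critQuot M a (M + c) L = critFun M a (M + c) L :=
          (critFun_eq L (by linarith)).symm
        have h6 : critFun M a (M + c) L = c * -u (M + c) := by
          simp only [critFun, hu]
          linear_combination (2 * (M + c)) * hsq2
        rw [h6, add_sub_cancel_left] at h5
        rw [mul_left_cancel₀ hsq.ne' h5]
        linarith
      obtain ⟨h1, h2⟩ := hsol u (fun r => 2 * r)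
        (fun r h => by
          have := (((hasDerivAt_id r).pow 2).add_const (a ^ 2)).sub_const (a * L)
          convert! this using 1
          simp)
        (fun r h => by linarith) (by fun_prop)
        (fun r h => by
          have h5 := mul_nonneg (mul_self_nonneg (u r)) (hcr r h).le
          linarith)
      exfalso
      have h3 := ne_zero_of_nullFun (hr 0) (hE 0) (hN 0) h1
      rw [hL] at h3
      rcases mul_eq_zero.1 h2 with h4 | h4
      · exact h3 h4
      · rcases mul_eq_zero.1 h4 with h4 | h4
        exacts [h3 h4, (hcr _ (hrb 0).1).ne' h4]
  exact ⟨ht, he, hgeo.mem_DOC 0 trivial, hcrit.2, by rw [hL]; exact hcrit.1, hN 0⟩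

end TrappedPhotons

/-! ### Existence of photons of constant radius -/

section SphericalPhotons

variable {M a : ℝ}

/-- A complete vector field whose integral curves are the photons of constant radius `r`, with
`ω` the derivative of the Hamiltonian with respect to the angular momentum. -/
noncomputable def sphericalField (a r ω : ℝ) (w : (Fin 4 → ℝ) × (Fin 4 → ℝ)) :
    (Fin 4 → ℝ) × (Fin 4 → ℝ) :=
  let T := (2 * (r ^ 2 + a ^ 2 * (w.1 3 / r) ^ 2))⁻¹
  let R := w.1 1 ^ 2 + w.1 2 ^ 2 + w.1 3 ^ 2
  let α := dilation w.1 w.2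
  let W := spatialSq w.2
  let c := 2 * a ^ 2 * w.1 3 / r ^ 4
  (![0, T * (2 * R * w.2 1 - 2 * α * w.1 1 - ω * w.1 2),
      T * (2 * R * w.2 2 - 2 * α * w.1 2 + ω * w.1 1),
      T * (2 * R * w.2 3 - 2 * α * w.1 3)],
    ![0, T * (-2 * W * w.1 1 + 2 * α * w.2 1 - ω * w.2 2 - c * w.1 3 * w.1 1),
      T * (-2 * W * w.1 2 + 2 * α * w.2 2 + ω * w.2 1 - c * w.1 3 * w.1 2),
      T * (-2 * W * w.1 3 + 2 * α * w.2 3 + c * (R - w.1 3 * w.1 3))])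

theorem contDiff_sphericalField {a r ω : ℝ} (hr : r ≠ 0) {n : WithTop ℕ∞} :
    ContDiff ℝ n (sphericalField a r ω) := by
  have hT : ContDiff ℝ n fun w : (Fin 4 → ℝ) × (Fin 4 → ℝ) =>
      (2 * (r ^ 2 + a ^ 2 * (w.1 3 / r) ^ 2))⁻¹ :=
    ContDiff.inv (by fun_prop) fun w => by positivity
  have hα : ContDiff ℝ n fun w : (Fin 4 → ℝ) × (Fin 4 → ℝ) => dilation w.1 w.2 := by
    unfold dilation; fun_prop
  have hW : ContDiff ℝ n fun w : (Fin 4 → ℝ) × (Fin 4 → ℝ) => spatialSq w.2 := by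
    unfold spatialSq; fun_prop
  unfold sphericalField
  refine ContDiff.prodMk ?_ ?_ <;>
  · rw [contDiff_pi]
    intro i
    fin_cases i
    · exact contDiff_const
    all_goals
      refine hT.mul ?_
      fun_prop

section Conservation

variable {a r ω f s : ℝ} {w : ℝ → (Fin 4 → ℝ) × (Fin 4 → ℝ)}

/-- The conservation laws of this group hold at all points and not only on the photon set: the terms
with `α` in `sphericalField`, and `R` in place of `r²`, are there for that purpose. The scalar
factor `f` is carried along because the flow is built from a cut-off field. -/
theorem hasDerivAt_sphericalField_zero (hw : HasDerivAt w (f • sphericalField a r ω (w s)) s) :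
    HasDerivAt (fun s => (w s).1 0) 0 s ∧ HasDerivAt (fun s => (w s).2 0) 0 s := by
  refine ⟨?_, ?_⟩
  · convert! hasDerivAt_apply hw.fst 0 using 1
    simp [sphericalField]
  · convert! hasDerivAt_apply hw.snd 0 using 1
    simp [sphericalField]

theorem hasDerivAt_sphericalField_radius
    (hw : HasDerivAt w (f • sphericalField a r ω (w s)) s) :
    HasDerivAt (fun s => (w s).1 1 ^ 2 + (w s).1 2 ^ 2 + (w s).1 3 ^ 2) 0 s := by
  convert! hasDerivAt_spatialSq hw.fst using 1
  simp [sphericalField, dilation]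
  ring

theorem hasDerivAt_sphericalField_dilation
    (hw : HasDerivAt w (f • sphericalField a r ω (w s)) s) :
    HasDerivAt (fun s => dilation (w s).1 (w s).2) 0 s := by
  convert! hasDerivAt_dilation hw.fst hw.snd using 1
  simp [sphericalField, dilation, spatialSq]
  ring

theorem hasDerivAt_sphericalField_angMom
    (hw : HasDerivAt w (f • sphericalField a r ω (w s)) s) :
    HasDerivAt (fun s => angMom (w s).1 (w s).2) 0 s := by
  convert! hasDerivAt_angMom hw.fst hw.snd using 1
  simp [sphericalField, angMom, dilation]
  ring

theorem hasDerivAt_sphericalField_spatialSq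
    (hw : HasDerivAt w (f • sphericalField a r ω (w s)) s) :
    HasDerivAt (fun s => spatialSq (w s).2 - a ^ 2 * (w s).1 3 ^ 2 / r ^ 4) 0 s := by
  convert! (hasDerivAt_spatialSq hw.snd).sub
    ((((hasDerivAt_apply hw.fst 3).pow 2).const_mul (a ^ 2)).div_const (r ^ 4)) using 1
  simp [sphericalField, dilation, spatialSq]
  ring

end Conservation

/-- Freezing the time coordinate and fixing the radius bounds the position, and the last condition,
Carter's constant up to terms constant along the motion, then bounds the momentum. -/
theorem isCompact_sphericalSet {a r B : ℝ} :
    IsCompact {w : (Fin 4 → ℝ) × (Fin 4 → ℝ) | w.1 0 = 0 ∧ w.2 0 = -1 ∧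
      w.1 1 ^ 2 + w.1 2 ^ 2 + w.1 3 ^ 2 = r ^ 2 ∧
      spatialSq w.2 - a ^ 2 * w.1 3 ^ 2 / r ^ 4 = B} := by
  obtain ⟨D, hD⟩ : ∃ D, D = |B| + a ^ 2 * r ^ 2 / r ^ 4 := ⟨_, rfl⟩
  have hD0 : 0 ≤ D := by rw [hD]; positivity
  refine (isCompact_box 0 |r| (D + 1)).of_isClosed_subset ?_ ?_
  · have hs : Continuous fun w : (Fin 4 → ℝ) × (Fin 4 → ℝ) => spatialSq w.2 := by
      unfold spatialSq; fun_prop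
    exact (isClosed_eq (by fun_prop) continuous_const).inter
      ((isClosed_eq (by fun_prop) continuous_const).inter
      ((isClosed_eq (by fun_prop) continuous_const).inter
      (isClosed_eq (by fun_prop) continuous_const)))
  · rintro ⟨q, p⟩ ⟨h0, h1, h2, h3⟩
    simp only at h0 h1 h2 h3
    have hz : q 3 ^ 2 ≤ r ^ 2 := by nlinarith [sq_nonneg (q 1), sq_nonneg (q 2)]
    have hr : radius q = |r| := by rw [radius, h2, Real.sqrt_sq_eq_abs]
    refine ⟨?_, Real.sqrt_nonneg _, hr.le, fun i => abs_apply_le hD0 h1 ?_ i⟩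
    · simp only [h0, abs_zero]; linarith
    · have h4 : a ^ 2 * q 3 ^ 2 / r ^ 4 ≤ a ^ 2 * r ^ 2 / r ^ 4 := by gcongr
      have := le_abs_self B
      linarith

theorem exists_sphericalField_solution {a r ω : ℝ} (hr : r ≠ 0)
    (w₀ : (Fin 4 → ℝ) × (Fin 4 → ℝ)) (h0 : w₀.1 0 = 0) (he : w₀.2 0 = -1)
    (hrw : w₀.1 1 ^ 2 + w₀.1 2 ^ 2 + w₀.1 3 ^ 2 = r ^ 2) :
    ∃ w : ℝ → (Fin 4 → ℝ) × (Fin 4 → ℝ), w 0 = w₀ ∧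
      ∀ s, HasDerivAt w (sphericalField a r ω (w s)) s := by
  suffices hinv : ∀ (f : ℝ → ℝ) (w : ℝ → (Fin 4 → ℝ) × (Fin 4 → ℝ)), w 0 = w₀ →
      (∀ t, HasDerivAt w (f t • sphericalField a r ω (w t)) t) →
      ∀ t, w t ∈ {w : (Fin 4 → ℝ) × (Fin 4 → ℝ) | w.1 0 = 0 ∧ w.2 0 = -1 ∧
        w.1 1 ^ 2 + w.1 2 ^ 2 + w.1 3 ^ 2 = r ^ 2 ∧ spatialSq w.2 - a ^ 2 * w.1 3 ^ 2 / r ^ 4 =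
          spatialSq w₀.2 - a ^ 2 * w₀.1 3 ^ 2 / r ^ 4} by
    obtain ⟨w, hw0, hw, -⟩ := exists_global_solution_of_invariant isOpen_univ
      (contDiff_sphericalField (a := a) (ω := ω) hr).contDiffOn isCompact_sphericalSet
      (subset_univ _) w₀ hinv
    exact ⟨w, hw0, hw⟩
  · intro f w hw0 hw t
    have key : ∀ φ : (Fin 4 → ℝ) × (Fin 4 → ℝ) → ℝ,
        (∀ s, HasDerivAt (fun s => φ (w s)) 0 s) → φ (w t) = φ w₀ := fun φ hφ => by
      rw [← hw0]
      exact eq_of_hasDerivAt_zero (f := fun s => φ (w s)) ordConnected_univ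
        (fun s _ => hφ s) trivial trivial
    refine ⟨?_, ?_, ?_, ?_⟩
    · exact (key (fun w => w.1 0) fun s => (hasDerivAt_sphericalField_zero (hw s)).1).trans h0
    · exact (key (fun w => w.2 0) fun s => (hasDerivAt_sphericalField_zero (hw s)).2).trans he
    · exact (key (fun w => w.1 1 ^ 2 + w.1 2 ^ 2 + w.1 3 ^ 2)
        fun s => hasDerivAt_sphericalField_radius (hw s)).trans hrw
    · exact key (fun w => spatialSq w.2 - a ^ 2 * w.1 3 ^ 2 / r ^ 4)
        fun s => hasDerivAt_sphericalField_spatialSq (hw s)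

/-- Away from the time components, the null Hamiltonian field coincides with the spherical field
at covectors with vanishing radial momentum and stationary radius. -/
theorem nullField_eq_sphericalField {q q₀ p : Fin 4 → ℝ} (hq : ∀ i : Fin 3, q i.succ = q₀ i.succ)
    (hr : 0 < radius q) (he : p 0 = -1) (hα : dilation q p = 0)
    (hcrit : critFun M a (radius q) (angMom q p) = 0) :
    nullField M a (q, p) =
      (Function.update (sphericalField a (radius q)
        (sepL M a (radius q) (angMom q p) (-1)) (q₀, p)).1 0
        ((2 * rhoSq a q)⁻¹ * sepE M a (radius q) (angMom q p) (-1) (q 3)),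
      (sphericalField a (radius q) (sepL M a (radius q) (angMom q p) (-1)) (q₀, p)).2) := by
  have h1 : q₀ 1 = q 1 := (hq 0).symm
  have h2 : q₀ 2 = q 2 := (hq 1).symm
  have h3 : q₀ 3 = q 3 := (hq 2).symm
  have hα₀ : dilation q₀ p = 0 := by rw [← hα]; simp only [dilation, h1, h2, h3]
  have hr0 := hr.ne'
  -- The part of `sepR` with `Δ` in the denominator has a numerator divisible by `critFun`;
  -- stationarity removes it, leaving the force that keeps the orbit on the sphere.
  have hR : sepR M a (radius q) 0 (angMom q p) (-1) (spatialSq p) (q 3) =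
      2 * radius q * spatialSq p + 2 * a ^ 2 * q 3 ^ 2 / radius q ^ 3 := by
    have hd : radius q ^ 2 - 2 * M * radius q + a ^ 2 = Delta M a q := rfl
    rw [critFun, hd] at hcrit
    simp only [sepR, hd]
    have : 4 * radius q * -1 * ((radius q ^ 2 + a ^ 2) * -1 + a * angMom q p) * Delta M a q
        - ((radius q ^ 2 + a ^ 2) * -1 + a * angMom q p) ^ 2 * (2 * (radius q - M)) = 0 := by
      linear_combination (2 * (radius q ^ 2 + a ^ 2 - a * angMom q p)) * hcrit
    rw [this]
    ring
  have hA : sepA M a (radius q) 0 = 0 := by simp [sepA]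
  have hsq := radius_sq q
  refine Prod.ext (funext fun i => ?_) (funext fun i => ?_)
  · fin_cases i
    · simp [nullField, vel, gradP, he]
    all_goals
      simp [nullField, vel, gradP, he, hα, hA, sphericalField, hα₀, h1, h2, h3, rhoSq, ← hsq]
      try ring_nf
      try simp
  · fin_cases i
    · simp [nullField, force, gradQ, sphericalField]
    all_goals
      simp [nullField, force, gradQ, he, hα, hA, hR, sphericalField, hα₀, h1, h2, h3, rhoSq, sepZ,
        ← hsq]
      field_simp
      try ring

/-- Solving stationarity for `r² + a² - a L` allows `a L` to be eliminated from the null condition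
and from the rate of `t`. -/
theorem Delta_eq_of_critFun {r L : ℝ} (hr : M < r) (h : critFun M a r L = 0) :
    r ^ 2 + a ^ 2 - a * L = 2 * r * (r ^ 2 - 2 * M * r + a ^ 2) / (r - M) := by
  have : r - M ≠ 0 := (sub_pos.2 hr).ne'
  rw [critFun] at h
  field_simp
  linarith

/-- The time function increases along the photons of constant radius. -/
theorem sepE_pos {q p : Fin 4 → ℝ} (hM : 0 < M) (hr : M < radius q) (hΔ : 0 < Delta M a q)
    (hcrit : critFun M a (radius q) (angMom q p) = 0) :
    0 < sepE M a (radius q) (angMom q p) (-1) (q 3) := by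
  have hu := Delta_eq_of_critFun hr hcrit
  have hr0 : 0 < radius q := hM.trans hr
  obtain ⟨hs0, hs1⟩ := sinSq_mem hr0
  have hd : radius q ^ 2 - 2 * M * radius q + a ^ 2 = Delta M a q := rfl
  simp only [sepE, hd] at hu ⊢
  obtain ⟨σ, hσ⟩ : ∃ σ, σ = 1 - q 3 ^ 2 / radius q ^ 2 := ⟨_, rfl⟩
  rw [← hσ] at hs0 hs1 ⊢
  have h1 : a * angMom q p = radius q ^ 2 + a ^ 2 -
      2 * radius q * Delta M a q / (radius q - M) := by linarith
  have hX : 0 < radius q - M := sub_pos.2 hr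
  rw [show 2 * a * angMom q p = 2 * (a * angMom q p) by ring, h1]
  -- After elimination of `a L` the rate is `8 M r² / (r - M) + 2 ρ²`, a sum of positive terms.
  have e : -2 * ((radius q ^ 2 + a ^ 2) * -1 + (radius q ^ 2 + a ^ 2 -
      2 * radius q * Delta M a q / (radius q - M))) * (radius q ^ 2 + a ^ 2) / Delta M a q +
      2 * (radius q ^ 2 + a ^ 2 - 2 * radius q * Delta M a q / (radius q - M)) +
      2 * a ^ 2 * -1 * σ = 2 * radius q * (2 * (2 * M * radius q)) / (radius q - M)
        + 2 * (radius q ^ 2 + a ^ 2 * (1 - σ)) := by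
    field_simp
    rw [← hd]
    ring
  rw [e]
  have h2 : 0 ≤ a ^ 2 * (1 - σ) := mul_nonneg (sq_nonneg a) (by linarith)
  positivity

/-- Every covector with vanishing radial momentum and stationary radius belongs to a trapped
photon. -/
theorem photonSet_subset_photonSlice (haM : a < M) (ha : 0 ≤ a) :
    photonSet M a ⊆ photonSlice M a := by
  rintro ⟨q₀, p₀⟩ ⟨h0, he, hD, hα, hcrit, hN⟩
  simp only at h0 he hD hα hcrit hN
  refine ⟨?_, h0, he⟩
  have hM : 0 < M := by linarith
  have hr := radius_pos_of_mem_DOC haM ha hD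
  have hΔ := Delta_pos_of_mem_DOC haM ha hD
  have hMr : M < radius q₀ := by
    have : M + √(M ^ 2 - a ^ 2) < radius q₀ := hD
    have := Real.sqrt_nonneg (M ^ 2 - a ^ 2)
    linarith
  obtain ⟨r, hrdef⟩ : ∃ r, r = radius q₀ := ⟨_, rfl⟩
  obtain ⟨L, hLdef⟩ : ∃ L, L = angMom q₀ p₀ := ⟨_, rfl⟩
  -- The spatial motion and the momenta do not depend on `t`, so they are solved first with the time
  -- coordinate frozen; `t` is recovered afterwards as the integral `τ` of its rate `g`.
  obtain ⟨β, hβ0, hβ⟩ := exists_sphericalField_solution (a := a) (ω := sepL M a r L (-1))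
    (hrdef ▸ hr.ne') (q₀, p₀) h0 he (by rw [hrdef, radius_sq])
  have hβ' : ∀ s, HasDerivAt β ((1 : ℝ) • sphericalField a r (sepL M a r L (-1)) (β s)) s :=
    fun s => by simpa using hβ s
  have key : ∀ φ : (Fin 4 → ℝ) × (Fin 4 → ℝ) → ℝ,
      (∀ s, HasDerivAt (fun s => φ (β s)) 0 s) → ∀ t, φ (β t) = φ (q₀, p₀) := fun φ hφ t => by
    rw [← hβ0]
    exact eq_of_hasDerivAt_zero (f := fun s => φ (β s)) ordConnected_univ
      (fun s _ => hφ s) trivial trivial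
  have hβe : ∀ s, (β s).2 0 = -1 := fun s =>
    (key (fun w => w.2 0) (fun s => (hasDerivAt_sphericalField_zero (hβ' s)).2) s).trans he
  have hβr : ∀ s, radius (β s).1 = r := fun s => by
    have := key (fun w => w.1 1 ^ 2 + w.1 2 ^ 2 + w.1 3 ^ 2)
      (fun s => hasDerivAt_sphericalField_radius (hβ' s)) s
    simp only at this
    rw [radius, this, hrdef, radius]
  have hβα : ∀ s, dilation (β s).1 (β s).2 = 0 := fun s =>
    (key (fun w => dilation w.1 w.2)
      (fun s => hasDerivAt_sphericalField_dilation (hβ' s)) s).trans hα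
  have hβL : ∀ s, angMom (β s).1 (β s).2 = L := fun s =>
    (key (fun w => angMom w.1 w.2)
      (fun s => hasDerivAt_sphericalField_angMom (hβ' s)) s).trans hLdef.symm
  set g : ℝ → ℝ := fun s =>
    (2 * (r ^ 2 + a ^ 2 * ((β s).1 3 / r) ^ 2))⁻¹ * sepE M a r L (-1) ((β s).1 3) with hg
  have hr0 : 0 < r := hrdef ▸ hr
  have hβc : Continuous β := continuous_iff_continuousAt.2 fun s => (hβ s).continuousAt
  have hgc : Continuous g := by
    have : Continuous fun s => (β s).1 3 := (continuous_apply 3).comp (continuous_fst.comp hβc)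
    refine Continuous.mul (Continuous.inv₀ (by fun_prop) fun s => by positivity) ?_
    unfold sepE
    fun_prop
  set τ : ℝ → ℝ := fun s => ∫ x in (0 : ℝ)..s, g x with hτ
  have hτd : ∀ s, HasDerivAt τ (g s) s := fun s => hgc.integral_hasStrictDerivAt 0 s |>.hasDerivAt
  set w : ℝ → (Fin 4 → ℝ) × (Fin 4 → ℝ) := fun s =>
    (Function.update (β s).1 0 (τ s), (β s).2) with hwdef
  have hwi : ∀ s (i : Fin 3), (w s).1 i.succ = (β s).1 i.succ := fun s i => by
    simp [hwdef]
  have hw1 : ∀ s, (w s).1 1 = (β s).1 1 := fun s => hwi s 0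
  have hw2 : ∀ s, (w s).1 2 = (β s).1 2 := fun s => hwi s 1
  have hw3 : ∀ s, (w s).1 3 = (β s).1 3 := fun s => hwi s 2
  have hwr : ∀ s, radius (w s).1 = r := fun s => by
    rw [← hβr s]; simp only [radius, hw1, hw2, hw3]
  have hwα : ∀ s, dilation (w s).1 (w s).2 = 0 := fun s => by
    rw [← hβα s]; simp only [dilation, hw1, hw2, hw3]; rfl
  have hwL : ∀ s, angMom (w s).1 (w s).2 = L := fun s => by
    rw [← hβL s]; simp only [angMom, hw1, hw2]; rfl
  have hw0 : w 0 = (q₀, p₀) := by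
    simp only [hwdef, hβ0, hτ, intervalIntegral.integral_same]
    rw [← h0, Function.update_eq_self]
  have hwD : ∀ s, (w s).1 ∈ DOC M a := fun s => by
    change _ < radius (w s).1
    rw [hwr, hrdef]
    exact hD
  have hcr : ∀ s, critFun M a (radius (w s).1) (angMom (w s).1 (w s).2) = 0 := fun s => by
    rw [hwr, hwL, hrdef, hLdef, hcrit]
  have hw : ∀ s, HasDerivAt w (nullField M a (w s)) s := by
    intro s
    have h1 := nullField_eq_sphericalField (M := M) (a := a) (q := (w s).1) (q₀ := (β s).1)
      (p := (w s).2) (hwi s) (hwr s ▸ hr0) (hβe s) (hwα s) (hcr s)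
    rw [hwr, hwL] at h1
    have h2 : nullField M a (w s) = _ := h1
    rw [h2]
    refine HasDerivAt.prodMk ?_ (hβ s).snd
    rw [hasDerivAt_pi]
    intro i
    refine Fin.cases ?_ (fun i => ?_) i
    · simp only [Function.update_self]
      rw [rhoSq, hwr, hw3]
      exact hτd s
    · simp only [ne_eq, Fin.succ_ne_zero, not_false_eq_true, Function.update_of_ne]
      exact hasDerivAt_apply (hβ s).fst i.succ
  have hwN : ∀ s, nullFun M a (w s).1 (w s).2 = 0 := fun s => by
    rw [eq_of_hasDerivAt_zero (f := fun s => nullFun M a (w s).1 (w s).2) ordConnected_univ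
      (fun s _ => hasDerivAt_nullFun_nullField (hw s)
        (radius_pos_of_mem_DOC haM ha (hwD s)) (Delta_pos_of_mem_DOC haM ha (hwD s)).ne')
      (mem_univ s) (mem_univ 0), hw0]
    exact hN
  have hgeo := isGeodesicOn_of_nullField haM ha isOpen_univ ordConnected_univ
    (fun s _ => hw s) (fun s _ => hwD s) fun s _ => hwN s
  have hder : ∀ s, deriv (fun s => (w s).1) s = vel M a (w s).1 (w s).2 := fun s =>
    HasDerivAt.deriv (hw s).fst
  have hlow : ∀ s, lower M a (w s).1 (deriv (fun s => (w s).1) s) = (w s).2 := fun s => by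
    rw [hder]
    exact lower_vel _ (radius_pos_of_mem_DOC haM ha (hwD s))
      (Delta_pos_of_mem_DOC haM ha (hwD s)).ne'
  -- A geodesic defined on the whole line is inextendible, and the sphere of radius `r` is the
  -- compact set that traps it.
  refine ⟨fun s => (w s).1, univ, trivial, ⟨⟨hgeo, fun _ J' _ h _ => univ_subset_iff.1 h⟩,
    fun s _ => ⟨?_, ?_⟩⟩, ?_, ?_⟩
  · rw [sum_metric_eq_zero_iff _ (radius_pos_of_mem_DOC haM ha (hwD s))
      (Delta_pos_of_mem_DOC haM ha (hwD s)).ne', hlow]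
    exact hwN s
  · rw [hder]
    have h1 : vel M a (w s).1 (w s).2 0 = (2 * rhoSq a (w s).1)⁻¹ *
        sepE M a (radius (w s).1) (angMom (w s).1 (w s).2) (-1) ((w s).1 3) := by
      rw [← hβe s]; rfl
    rw [h1]
    refine mul_pos (inv_pos.2 (mul_pos two_pos (rhoSq_pos a (hwr s ▸ hr0)))) ?_
    exact sepE_pos hM (by rw [hwr, hrdef]; exact hMr) (Delta_pos_of_mem_DOC haM ha (hwD s)) (hcr s)
  · refine ⟨{x | x 0 ^ 2 + x 1 ^ 2 + x 2 ^ 2 = r ^ 2}, ?_, ?_, ?_⟩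
    · refine (isCompact_closedBall (0 : Fin 3 → ℝ) r).of_isClosed_subset
        (isClosed_eq (by fun_prop) continuous_const) fun x hx => ?_
      have hx' : x 0 ^ 2 + x 1 ^ 2 + x 2 ^ 2 = r ^ 2 := hx
      rw [mem_closedBall_zero_iff, pi_norm_le_iff_of_nonneg hr0.le]
      intro i
      rw [Real.norm_eq_abs]
      refine abs_le_of_sq_le_sq ?_ hr0.le
      fin_cases i <;> simp <;> nlinarith [sq_nonneg (x 0), sq_nonneg (x 1), sq_nonneg (x 2)]
    · intro x hx
      have hx' : x 0 ^ 2 + x 1 ^ 2 + x 2 ^ 2 = r ^ 2 := hx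
      refine ⟨Fin.cons 0 x, ?_, ?_⟩
      · have : radius (Fin.cons 0 x) = r := by
          have : radius (Fin.cons 0 x) = √(x 0 ^ 2 + x 1 ^ 2 + x 2 ^ 2) := rfl
          rw [this, hx', Real.sqrt_sq hr0.le]
        change _ < radius _
        rw [this, hrdef]
        exact hD
      · funext i
        simp [spatial]
    · intro s _
      change (w s).1 1 ^ 2 + (w s).1 2 ^ 2 + (w s).1 3 ^ 2 = r ^ 2
      rw [← radius_sq, hwr]
  · rw [hlow 0]
    exact hw0.symm

theorem photonSlice_eq_photonSet (haM : a < M) (ha : 0 ≤ a) :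
    photonSlice M a = photonSet M a := by
  refine Subset.antisymm ?_ (photonSet_subset_photonSlice haM ha)
  rintro _ ⟨⟨γ, J, h0, hph, htr, rfl⟩, ht, he⟩
  exact mem_photonSet_of_isTrapped haM ha h0 hph htr ht he

end SphericalPhotons

/-! ### Existence and uniqueness of the radius for given directions -/

section SphericalRadius

variable {M a : ℝ}

/-- The equations for the radius `r` and the length `k` of the angular momentum of a photon of
constant radius, with `l` the cosine of its inclination and `σ` the square of the sine of the
polar angle. -/
structure IsSphericalRadius (M a l σ r k : ℝ) : Prop where
  horizon_lt : M + √(M ^ 2 - a ^ 2) < r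
  pos : 0 < k
  crit : critFun M a r (k * l) = 0
  null : (r ^ 2 + a ^ 2 - a * (k * l)) ^ 2 =
    (r ^ 2 - 2 * M * r + a ^ 2) * (k ^ 2 - 2 * a * (k * l) + a ^ 2 * σ)

/-- Here `X = r - M` and `c² = M² - a²`, so `Δ = X² - c²`. Stationarity turns the null condition
into `k² - 2 a l k + a² σ = κ`, of which `K` is the larger root, and `hA` is stationarity itself.
The point is that the truncated square root is genuine and that `K` is positive. -/
theorem isSphericalRadius_of_root (ha : 0 ≤ a) (haM : a < M) {l σ c X κ K : ℝ} (hl : l ^ 2 ≤ σ)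
    (hσ : σ ≤ 1) (hc : c = √(M ^ 2 - a ^ 2)) (hcX : c < X)
    (hκ : κ = 4 * (X + M) ^ 2 * (X ^ 2 - c ^ 2) / X ^ 2)
    (hKe : K = a * l + √(κ - a ^ 2 * (σ - l ^ 2)))
    (hA : a * l * K = 3 * M ^ 2 - a ^ 2 - X ^ 2 + 2 * M * c ^ 2 / X) :
    IsSphericalRadius M a l σ (X + M) K := by
  have hc0 : 0 < c := by rw [hc]; exact Real.sqrt_pos.2 (by nlinarith)
  have hc2 : c ^ 2 = M ^ 2 - a ^ 2 := by rw [hc]; exact Real.sq_sqrt (by nlinarith)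
  have hM : 0 < M := by linarith
  have hl1 : l ^ 2 ≤ 1 := hl.trans hσ
  have hX0 : 0 < X := hc0.trans hcX
  obtain ⟨r, hr⟩ : ∃ r, r = X + M := ⟨_, rfl⟩
  obtain ⟨D, hD⟩ : ∃ D, D = X ^ 2 - c ^ 2 := ⟨_, rfl⟩
  have hD' : r ^ 2 - 2 * M * r + a ^ 2 = D := by rw [hD, hr]; linear_combination hc2
  have hD0 : 0 < D := by rw [hD]; nlinarith
  have hr0 : 0 < r := by linarith
  have hcrit : a * (K * l) = r ^ 2 + a ^ 2 - 2 * r * D / X := by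
    rw [show a * (K * l) = a * l * K by ring, hA, hD, hr]
    field_simp
    linear_combination (-2 * X) * hc2
  have hκX : κ * D = (2 * r * D / X) ^ 2 := by
    rw [hκ, hr, hD]
    field_simp
    ring
  -- If `κ ≤ a²` and `a L ≤ a²` then `u = r² + a² - a L ≥ r²`, while `u² = κ Δ ≤ a² Δ < r⁴`. A
  -- negative discriminant and a nonpositive `K` both lead to this situation.
  have hlow : ¬ (κ ≤ a ^ 2 ∧ a * (K * l) ≤ a ^ 2) := by
    rintro ⟨h1, h2⟩
    have h3 : r ^ 2 ≤ 2 * r * D / X := by linarith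
    have h4 : (r ^ 2) ^ 2 ≤ κ * D := by rw [hκX]; gcongr
    have h5 : κ * D ≤ a ^ 2 * D := by gcongr
    have h6 : D < r ^ 2 := by rw [← hD']; nlinarith
    have h7 : a ^ 2 * D ≤ a ^ 2 * r ^ 2 := by gcongr
    have h8 : a ^ 2 < r ^ 2 := by gcongr; linarith
    have h9 : a ^ 2 * r ^ 2 < r ^ 2 * r ^ 2 := by gcongr
    linarith
  have hS0 := Real.sqrt_nonneg (κ - a ^ 2 * (σ - l ^ 2))
  have hal : a ^ 2 * l ^ 2 ≤ a ^ 2 := by nlinarith [sq_nonneg a]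
  have haσ : a ^ 2 * σ ≤ a ^ 2 := by nlinarith [sq_nonneg a]
  have hdisc : 0 ≤ κ - a ^ 2 * (σ - l ^ 2) := by
    by_contra! h
    have h1 := Real.sqrt_eq_zero_of_nonpos h.le
    rw [h1, add_zero] at hKe
    have h2 : 0 ≤ a ^ 2 * l ^ 2 := by positivity
    refine hlow ⟨by linarith, ?_⟩
    rw [hKe]
    linarith
  have hS2 := Real.sq_sqrt hdisc
  have hκK : K ^ 2 - 2 * a * (K * l) + a ^ 2 * σ = κ := by
    rw [← sub_eq_iff_eq_add'] at hKe
    rw [← hKe] at hS2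
    linear_combination hS2
  have hKpos : 0 < K := by
    by_contra! h
    have h1 : a * l ≤ K := by linarith
    have hl0 : a * l ≤ 0 := h1.trans h
    have h2 : -(a * l) * -K ≤ -(a * l) * -(a * l) := by gcongr; linarith
    have h3 : a * (K * l) ≤ a ^ 2 := by linarith
    have h4 : K ^ 2 ≤ (a * l) * K := by
      have : -K * -K ≤ -K * -(a * l) := by gcongr; linarith
      linarith
    have h5 : 0 ≤ a * (K * l) := by
      have := mul_nonneg_of_nonpos_of_nonpos hl0 h
      linarith
    exact hlow ⟨by linarith, h3⟩
  rw [← hr]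
  refine ⟨by linarith, hKpos, ?_, ?_⟩
  · rw [critFun, hD', hcrit, hr]
    field_simp
    ring
  · rw [hD', hκK, mul_comm D, hκX, hcrit]
    ring

/-- With `k` eliminated one equation `F X = 0` remains, and `F` changes sign between the horizon `X
= c` and `X = 5 M`. The square root in `F` is truncated at zero, which keeps `F` continuous on the
whole interval; `isSphericalRadius_of_root` shows that the truncation is inactive at a root. -/
theorem exists_isSphericalRadius (ha : 0 ≤ a) (haM : a < M) {l σ : ℝ} (hl : l ^ 2 ≤ σ)
    (hσ : σ ≤ 1) : ∃ r k, IsSphericalRadius M a l σ r k := by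
  obtain ⟨c, hc⟩ : ∃ c, c = √(M ^ 2 - a ^ 2) := ⟨_, rfl⟩
  have hc0 : 0 < c := by rw [hc]; exact Real.sqrt_pos.2 (by nlinarith)
  have hc2 : c ^ 2 = M ^ 2 - a ^ 2 := by rw [hc]; exact Real.sq_sqrt (by nlinarith)
  have hM : 0 < M := by linarith
  have hcM : c ≤ M := abs_le_of_sq_le_sq' (by nlinarith) hM.le |>.2
  have hl1 : l ^ 2 ≤ 1 := hl.trans hσ
  obtain ⟨hl2, hl3⟩ := abs_le.1 ((sq_le_one_iff_abs_le_one l).1 hl1)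
  set κ : ℝ → ℝ := fun X => 4 * (X + M) ^ 2 * (X ^ 2 - c ^ 2) / X ^ 2 with hκ
  set k : ℝ → ℝ := fun X => a * l + √(κ X - a ^ 2 * (σ - l ^ 2)) with hk
  set A : ℝ → ℝ := fun X => 3 * M ^ 2 - a ^ 2 - X ^ 2 + 2 * M * c ^ 2 / X with hA
  set F : ℝ → ℝ := fun X => a * l * k X - A X with hF
  have hdef : 0 ≤ a ^ 2 * (σ - l ^ 2) := mul_nonneg (sq_nonneg a) (by linarith)
  have hFc : ContinuousOn F (Icc c (5 * M)) := by
    have h0 : ∀ X ∈ Icc c (5 * M), X ≠ 0 := fun X hX => (hc0.trans_le hX.1).ne'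
    have h02 : ∀ X ∈ Icc c (5 * M), X ^ 2 ≠ 0 := fun X hX => pow_ne_zero 2 (h0 X hX)
    have hκc : ContinuousOn κ (Icc c (5 * M)) := ContinuousOn.div (by fun_prop) (by fun_prop) h02
    have hAc : ContinuousOn A (Icc c (5 * M)) :=
      ContinuousOn.add (by fun_prop) (ContinuousOn.div (by fun_prop) (by fun_prop) h0)
    refine ContinuousOn.sub (ContinuousOn.mul (by fun_prop) (ContinuousOn.add (by fun_prop) ?_)) hAc
    exact (hκc.sub (by fun_prop)).sqrt
  have hFneg : F c < 0 := by
    have h1 : κ c = 0 := by simp [hκ]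
    have h2 : A c = 2 * M ^ 2 + 2 * M * c := by
      simp only [hA]
      field_simp
      linear_combination -hc2
    -- At the horizon `κ` vanishes and the argument of the square root is nonpositive, so its
    -- default value zero is used.
    have h3 : √(κ c - a ^ 2 * (σ - l ^ 2)) = 0 := Real.sqrt_eq_zero_of_nonpos (by linarith)
    have h4 : F c = a ^ 2 * l ^ 2 - (2 * M ^ 2 + 2 * M * c) := by
      simp only [hF, hk, h2, h3]; ring
    have h5 : a ^ 2 * l ^ 2 ≤ a ^ 2 * 1 := by gcongr
    rw [h4]
    nlinarith
  -- Here `κ ≤ (12 M)²`, so the term with `k` is at least `-12 M²`, while `A ≤ -21 M²`.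
  have hFpos : 0 < F (5 * M) := by
    have hκ1 : κ (5 * M) ≤ (12 * M) ^ 2 := by
      simp only [hκ]
      rw [div_le_iff₀ (by positivity)]
      nlinarith [sq_nonneg c, mul_nonneg (sq_nonneg M) (sq_nonneg c)]
    have h1 : √(κ (5 * M) - a ^ 2 * (σ - l ^ 2)) ≤ 12 * M := by
      rw [Real.sqrt_le_left (by linarith)]
      linarith
    have h0 := Real.sqrt_nonneg (κ (5 * M) - a ^ 2 * (σ - l ^ 2))
    have h2 : -(12 * M * M) ≤ a * l * √(κ (5 * M) - a ^ 2 * (σ - l ^ 2)) := by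
      obtain ⟨S, hS⟩ : ∃ S, S = √(κ (5 * M) - a ^ 2 * (σ - l ^ 2)) := ⟨_, rfl⟩
      rw [← hS] at h0 h1 ⊢
      have h3 : a * S ≤ M * (12 * M) := by gcongr
      have h4 : 0 ≤ a * S := by positivity
      nlinarith
    have h3 : A (5 * M) ≤ 3 * M ^ 2 - 25 * M ^ 2 + M ^ 2 := by
      simp only [hA]
      have : 2 * M * c ^ 2 / (5 * M) ≤ M ^ 2 := by
        rw [div_le_iff₀ (by positivity)]
        nlinarith
      nlinarith
    have h4 : F (5 * M) = a ^ 2 * l ^ 2 + a * l * √(κ (5 * M) - a ^ 2 * (σ - l ^ 2)) - A (5 * M) := by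
      simp only [hF, hk]; ring
    rw [h4]
    nlinarith [mul_nonneg (sq_nonneg a) (sq_nonneg l)]
  obtain ⟨X, hX, hFX⟩ := intermediate_value_Icc (by linarith : c ≤ 5 * M) hFc ⟨hFneg.le, hFpos.le⟩
  have hcX : c < X := lt_of_le_of_ne hX.1 fun h => by rw [← h] at hFX; linarith
  have hX0 : 0 < X := hc0.trans hcX
  exact ⟨X + M, k X, isSphericalRadius_of_root ha haM hl hσ hc hcX rfl rfl (sub_eq_zero.1 hFX)⟩

/-- The convexity argument for the uniqueness of the radius: an affine function cannot meet the
root of a nonnegative quadratic polynomial from above and stay above it. -/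
theorem quadratic_ne_of_affine {b S D U₀ k k' : ℝ} (hD : 0 < D) (hb : b ^ 2 ≤ S)
    (hk : 0 < k) (hkk : k < k') (h0 : D * S < U₀ ^ 2) (hU₀ : 0 < U₀) (hU₂ : 0 < U₀ - k' * b)
    (h2 : D * (k' ^ 2 - 2 * b * k' + S) ≤ (U₀ - k' * b) ^ 2) :
    (U₀ - k * b) ^ 2 ≠ D * (k ^ 2 - 2 * b * k + S) := by
  intro h1
  obtain ⟨U₂, hU⟩ : ∃ U₂, U₂ = U₀ - k' * b := ⟨_, rfl⟩
  obtain ⟨C, hC⟩ : ∃ C, C = k' ^ 2 - 2 * b * k' + S := ⟨_, rfl⟩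
  obtain ⟨B, hB⟩ : ∃ B, B = S - b * k' := ⟨_, rfl⟩
  rw [← hU] at hU₂ h2
  rw [← hC] at h2
  have hC0 : 0 ≤ C := by rw [hC]; nlinarith [sq_nonneg (k' - b)]
  have hBC : B ^ 2 ≤ S * C := by
    have : 0 ≤ k' ^ 2 * (S - b ^ 2) := mul_nonneg (sq_nonneg _) (by linarith)
    rw [hB, hC]
    linarith
  -- The mixed term `B` is the polarization of the nonnegative quadratic form between the parameters
  -- `0` and `k'`. Cauchy-Schwarz for it expresses the convexity of the square root of the quadratic
  -- polynomial.
  have hDB : D * B ≤ U₀ * U₂ := by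
    refine (abs_le_of_sq_le_sq' ?_ (by positivity)).2
    calc (D * B) ^ 2 = D ^ 2 * B ^ 2 := by ring
      _ ≤ D ^ 2 * (S * C) := by gcongr
      _ = (D * S) * (D * C) := by ring
      _ ≤ U₀ ^ 2 * U₂ ^ 2 := by gcongr
      _ = (U₀ * U₂) ^ 2 := by ring
  have hd : 0 < k' - k := by linarith
  have e1 : (k' - k) ^ 2 * (D * S) < (k' - k) ^ 2 * U₀ ^ 2 := by gcongr
  have e2 : k ^ 2 * (D * C) ≤ k ^ 2 * U₂ ^ 2 := by gcongr
  have e3 : 2 * k * (k' - k) * (D * B) ≤ 2 * k * (k' - k) * (U₀ * U₂) := by gcongr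
  -- Both sides are expanded using that `k' k` is the combination of `0` and `k'` with weights `k' -
  -- k` and `k`; the comparison is strict because it is strict at `0`.
  have e4 : k' ^ 2 * (U₀ - k * b) ^ 2 = (k' - k) ^ 2 * U₀ ^ 2 + k ^ 2 * U₂ ^ 2
      + 2 * k * (k' - k) * (U₀ * U₂) := by rw [hU]; ring
  have e5 : k' ^ 2 * (D * (k ^ 2 - 2 * b * k + S)) = (k' - k) ^ 2 * (D * S) + k ^ 2 * (D * C)
      + 2 * k * (k' - k) * (D * B) := by rw [hC, hB]; ring
  rw [h1] at e4
  linarith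

/-- For the angular momentum that makes `Y + M` stationary, `(r² + a² - a L)² / Δ` attains its
minimum over the exterior at `Y + M`. The difference of the two sides, times `Y²`, is `(X - Y)²`
times a sum of nonnegative terms. -/
theorem sq_radial_le {c X Y : ℝ} (hM : 0 ≤ M) (hX : 0 ≤ X) (hY : 0 < Y) (hD : 0 ≤ Y ^ 2 - c ^ 2) :
    (X ^ 2 - c ^ 2) * (4 * (Y + M) ^ 2 * (Y ^ 2 - c ^ 2) / Y ^ 2) ≤
      ((X + M) ^ 2 - (Y + M) ^ 2 + 2 * (Y + M) * (Y ^ 2 - c ^ 2) / Y) ^ 2 := by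
  obtain ⟨D, hDe⟩ : ∃ D, D = Y ^ 2 - c ^ 2 := ⟨_, rfl⟩
  obtain ⟨E, hE⟩ : ∃ E, E = 2 * (Y + M) * D / Y := ⟨_, rfl⟩
  obtain ⟨G, hG⟩ : ∃ G, G = 4 * (Y + M) ^ 2 * D / Y ^ 2 := ⟨_, rfl⟩
  rw [← hDe] at hD
  have hG0 : 0 ≤ G := by rw [hG]; positivity
  have hEY : E * Y = 2 * (Y + M) * D := by rw [hE]; field_simp
  have hGY : G * Y ^ 2 = 4 * (Y + M) ^ 2 * D := by rw [hG]; field_simp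
  rw [← hDe, ← hE, ← hG]
  have key : Y ^ 2 * (((X + M) ^ 2 - (Y + M) ^ 2 + E) ^ 2 - (X ^ 2 - c ^ 2) * G) =
      (X - Y) ^ 2 * (Y ^ 2 * (X ^ 2 + (4 * M + 2 * Y) * X) +
        ((M ^ 2 + (E - (Y + M) ^ 2)) ^ 2 + G * c ^ 2)) := by
    rw [hE, hG, hDe]
    field_simp
    ring
  have : 0 ≤ Y ^ 2 * (((X + M) ^ 2 - (Y + M) ^ 2 + E) ^ 2 - (X ^ 2 - c ^ 2) * G) := by
    rw [key]
    positivity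
  have := nonneg_of_mul_nonneg_right this (by positivity)
  linarith

/-- At the fixed radius `r` the affine function `κ ↦ r² + a² - a l κ` is compared with the convex
function `√(Δ (κ² - 2 a l κ + a² σ))`. It is strictly above at `κ = 0`, and not below at `κ = k'`
because `r'` minimizes for `k'`. So it is strictly above in between, whereas the null condition
demands equality of squares at `κ = k`. -/
theorem not_isSphericalRadius_of_lt (ha : 0 ≤ a) (haM : a < M) {l σ r r' k k' : ℝ}
    (hl : l ^ 2 ≤ σ) (hσ : σ ≤ 1) (h : IsSphericalRadius M a l σ r k)
    (h' : IsSphericalRadius M a l σ r' k') : ¬ k < k' := by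
  intro hkk
  obtain ⟨c, hc⟩ : ∃ c, c = √(M ^ 2 - a ^ 2) := ⟨_, rfl⟩
  have hc0 : 0 < c := by rw [hc]; exact Real.sqrt_pos.2 (by nlinarith)
  have hc2 : c ^ 2 = M ^ 2 - a ^ 2 := by rw [hc]; exact Real.sq_sqrt (by nlinarith)
  have hM : 0 < M := by linarith
  have hX := h.horizon_lt
  have hY := h'.horizon_lt
  rw [← hc] at hX hY
  have hu := Delta_eq_of_critFun (by linarith : M < r) h.crit
  have hu' := Delta_eq_of_critFun (by linarith : M < r') h'.crit
  have hN := h.null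
  have hN' := h'.null
  have hk := h.pos
  obtain ⟨X, rfl⟩ : ∃ X, r = X + M := ⟨r - M, by ring⟩
  obtain ⟨Y, rfl⟩ : ∃ Y, r' = Y + M := ⟨r' - M, by ring⟩
  have eD : ∀ Z, (Z + M) ^ 2 - 2 * M * (Z + M) + a ^ 2 = Z ^ 2 - c ^ 2 := fun Z => by
    linear_combination hc2
  rw [eD, add_sub_cancel_right] at hu hu'
  rw [eD] at hN hN'
  have hXc : c < X := by linarith
  have hYc : c < Y := by linarith
  have hX0 : 0 < X := by linarith
  have hY0 : 0 < Y := by linarith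
  have hD : 0 < X ^ 2 - c ^ 2 := by nlinarith
  have hD' : 0 < Y ^ 2 - c ^ 2 := by nlinarith
  have hC : k' ^ 2 - 2 * (a * l) * k' + a ^ 2 * σ = 4 * (Y + M) ^ 2 * (Y ^ 2 - c ^ 2) / Y ^ 2 := by
    rw [hu'] at hN'
    apply mul_left_cancel₀ hD'.ne'
    rw [show k' ^ 2 - 2 * (a * l) * k' + a ^ 2 * σ = k' ^ 2 - 2 * a * (k' * l) + a ^ 2 * σ by ring,
      ← hN']
    field_simp
    ring
  have hU₂ : (X + M) ^ 2 + a ^ 2 - k' * (a * l) =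
      (X + M) ^ 2 - (Y + M) ^ 2 + 2 * (Y + M) * (Y ^ 2 - c ^ 2) / Y := by
    linear_combination hu'
  refine quadratic_ne_of_affine (b := a * l) (S := a ^ 2 * σ) (U₀ := (X + M) ^ 2 + a ^ 2) hD ?_ hk hkk ?_ (by positivity) ?_ ?_ ?_
  · rw [mul_pow]; gcongr
  · have h1 : a ^ 2 * σ ≤ a ^ 2 := mul_le_of_le_one_right (sq_nonneg a) hσ
    have h2 : (X ^ 2 - c ^ 2) * (a ^ 2 * σ) ≤ (X ^ 2 - c ^ 2) * a ^ 2 := by gcongr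
    have h3 : X ^ 2 - c ^ 2 < (X + M) ^ 2 := by
      have : 0 < c ^ 2 + 2 * X * M + M ^ 2 := by positivity
      linarith
    have h4 : (X ^ 2 - c ^ 2) * a ^ 2 ≤ (X + M) ^ 2 * a ^ 2 := by gcongr
    have h5 : 0 < (X + M) ^ 4 + (X + M) ^ 2 * a ^ 2 + a ^ 4 := by positivity
    linarith
  · rw [hU₂]
    have : (X + M) ^ 2 - (Y + M) ^ 2 + 2 * (Y + M) * (Y ^ 2 - c ^ 2) / Y =
        (X - c) * (X + c + 2 * M) + (Y - c) * (Y ^ 2 + c * Y + 2 * M * c) / Y := by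
      field_simp
      ring
    rw [this]
    have h1 : 0 < X - c := by linarith
    have h2 : 0 < Y - c := by linarith
    positivity
  · rw [hU₂, hC]
    exact sq_radial_le hM.le hX0.le hY0 hD'.le
  · rw [show (X + M) ^ 2 + a ^ 2 - k * (a * l) = (X + M) ^ 2 + a ^ 2 - a * (k * l) by ring, hN]
    ring

/-- The two values of `k` agree by `not_isSphericalRadius_of_lt` used in both directions; then the
axial angular momenta agree, and the radius is the only zero of the strictly increasing `critQuot`.
-/
theorem IsSphericalRadius.eq (ha : 0 ≤ a) (haM : a < M) {l σ r r' k k' : ℝ} (hl : l ^ 2 ≤ σ)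
    (hσ : σ ≤ 1) (h : IsSphericalRadius M a l σ r k) (h' : IsSphericalRadius M a l σ r' k') :
    r = r' ∧ k = k' := by
  have hk : k = k' := le_antisymm
    (not_lt.1 (not_isSphericalRadius_of_lt ha haM hl hσ h' h))
    (not_lt.1 (not_isSphericalRadius_of_lt ha haM hl hσ h h'))
  subst hk
  refine ⟨?_, rfl⟩
  have hs := Real.sqrt_nonneg (M ^ 2 - a ^ 2)
  have hM : 0 < M := by linarith
  have hMc : 0 ≤ M * (M ^ 2 - a ^ 2) := mul_nonneg hM.le (by nlinarith)
  have key : ∀ {r}, IsSphericalRadius M a l σ r k → M < r ∧ critQuot M a r (k * l) = 0 := by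
    intro r h
    have h1 := h.horizon_lt
    have h2 : M < r := by linarith
    have h3 := h.crit
    rw [critFun_eq _ h2.ne'] at h3
    exact ⟨h2, (mul_eq_zero.1 h3).resolve_left (sub_pos.2 h2).ne'⟩
  obtain ⟨h1, h2⟩ := key h
  obtain ⟨h3, h4⟩ := key h'
  rcases lt_trichotomy r r' with h5 | h5 | h5
  · have := critQuot_lt (k * l) hMc h1 h5
    linarith
  · exact h5
  · have := critQuot_lt (k * l) hMc h3 h5
    linarith

end SphericalRadius

end Kerr
open scoped Quaternion

/-! ### Coordinates on orthonormal pairs -/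

namespace quaternionFrames

/-- The imaginary quaternion with given components. -/
def imaginary (x y z : ℝ) : ℍ[ℝ] := ⟨0, x, y, z⟩

@[simp] theorem re_imaginary (x y z : ℝ) : (imaginary x y z).re = 0 := rfl

@[simp] theorem imI_imaginary (x y z : ℝ) : (imaginary x y z).imI = x := rfl

@[simp] theorem imJ_imaginary (x y z : ℝ) : (imaginary x y z).imJ = y := rfl

@[simp] theorem imK_imaginary (x y z : ℝ) : (imaginary x y z).imK = z := rfl

theorem continuous_imaginary {X : Type*} [TopologicalSpace X] {f g h : X → ℝ} (hf : Continuous f)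
    (hg : Continuous g) (hh : Continuous h) : Continuous fun x => imaginary (f x) (g x) (h x) := by
  have e : (fun x => imaginary (f x) (g x) (h x)) = fun x =>
      f x • qi + g x • qj + h x • (qi * qj) := by
    funext x
    ext <;> simp
  rw [e]
  fun_prop

theorem imaginary_mem {n₁ n₂ n₃ e₁ e₂ e₃ : ℝ} (hn : n₁ ^ 2 + n₂ ^ 2 + n₃ ^ 2 = 1)
    (he : e₁ ^ 2 + e₂ ^ 2 + e₃ ^ 2 = 1) (hne : n₁ * e₁ + n₂ * e₂ + n₃ * e₃ = 0) :
    (imaginary n₁ n₂ n₃, imaginary e₁ e₂ e₃) ∈ quaternionFrames := by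
  refine ⟨?_, ?_, ?_⟩ <;> ext <;> simp <;> linarith

theorem exists_imaginary_of_mul_self {n : ℍ[ℝ]} (h : n * n = -1) :
    ∃ x y z, n = imaginary x y z ∧ x ^ 2 + y ^ 2 + z ^ 2 = 1 := by
  have h0 := congrArg QuaternionAlgebra.re h
  have h1 := congrArg QuaternionAlgebra.imI h
  have h2 := congrArg QuaternionAlgebra.imJ h
  have h3 := congrArg QuaternionAlgebra.imK h
  simp at h0 h1 h2 h3
  have hre : n.re = 0 := by
    by_contra hne
    have e1 : n.imI = 0 := mul_left_cancel₀ hne (by linarith)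
    have e2 : n.imJ = 0 := mul_left_cancel₀ hne (by linarith)
    have e3 : n.imK = 0 := mul_left_cancel₀ hne (by linarith)
    rw [e1, e2, e3] at h0
    nlinarith [sq_nonneg n.re]
  refine ⟨n.imI, n.imJ, n.imK, ?_, ?_⟩
  · ext <;> simp [hre]
  · rw [hre] at h0
    linarith

theorem exists_imaginary {p : ℍ[ℝ] × ℍ[ℝ]} (hp : p ∈ quaternionFrames) :
    ∃ n₁ n₂ n₃ e₁ e₂ e₃ : ℝ, p = (imaginary n₁ n₂ n₃, imaginary e₁ e₂ e₃) ∧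
      n₁ ^ 2 + n₂ ^ 2 + n₃ ^ 2 = 1 ∧ e₁ ^ 2 + e₂ ^ 2 + e₃ ^ 2 = 1 ∧
      n₁ * e₁ + n₂ * e₂ + n₃ * e₃ = 0 := by
  obtain ⟨n, e⟩ := p
  obtain ⟨h1, h2, h3⟩ := hp
  obtain ⟨n₁, n₂, n₃, rfl, hn⟩ := exists_imaginary_of_mul_self h1
  obtain ⟨e₁, e₂, e₃, rfl, he⟩ := exists_imaginary_of_mul_self h2
  refine ⟨_, _, _, _, _, _, rfl, hn, he, ?_⟩
  have := congrArg QuaternionAlgebra.re h3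
  simp at this
  linarith

end quaternionFrames

namespace Kerr

/-! ### The photon covectors in polar form, and bounds for them -/

section PhotonFrames

variable {M a : ℝ}

/-- The null condition for covectors with vanishing radial momentum. -/
theorem nullFun_eq_zero_iff {q p : Fin 4 → ℝ} (hΔ : Delta M a q ≠ 0) (he : p 0 = -1)
    (hα : dilation q p = 0) : nullFun M a q p = 0 ↔
      (radius q ^ 2 + a ^ 2 - a * angMom q p) ^ 2 = Delta M a q *
        (radius q ^ 2 * spatialSq p - 2 * a * angMom q p
          + a ^ 2 * (1 - q 3 ^ 2 / radius q ^ 2)) := by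
  rw [nullFun_eq he, hα]
  generalize a ^ 2 * (1 - q 3 ^ 2 / radius q ^ 2) = t
  constructor
  · intro h
    field_simp at h
    linear_combination -h
  · intro h
    rw [h]
    field_simp
    ring

theorem radius_gt_of_mem_DOC {q : Fin 4 → ℝ} (hq : q ∈ DOC M a) :
    M < radius q := by
  have h1 : M + √(M ^ 2 - a ^ 2) < radius q := hq
  have h2 : 0 ≤ √(M ^ 2 - a ^ 2) := Real.sqrt_nonneg _
  linarith

/-- With vanishing spatial momentum also `L = 0`, and the null condition would read `(r² + a²)² = Δ
a² sin² ϑ`, which is impossible because `Δ < r² + a²`. So the momentum has a direction. -/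
theorem spatialSq_pos_of_mem_photonSet (haM : a < M) (ha : 0 ≤ a)
    {w : (Fin 4 → ℝ) × (Fin 4 → ℝ)} (hw : w ∈ photonSet M a) : 0 < spatialSq w.2 := by
  obtain ⟨-, he, hD, hα, -, hN⟩ := hw
  have hr := radius_pos_of_mem_DOC haM ha hD
  have hΔ := Delta_pos_of_mem_DOC haM ha hD
  have hM : 0 < M := by linarith
  rw [nullFun_eq_zero_iff hΔ.ne' he hα] at hN
  refine lt_of_le_of_ne (by unfold spatialSq; positivity) fun h => ?_
  have hL : angMom w.1 w.2 = 0 := by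
    have := angMom_sq_le w.1 w.2
    rw [← h, mul_zero] at this
    exact pow_eq_zero_iff two_ne_zero |>.1 (le_antisymm this (sq_nonneg _))
  rw [hL, ← h] at hN
  have h1 := mul_le_of_le_one_right (sq_nonneg a) (sinSq_mem hr).2
  obtain ⟨t, ht⟩ : ∃ t, t = a ^ 2 * (1 - w.1 3 ^ 2 / radius w.1 ^ 2) := ⟨_, rfl⟩
  rw [← ht] at hN h1
  have h2 : Delta M a w.1 < radius w.1 ^ 2 + a ^ 2 := by
    have : 0 < 2 * M * radius w.1 := by positivity
    unfold Delta
    linarith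
  have h3 : Delta M a w.1 * t ≤ Delta M a w.1 * a ^ 2 := by gcongr
  have h4 : Delta M a w.1 * a ^ 2 ≤ (radius w.1 ^ 2 + a ^ 2) * a ^ 2 := by gcongr
  have h5 : 0 < radius w.1 ^ 4 + radius w.1 ^ 2 * a ^ 2 := by positivity
  linarith

/-- In polar coordinates the photons of constant radius are the solutions of the radius
equations. -/
theorem mem_photonSet_iff (haM : a < M) (ha : 0 ≤ a) {q p : Fin 4 → ℝ} {P : ℝ} (hr : 0 < radius q)
    (hP : 0 < P) (hPp : P ^ 2 = spatialSq p) :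
    (q, p) ∈ photonSet M a ↔ q 0 = 0 ∧ p 0 = -1 ∧ dilation q p = 0 ∧
      IsSphericalRadius M a (angMom q p / (radius q * P)) (1 - q 3 ^ 2 / radius q ^ 2) (radius q)
        (radius q * P) := by
  have hk : 0 < radius q * P := by positivity
  have e1 : radius q * P * (angMom q p / (radius q * P)) = angMom q p := by field_simp
  have e2 : (radius q * P) ^ 2 = radius q ^ 2 * spatialSq p := by rw [mul_pow, hPp]
  constructor
  · rintro ⟨h0, he, hD, hα, hc, hN⟩
    refine ⟨h0, he, hα, hD, hk, ?_, ?_⟩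
    · rw [e1]; exact hc
    · rw [e1, e2]
      exact (nullFun_eq_zero_iff (Delta_pos_of_mem_DOC haM ha hD).ne' he hα).1 hN
  · rintro ⟨h0, he, hα, hD, -, hc, hN⟩
    rw [e1] at hc hN
    rw [e2] at hN
    exact ⟨h0, he, hD, hα, hc,
      (nullFun_eq_zero_iff (Delta_pos_of_mem_DOC haM ha hD).ne' he hα).2 hN⟩

/-- The photon covectors have bounded radius and momentum. -/
theorem photonSet_bounds (haM : a < M) (ha : 0 ≤ a) {w : (Fin 4 → ℝ) × (Fin 4 → ℝ)}
    (hw : w ∈ photonSet M a) : spatialSq w.2 ≤ 12 ∧ radius w.1 ≤ 7 * M ∧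
      (radius w.1 ^ 2 * spatialSq w.2 - 2 * a * angMom w.1 w.2
          + a ^ 2 * (1 - w.1 3 ^ 2 / radius w.1 ^ 2)) * (radius w.1 - M) ^ 2 =
        4 * radius w.1 ^ 2 * Delta M a w.1 := by
  obtain ⟨-, he, hD, hα, hc, hN⟩ := hw
  have hr := radius_pos_of_mem_DOC haM ha hD
  have hΔ := Delta_pos_of_mem_DOC haM ha hD
  have hMr := radius_gt_of_mem_DOC hD
  have hM : 0 < M := by linarith
  have hsq : 0 < √(M ^ 2 - a ^ 2) := Real.sqrt_pos.2 (by nlinarith)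
  have hsq2 : √(M ^ 2 - a ^ 2) ^ 2 = M ^ 2 - a ^ 2 := Real.sq_sqrt (by nlinarith)
  have hDr : M + √(M ^ 2 - a ^ 2) < radius w.1 := hD
  rw [nullFun_eq_zero_iff hΔ.ne' he hα] at hN
  have hu := Delta_eq_of_critFun hMr hc
  have hL2 : angMom w.1 w.2 ^ 2 ≤ radius w.1 ^ 2 * spatialSq w.2 := by
    refine (angMom_sq_le _ _).trans ?_
    have : 0 ≤ spatialSq w.2 := by unfold spatialSq; positivity
    gcongr
    rw [radius_sq]
    linarith [sq_nonneg (w.1 3)]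
  have ht0 : 0 ≤ a ^ 2 * (1 - w.1 3 ^ 2 / radius w.1 ^ 2) :=
    mul_nonneg (sq_nonneg a) (sinSq_mem hr).1
  have hΔe : Delta M a w.1 = radius w.1 ^ 2 - 2 * M * radius w.1 + a ^ 2 := rfl
  obtain ⟨r, hr'⟩ : ∃ r, r = radius w.1 := ⟨_, rfl⟩
  obtain ⟨L, hL⟩ : ∃ L, L = angMom w.1 w.2 := ⟨_, rfl⟩
  obtain ⟨W, hW⟩ : ∃ W, W = spatialSq w.2 := ⟨_, rfl⟩
  obtain ⟨t, ht⟩ : ∃ t, t = a ^ 2 * (1 - w.1 3 ^ 2 / radius w.1 ^ 2) := ⟨_, rfl⟩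
  obtain ⟨D, hDe⟩ : ∃ D, D = Delta M a w.1 := ⟨_, rfl⟩
  obtain ⟨c, hce⟩ : ∃ c, c = √(M ^ 2 - a ^ 2) := ⟨_, rfl⟩
  rw [← ht] at hN ht0 ⊢
  rw [← hΔe] at hu
  rw [← hce] at hsq hsq2 hDr
  rw [← hr', ← hL, ← hDe] at hu
  rw [← hr', ← hL, ← hW, ← hDe] at hN
  rw [← hr', ← hL, ← hW] at hL2
  rw [← hr', ← hDe] at hΔe
  rw [← hr', ← hL] at hc
  rw [← hr'] at hr hMr hDr
  rw [← hDe] at hΔ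
  rw [← hr', ← hL, ← hW, ← hDe]
  have hX : 0 < r - M := by linarith
  have heq : (r ^ 2 * W - 2 * a * L + t) * (r - M) ^ 2 = 4 * r ^ 2 * D := by
    rw [hu] at hN
    apply mul_left_cancel₀ hΔ.ne'
    rw [← mul_assoc, ← hN]
    field_simp
    ring
  have hDX : D ≤ (r - M) ^ 2 := by
    rw [hΔe]
    have : a ^ 2 ≤ M ^ 2 := by gcongr
    linarith
  have hC : r ^ 2 * W - 2 * a * L + t ≤ 4 * r ^ 2 := by
    have h1 : 4 * r ^ 2 * D ≤ 4 * r ^ 2 * (r - M) ^ 2 := by gcongr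
    rw [← heq] at h1
    exact le_of_mul_le_mul_right h1 (by positivity)
  have ha2 : a ^ 2 ≤ r ^ 2 := by gcongr; linarith
  -- From `r² W ≤ 4 r² + 2 a L`, `2 a L ≤ L² / 2 + 2 a²`, `L² ≤ r² W` and `a² ≤ r²` one gets `r² W ≤
  -- 6 r² + r² W / 2`.
  have hrW : r ^ 2 * W ≤ 12 * r ^ 2 := by
    have h1 := sq_nonneg (L - 2 * a)
    linarith
  have hWb : W ≤ 12 := by
    rw [mul_comm] at hrW
    exact le_of_mul_le_mul_right hrW (by positivity)
  refine ⟨hWb, ?_, heq⟩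
  have hLr : |L| ≤ 4 * r := by
    refine abs_le_of_sq_le_sq ?_ (by linarith)
    have : 0 < r ^ 2 := by positivity
    linarith
  obtain ⟨h1, -⟩ := abs_le.1 hLr
  have haL : -(M * (4 * r)) ≤ a * L := by
    have h2 : a * (-(4 * r)) ≤ a * L := by gcongr
    have h3 : a * (4 * r) ≤ M * (4 * r) := by gcongr
    linarith
  have hcM : c ≤ M := (abs_le_of_sq_le_sq' (by linarith [sq_nonneg a]) hM.le).2
  have hcc : c ^ 2 / (r - M) ≤ M := by
    rw [div_le_iff₀ hX]
    have h2 : c * c ≤ M * (r - M) := by gcongr; linarith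
    linarith
  rw [critFun_eq L hMr.ne'] at hc
  have hq := (mul_eq_zero.1 hc).resolve_left hX.ne'
  rw [critQuot, ← hsq2, mul_div_assoc] at hq
  -- If `r - M > 6 M` then `critQuot` is at least `(r - M)² - 4 M r - 5 M²`, which is positive.
  by_contra! hlt
  have h4 : 2 * M * (c ^ 2 / (r - M)) ≤ 2 * M * M := by gcongr
  have h5 : (6 * M) * (r - M) ≤ (r - M) * (r - M) := by gcongr; linarith
  have h6 : 6 * M * M < (r - M) * M := by gcongr; linarith
  linarith [sq_nonneg a]

end PhotonFrames

end Kerr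
open scoped Quaternion

namespace Kerr

/-! ### The homeomorphism between photon covectors and orthonormal pairs -/

section PhotonHomeomorph

variable {M a : ℝ}

/-- Boundedness is `photonSet_bounds`. For closedness the null condition is cleared of denominators
and the strict inequality at the horizon is weakened; no new points arise, since a covector on the
horizon satisfying the remaining equations would have `r² + a² - a L = 0`. -/
theorem isCompact_photonSet (haM : a < M) (ha : 0 ≤ a) : IsCompact (photonSet M a) := by
  have hM : 0 < M := by linarith
  have hsq : 0 < √(M ^ 2 - a ^ 2) := Real.sqrt_pos.2 (by nlinarith)
  have hsq2 : √(M ^ 2 - a ^ 2) ^ 2 = M ^ 2 - a ^ 2 := Real.sq_sqrt (by nlinarith)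
  have hclosed : photonSet M a = {w | w.1 0 = 0 ∧ w.2 0 = -1 ∧
      M + √(M ^ 2 - a ^ 2) ≤ radius w.1 ∧ dilation w.1 w.2 = 0 ∧
      critFun M a (radius w.1) (angMom w.1 w.2) = 0 ∧
      (radius w.1 ^ 2 * (radius w.1 ^ 2 * spatialSq w.2 - 2 * a * angMom w.1 w.2)
          + a ^ 2 * (radius w.1 ^ 2 - w.1 3 ^ 2)) * (radius w.1 - M) ^ 2 =
        4 * radius w.1 ^ 4 * Delta M a w.1} := by
    have e : ∀ w : (Fin 4 → ℝ) × (Fin 4 → ℝ), 0 < radius w.1 →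
        radius w.1 ^ 2 * (radius w.1 ^ 2 * spatialSq w.2 - 2 * a * angMom w.1 w.2)
          + a ^ 2 * (radius w.1 ^ 2 - w.1 3 ^ 2) =
        radius w.1 ^ 2 * (radius w.1 ^ 2 * spatialSq w.2 - 2 * a * angMom w.1 w.2
          + a ^ 2 * (1 - w.1 3 ^ 2 / radius w.1 ^ 2)) := fun w h => by
      field_simp
    ext w
    constructor
    · intro hw
      obtain ⟨-, -, h⟩ := photonSet_bounds haM ha hw
      obtain ⟨h0, he, hD, hα, hc, hN⟩ := hw
      refine ⟨h0, he, le_of_lt hD, hα, hc, ?_⟩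
      rw [e w (radius_pos_of_mem_DOC haM ha hD), mul_assoc, h]
      ring
    · rintro ⟨h0, he, hD, hα, hc, h⟩
      have hr : 0 < radius w.1 := by linarith
      have hX : 0 < radius w.1 - M := by linarith
      rw [e w hr] at h
      obtain ⟨C, hC⟩ : ∃ C, C = radius w.1 ^ 2 * spatialSq w.2 - 2 * a * angMom w.1 w.2
          + a ^ 2 * (1 - w.1 3 ^ 2 / radius w.1 ^ 2) := ⟨_, rfl⟩
      rw [← hC] at h
      rcases hD.lt_or_eq with hD | hD
      · have hΔ := Delta_pos_of_mem_DOC haM ha hD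
        refine ⟨h0, he, hD, hα, hc, (nullFun_eq_zero_iff hΔ.ne' he hα).2 ?_⟩
        have hu := Delta_eq_of_critFun (by linarith : M < radius w.1) hc
        have hΔe : radius w.1 ^ 2 - 2 * M * radius w.1 + a ^ 2 = Delta M a w.1 := rfl
        rw [hu, ← hC, hΔe]
        have h1 : C * (radius w.1 - M) ^ 2 = 4 * radius w.1 ^ 2 * Delta M a w.1 := by
          apply mul_left_cancel₀ (pow_pos hr 2).ne'
          linear_combination h
        field_simp
        linear_combination (-1) * h1
      · exfalso
        have hΔ : Delta M a w.1 = 0 := by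
          rw [Delta, ← hD]
          linear_combination hsq2
        have hC0 : C = 0 := by
          rw [hΔ, mul_zero] at h
          simpa [hr.ne', hX.ne'] using h
        have hu : radius w.1 ^ 2 + a ^ 2 - a * angMom w.1 w.2 = 0 := by
          have h1 : 2 * radius w.1 * Delta M a w.1 - (radius w.1 - M) *
              (radius w.1 ^ 2 + a ^ 2 - a * angMom w.1 w.2) = 0 := hc
          rw [hΔ, mul_zero, zero_sub, neg_eq_zero] at h1
          exact (mul_eq_zero.1 h1).resolve_left hX.ne'
        -- On the horizon the quotient by `Δ = 0` in `nullFun` has the value zero, so `nullFun`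
        -- vanishes there and the lemma applies.
        refine ne_zero_of_nullFun (M := M) hr he ?_ hα hu
        rw [nullFun_eq he, hu, hα, hΔ]
        rw [hC0] at hC
        simp only [zero_pow two_ne_zero, zero_div, mul_zero, sub_zero]
        linarith
  refine (isCompact_box (M + √(M ^ 2 - a ^ 2)) (7 * M) 13).of_isClosed_subset ?_ fun w hw => ?_
  · rw [hclosed]
    have hr : Continuous fun w : (Fin 4 → ℝ) × (Fin 4 → ℝ) => radius w.1 :=
      continuous_radius.comp continuous_fst
    have hα : Continuous fun w : (Fin 4 → ℝ) × (Fin 4 → ℝ) => dilation w.1 w.2 := by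
      unfold dilation; fun_prop
    have hL : Continuous fun w : (Fin 4 → ℝ) × (Fin 4 → ℝ) => angMom w.1 w.2 := by
      unfold angMom; fun_prop
    have hW : Continuous fun w : (Fin 4 → ℝ) × (Fin 4 → ℝ) => spatialSq w.2 := by
      unfold spatialSq; fun_prop
    refine (isClosed_eq (by fun_prop) continuous_const).inter
      ((isClosed_eq (by fun_prop) continuous_const).inter
      ((isClosed_le continuous_const hr).inter ((isClosed_eq hα continuous_const).inter
      ((isClosed_eq ?_ continuous_const).inter (isClosed_eq (by fun_prop) ?_)))))
    · unfold critFun; fun_prop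
    · unfold Delta; fun_prop
  · obtain ⟨h1, h2, -⟩ := photonSet_bounds haM ha hw
    obtain ⟨h0, he, hD, -⟩ := hw
    refine ⟨by rw [h0]; norm_num, le_of_lt hD, h2, fun i => ?_⟩
    exact (abs_apply_le (by norm_num) he h1 i).trans (by norm_num)

open quaternionFrames in
/-- The direction of the position and the direction of the momentum. -/
noncomputable def directions (w : (Fin 4 → ℝ) × (Fin 4 → ℝ)) : ℍ[ℝ] × ℍ[ℝ] :=
  (imaginary (w.1 1 / radius w.1) (w.1 2 / radius w.1) (w.1 3 / radius w.1),
    imaginary (w.2 1 / √(spatialSq w.2)) (w.2 2 / √(spatialSq w.2)) (w.2 3 / √(spatialSq w.2)))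

theorem directions_mem (haM : a < M) (ha : 0 ≤ a) {w : (Fin 4 → ℝ) × (Fin 4 → ℝ)}
    (hw : w ∈ photonSet M a) : directions w ∈ quaternionFrames := by
  have hP := Real.sqrt_pos.2 (spatialSq_pos_of_mem_photonSet haM ha hw)
  have hP2 := Real.sq_sqrt (spatialSq_pos_of_mem_photonSet haM ha hw).le
  have hr := radius_pos_of_mem_DOC haM ha hw.2.2.1
  have hr2 := radius_sq w.1
  refine quaternionFrames.imaginary_mem ?_ ?_ ?_
  · field_simp
    exact hr2.symm
  · rw [div_pow, div_pow, div_pow, hP2]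
    have := (spatialSq_pos_of_mem_photonSet haM ha hw).ne'
    field_simp
    rfl
  · have h : dilation w.1 w.2 = 0 := hw.2.2.2.1
    rw [dilation] at h
    field_simp
    rw [h, mul_zero]

/-- The directions determine `l`, the axial component of their cross product, and `σ`; these
determine `r` and `k = r |p|` by `IsSphericalRadius.eq`, hence the covector. -/
theorem injOn_directions (haM : a < M) (ha : 0 ≤ a) : InjOn directions (photonSet M a) := by
  rintro ⟨q, p⟩ hw ⟨q', p'⟩ hw' h
  have hP := Real.sqrt_pos.2 (spatialSq_pos_of_mem_photonSet haM ha hw)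
  have hP2 := Real.sq_sqrt (spatialSq_pos_of_mem_photonSet haM ha hw).le
  have hP' := Real.sqrt_pos.2 (spatialSq_pos_of_mem_photonSet haM ha hw')
  have hP2' := Real.sq_sqrt (spatialSq_pos_of_mem_photonSet haM ha hw').le
  have hr : 0 < radius q := radius_pos_of_mem_DOC haM ha hw.2.2.1
  have hr' : 0 < radius q' := radius_pos_of_mem_DOC haM ha hw'.2.2.1
  simp only at hP hP2 hP' hP2'
  obtain ⟨h0, he, -, hs⟩ := (mem_photonSet_iff haM ha hr hP hP2).1 hw
  obtain ⟨h0', he', -, hs'⟩ := (mem_photonSet_iff haM ha hr' hP' hP2').1 hw'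
  have n1 : q 1 / radius q = q' 1 / radius q' := congrArg (fun x => x.1.imI) h
  have n2 : q 2 / radius q = q' 2 / radius q' := congrArg (fun x => x.1.imJ) h
  have n3 : q 3 / radius q = q' 3 / radius q' := congrArg (fun x => x.1.imK) h
  have e1 : p 1 / √(spatialSq p) = p' 1 / √(spatialSq p') := congrArg (fun x => x.2.imI) h
  have e2 : p 2 / √(spatialSq p) = p' 2 / √(spatialSq p') := congrArg (fun x => x.2.imJ) h
  have e3 : p 3 / √(spatialSq p) = p' 3 / √(spatialSq p') := congrArg (fun x => x.2.imK) h
  have hl : ∀ q p : Fin 4 → ℝ, angMom q p / (radius q * √(spatialSq p)) =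
      q 1 / radius q * (p 2 / √(spatialSq p)) - q 2 / radius q * (p 1 / √(spatialSq p)) :=
    fun q p => by rw [angMom]; ring
  rw [hl, ← div_pow] at hs hs'
  rw [← n1, ← n2, ← n3, ← e1, ← e2] at hs'
  have hlσ : (q 1 / radius q * (p 2 / √(spatialSq p)) - q 2 / radius q * (p 1 / √(spatialSq p))) ^ 2
      ≤ 1 - (q 3 / radius q) ^ 2 := by
    rw [← hl, div_pow, div_pow, sinSq_eq hr, div_le_div_iff₀ (by positivity) (by positivity),
      mul_pow, hP2]
    have := mul_le_mul_of_nonneg_right (angMom_sq_le q p) (sq_nonneg (radius q))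
    linarith
  obtain ⟨er, ek⟩ := hs.eq ha haM hlσ (by linarith [sq_nonneg (q 3 / radius q)]) hs'
  rw [← er] at ek n1 n2 n3
  have ep := mul_left_cancel₀ hr.ne' ek
  rw [← ep] at e1 e2 e3
  rw [div_left_inj' hr.ne'] at n1 n2 n3
  rw [div_left_inj' hP.ne'] at e1 e2 e3
  refine Prod.ext (funext fun i => ?_) (funext fun i => ?_)
  · fin_cases i
    exacts [h0.trans h0'.symm, n1, n2, n3]
  · fin_cases i
    exacts [he.trans he'.symm, e1, e2, e3]

theorem surjOn_directions (haM : a < M) (ha : 0 ≤ a) :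
    SurjOn directions (photonSet M a) quaternionFrames := by
  intro f hf
  obtain ⟨n₁, n₂, n₃, e₁, e₂, e₃, rfl, hn, he, hne⟩ := quaternionFrames.exists_imaginary hf
  -- By Lagrange's identity the axial component of `n × e` is at most the length of the horizontal
  -- part of `n`; this is the hypothesis `l² ≤ σ`.
  have hl : (n₁ * e₂ - n₂ * e₁) ^ 2 ≤ 1 - n₃ ^ 2 := by
    have h1 := sq_nonneg (n₁ * e₁ + n₂ * e₂)
    have h2 : 0 ≤ (n₁ ^ 2 + n₂ ^ 2) * e₃ ^ 2 := by positivity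
    have h3 : (n₁ ^ 2 + n₂ ^ 2) * (e₁ ^ 2 + e₂ ^ 2 + e₃ ^ 2) = 1 - n₃ ^ 2 := by
      rw [he]; linarith
    linarith
  obtain ⟨r, k, hs⟩ := exists_isSphericalRadius ha haM hl (by linarith [sq_nonneg n₃])
  have hr : 0 < r := by
    have := hs.horizon_lt
    have := Real.sqrt_nonneg (M ^ 2 - a ^ 2)
    linarith
  have hk := hs.pos
  have hP : 0 < k / r := by positivity
  set q : Fin 4 → ℝ := ![0, r * n₁, r * n₂, r * n₃] with hq
  set p : Fin 4 → ℝ := ![-1, k / r * e₁, k / r * e₂, k / r * e₃] with hp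
  have q1 : q 1 = r * n₁ := rfl
  have q2 : q 2 = r * n₂ := rfl
  have q3 : q 3 = r * n₃ := rfl
  have p1 : p 1 = k / r * e₁ := rfl
  have p2 : p 2 = k / r * e₂ := rfl
  have p3 : p 3 = k / r * e₃ := rfl
  have hrad : radius q = r := by
    rw [radius, q1, q2, q3, show (r * n₁) ^ 2 + (r * n₂) ^ 2 + (r * n₃) ^ 2 =
      r ^ 2 * (n₁ ^ 2 + n₂ ^ 2 + n₃ ^ 2) by ring, hn, mul_one, Real.sqrt_sq hr.le]
  have hsp : spatialSq p = (k / r) ^ 2 := by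
    rw [spatialSq, p1, p2, p3, show (k / r * e₁) ^ 2 + (k / r * e₂) ^ 2 + (k / r * e₃) ^ 2 =
      (k / r) ^ 2 * (e₁ ^ 2 + e₂ ^ 2 + e₃ ^ 2) by ring, he, mul_one]
  refine ⟨(q, p), (mem_photonSet_iff haM ha (hrad ▸ hr) hP hsp.symm).2 ⟨rfl, rfl, ?_, ?_⟩, ?_⟩
  · rw [dilation, q1, q2, q3, p1, p2, p3]
    linear_combination r * (k / r) * hne
  · rw [hrad, angMom, q1, q2, q3, p1, p2]
    convert! hs using 1
    · field_simp
    · field_simp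
    · field_simp
  · simp only [directions, hrad, hsp, Real.sqrt_sq hP.le, q1, q2, q3, p1, p2, p3]
    rw [mul_div_cancel_left₀ _ hr.ne', mul_div_cancel_left₀ _ hr.ne', mul_div_cancel_left₀ _ hr.ne',
      mul_div_cancel_left₀ _ hP.ne', mul_div_cancel_left₀ _ hP.ne', mul_div_cancel_left₀ _ hP.ne']

theorem continuous_directions (haM : a < M) (ha : 0 ≤ a) :
    Continuous fun w : photonSet M a => directions w := by
  have hr : Continuous fun w : photonSet M a => radius w.1.1 :=
    continuous_radius.comp (continuous_fst.comp continuous_subtype_val)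
  have hP : Continuous fun w : photonSet M a => √(spatialSq w.1.2) := by
    unfold spatialSq; fun_prop
  have hr0 : ∀ w : photonSet M a, radius w.1.1 ≠ 0 := fun w =>
    (radius_pos_of_mem_DOC haM ha w.2.2.2.1).ne'
  have hP0 : ∀ w : photonSet M a, √(spatialSq w.1.2) ≠ 0 := fun w =>
    (Real.sqrt_pos.2 (spatialSq_pos_of_mem_photonSet haM ha w.2)).ne'
  refine Continuous.prodMk ?_ ?_ <;>
  refine quaternionFrames.continuous_imaginary ?_ ?_ ?_ <;>
  exact Continuous.div (by fun_prop) (by assumption) (by assumption)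

/-- The photon covectors are parametrized by the orthonormal pairs of vectors. -/
theorem nonempty_homeomorph_photonSet (haM : a < M) (ha : 0 ≤ a) :
    Nonempty (quaternionFrames ≃ₜ photonSet M a) := by
  have hcomp : CompactSpace (photonSet M a) :=
    isCompact_iff_compactSpace.1 (isCompact_photonSet haM ha)
  have hbij : BijOn directions (photonSet M a) quaternionFrames :=
    ⟨fun _ => directions_mem haM ha, injOn_directions haM ha, surjOn_directions haM ha⟩
  have hcont : Continuous (BijOn.equiv directions hbij) :=
    (continuous_directions haM ha).subtype_mk _
  -- The bijection is continuous from a compact space to a Hausdorff one, so continuity of the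
  -- inverse, that is of `r` and `k` in the directions, needs no separate proof.
  exact ⟨hcont.homeoOfEquivCompactToT2.symm⟩

end PhotonHomeomorph

end Kerr

theorem proposition5 (M a : ℝ) (ha : 0 ≤ a) (haM : a < M) :
    PathConnectedSpace (Kerr.photonSlice M a) ∧
      ∀ w : Kerr.photonSlice M a,
        Nonempty (FundamentalGroup (Kerr.photonSlice M a) w ≃* Multiplicative (ZMod 2)) := by
  rw [Kerr.photonSlice_eq_photonSet haM ha]
  obtain ⟨e⟩ := Kerr.nonempty_homeomorph_photonSet haM ha
  exact quaternionFrames.pathConnectedSpace_and_fundamentalGroup e
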